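/- **Setting.** Let $d\ge 3$, and let $\widehat f(p)=\int e^{-2\pi i p\cdot x}f(x)\,dx$. Let $B:\mathbb R^d\to\mathbb R$ be a spherically symmetric Schwartz function such that $\widehat B$ has compact support and $0\in\operatorname{supp}\widehat B$. Let $\mathbf P_v$ be a probability measure on $\mathbb R$ with moments $m_1=m_3=m_5=0$, $m_2=1$, $m_{2d}<\infty$. Let $\psi_0$ be a function on $\mathbb R^d$ with $\widehat\psi_0\in C_c^\infty(\mathbb R^d)$. Let $\lambda,\eta>0$, $t\ge0$ and $k\in\{0,1,2,\dots\}$. Put $e(p)=\frac12p^2$ and $$\theta(p)=\lim_{\epsilon\to0+}\int\frac{|\widehat B(q-p)|^2\,dq}{e(p)-e(q)+i\epsilon},\qquad \omega(p)=e(p)+\lambda^2\theta(p).$$ **Finite box.** For $L\ge1$ let $\Lambda_L=[-L/2,L/2]^d$ with periodic boundary conditions, $\Lambda_L^*=(\mathbb Z/L)^d$, $\int_{\Lambda_L^*}g(p)\,dp=L^{-d}\sum_{p\in\Lambda_L^*}g(p)$, and $\widehat f(p)=\int_{\Lambda_L}e^{-2\pi ip\cdot x}f(x)\,dx$ for functions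 $f$ on $\Lambda_L$ and $p\in\Lambda_L^*$. The norm $\|\cdot\|_L$ is that of $L^2(\Lambda_L)$. Let $\mathbf E'$ be the expectation with respect to $(M,(y_\gamma)_{\gamma\le M},(v_\gamma)_{\gamma\le M})$, where $M$ is Poisson with mean $L^d$ and, given $M$, the $y_\gamma$ are i.i.d. uniform on $\Lambda_L$, the $v_\gamma$ are i.i.d. with law $\mathbf P_v$, and the two families are independent. Let $V_\gamma(x)=v_\gamma\sum_{n\in\mathbb Z^d}B(x-y_\gamma+Ln)$, and let $e^{-isH_0}$ be multiplication by $e^{-is\omega(p)}$, $p\in\Lambda_L^*$, in Fourier space. Let $\chi_L$ be smooth real functions with $\operatorname{supp}\chi_L\subset\Lambda_L$, $\chi_L=1$ on $\Lambda_{L/2}$, $|\nabla\chi_L|\le C/L$ with $C$ independent of $L$, and put $\psi_0'=\chi_L\psi_0$. Define $$\psi^{nr}_{t,k}=(-i)^k\lambda^k\sum_{\gamma}\int_{s_j\ge0}\Big(\prod_{j=1}^{k+1}ds_j\Big)\delta\Big(t-\sum_{j=1}^{k+1}s_j\Big)\,e^{-is_{k+1}H_0}V_{\gamma_k}e^{-is_kH_0}\cdots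 V_{\gamma_1}e^{-is_1H_0}\psi_0',$$ the sum being over all $(\gamma_1,\dots,\gamma_k)\in\{1,\dots,M\}^k$ with pairwise distinct entries. For $\varepsilon>0$ and a Schwartz function $\mathcal O:\mathbb R^d\times\mathbb R^d\to\mathbb C$ let $\widehat{\mathcal O}(\xi,v)=\int e^{-2\pi i\xi\cdot X}\mathcal O(X,v)\,dX$, $\mathcal O_L(X,v)=\chi_L(X)\mathcal O(X,v)$, $\widehat W^\varepsilon_\psi(\xi,v)=\overline{\widehat\psi(v-\frac{\varepsilon\xi}2)}\,\widehat\psi(v+\frac{\varepsilon\xi}2)$, and $$\langle\widehat{\mathcal O}_L,\widehat W^\varepsilon_\psi\rangle_L=\varepsilon^{-d}\iint_{\Lambda_L^*\times\Lambda_L^*}dp\,d\tilde p\;\widehat{\mathcal O}_L(\xi,v)\,\overline{\widehat W^\varepsilon_\psi(\xi,v)}\Big|_{\xi=(p-\tilde p)/\varepsilon,\;v=(p+\tilde p)/2}.$$ **Feynman graphs.** Let $\mathfrak S_k$ be the permutations and $\mathcal A_k$ the partitions $\mathbf A$ (into nonempty blocks $A_\nu$) of $\{1,\dots,k\}$. Let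 $c(\mathbf A)=\prod_\nu c(|A_\nu|)$ with $c(1)=1$ and $c(n)=0$ for $n\ge2$. For $\xi\in\mathbb R^d$, $p,\tilde p\in(\mathbb R^d)^{k+1}$ and a continuous function $Q:\mathbb R^d\to\mathbb C$ put $$\Delta_\xi=\delta\big(\xi+\tilde p_{k+1}-p_{k+1}\big)\prod_{\nu}\delta\Big(\sum_{j\in A_\nu}(p_{j+1}-p_j)-\sum_{j\in\sigma(A_\nu)}(\tilde p_{j+1}-\tilde p_j)\Big),$$ $$\mathcal M=\prod_{j=1}^k\overline{\widehat B(p_j-p_{j+1})}\,\widehat B(\tilde p_{j+1}-\tilde p_j)\;\,\overline{\widehat\psi_0(p_1)}\,\widehat\psi_0(\tilde p_1)\,Q\big(\tfrac12(p_{k+1}+\tilde p_{k+1})\big).$$ For $k\ge1$ define $$V^\circ_\xi(\mathbf A,\sigma,Q)=\frac{\lambda^{2k}e^{2t\eta}}{(2\pi)^2}\iint_{\mathbb R^2}d\alpha\,d\beta\,e^{it(\alpha-\beta)}\int dp\,d\tilde p\;\Delta_\xi\,\mathcal M\prod_{j=1}^{k+1}\frac1{\alpha-\overline{\omega(p_j)}-i\eta}\,\frac1{\beta-\omega(\tilde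 p_j)+i\eta},$$ and for $k=0$ define $V^\circ_\xi(\mathbf A,\sigma,Q)=\int dp\,d\tilde p\;\Delta_\xi\,\mathcal M\,e^{it\overline{\omega(p_1)}}e^{-it\omega(\tilde p_1)}$. (Integrals against $\Delta_\xi$ are the limits as $r\to0+$ of those with each $\delta$ replaced by the normalized indicator function of the ball of radius $r$.) **Proposition 6.3.** For every $L\ge1$ the random variables below are integrable, and $$\lim_{L\to\infty}\mathbf E'\|\psi^{nr}_{t,k}\|_L^2=\sum_{\sigma\in\mathfrak S_k}\sum_{\mathbf A\in\mathcal A_k}c(\mathbf A)\,V^\circ_{0}(\mathbf A,\sigma,1).$$ For every $\varepsilon>0$ and every Schwartz function $\mathcal O$, with $Q_\xi(v)=\widehat{\mathcal O}(\xi,v)$, $$\lim_{L\to\infty}\mathbf E'\langle\widehat{\mathcal O}_L,\widehat W^\varepsilon_{\psi^{nr}_{t,k}}\rangle_L=\sum_{\sigma\in\mathfrak S_k}\sum_{\mathbf A\in\mathcal A_k}c(\mathbf A)\int d\xi\;V^\circ_{\varepsilon\xi}(\mathbf A,\sigma,Q_\xi).$$ -/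

import Mathlib

open scoped FourierTransform Topology ComplexConjugate
open MeasureTheory Filter

namespace RandomSchrodinger

noncomputable section

/-- Configuration / momentum space `ℝ^d` with the Euclidean norm. -/
abbrev E (d : ℕ) := EuclideanSpace ℝ (Fin d)

/-! ### Dispersion relation and self-energy -/

/-- The kinetic energy `e(p) = p² / 2`. -/
def kin {d : ℕ} (p : E d) : ℝ := ‖p‖ ^ 2 / 2

/-- The Fourier transform `B̂(p) = ∫ exp(-2πi p·x) B(x) dx` of the single-site profile. -/
def Bhat {d : ℕ} (B : SchwartzMap (E d) ℝ) : E d → ℂ := 𝓕 (fun x => (B x : ℂ))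

/-- The regularized self-energy `Θ_ε(α, r) = ∫ |B̂(q - r)|² / (α - e(q) + iε) dq`. -/
def ThetaReg {d : ℕ} (B : SchwartzMap (E d) ℝ) (ε α : ℝ) (r : E d) : ℂ :=
  ∫ q : E d, ((‖Bhat B (q - r)‖ ^ 2 : ℝ) : ℂ) / ((α : ℂ) - (kin q : ℂ) + (ε : ℂ) * Complex.I)

/-- The self-energy `θ(p) = lim_{ε → 0+} Θ_ε(e(p), p)`. -/
def theta {d : ℕ} (B : SchwartzMap (E d) ℝ) (p : E d) : ℂ :=
  limUnder (𝓝[>] (0 : ℝ)) (fun ε => ThetaReg B ε (kin p) p)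

/-- The renormalized (complex) dispersion relation `ω(p) = e(p) + λ² θ(p)`. -/
def omega {d : ℕ} (B : SchwartzMap (E d) ℝ) (lam : ℝ) (p : E d) : ℂ :=
  (kin p : ℂ) + (lam : ℂ) ^ 2 * theta B p

/-! ### The finite box with periodic boundary conditions -/

/-- The box `Λ_L = [-L/2, L/2]^d`. -/
def box (d : ℕ) (L : ℝ) : Set (E d) := {x | ∀ i, |x i| ≤ L / 2}

/-- The momentum `n / L` of the dual lattice `Λ_L^* = (ℤ / L)^d` labelled by `n ∈ ℤ^d`. -/
def dualPt {d : ℕ} (L : ℝ) (n : Fin d → ℤ) : E d := WithLp.toLp 2 (fun i => (n i : ℝ) / L)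

/-- The vector `L n` of the period lattice `L ℤ^d`. -/
def period {d : ℕ} (L : ℝ) (n : Fin d → ℤ) : E d := WithLp.toLp 2 (fun i => (n i : ℝ) * L)

/-- The Fourier transform on the box, `∫_{Λ_L} exp(-2πi p·x) f(x) dx`. -/
def boxFourier {d : ℕ} (L : ℝ) (f : E d → ℂ) (p : E d) : ℂ :=
  ∫ x in box d L, Complex.exp (-2 * Real.pi * Complex.I * ((inner ℝ p x : ℝ) : ℂ)) * f x

/-- The integral over the dual lattice, `∫_{Λ_L^*} g(p) dp = |Λ_L|⁻¹ ∑_{p ∈ Λ_L^*} g(p)`. -/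
def dualIntegral {d : ℕ} (L : ℝ) (g : E d → ℂ) : ℂ :=
  ((L : ℂ) ^ d)⁻¹ * ∑' n : Fin d → ℤ, g (dualPt L n)

/-- The renormalized free evolution `exp(-i s H₀)` on the box: multiplication by
`exp(-i s ω(p))` in Fourier space. -/
def freeEvol {d : ℕ} (B : SchwartzMap (E d) ℝ) (lam L s : ℝ) (f : E d → ℂ) (x : E d) : ℂ :=
  dualIntegral L (fun p => Complex.exp (2 * Real.pi * Complex.I * ((inner ℝ p x : ℝ) : ℂ)) *
    (Complex.exp (-Complex.I * (s : ℂ) * omega B lam p) * boxFourier L f p))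

/-- The potential `v B(x - y)` of one obstacle with centre `y` and weight `v`, with periodic
boundary conditions on the box (i.e. `B` is made `L`-periodic). -/
def obstacle {d : ℕ} (B : SchwartzMap (E d) ℝ) (L : ℝ) (y : E d) (v : ℝ) (x : E d) : ℝ :=
  v * ∑' n : Fin d → ℤ, B (x - y + period L n)

/-! ### The Duhamel expansion -/

/-- `exp(-i s_{k+1} H₀) W_k exp(-i s_k H₀) ⋯ exp(-i s_2 H₀) W_1 exp(-i s_1 H₀) f`, where
`W_j` are multiplication operators. -/
def duhamelChain {d : ℕ} (B : SchwartzMap (E d) ℝ) (lam L : ℝ) :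
    (k : ℕ) → (Fin (k + 1) → ℝ) → (Fin k → E d → ℂ) → (E d → ℂ) → E d → ℂ
  | 0, s, _, f => freeEvol B lam L (s 0) f
  | k + 1, s, W, f => freeEvol B lam L (s (Fin.last (k + 1))) (fun x => W (Fin.last k) x *
      duhamelChain B lam L k (fun j => s j.castSucc) (fun j => W j.castSucc) f x)

/-- `∫₀ᵗ [ds]_1^{k+1} F(s_1, …, s_{k+1})`, the integral over `s_j ≥ 0` with
`δ(t - ∑ s_j)`; the delta function is resolved by `s_{k+1} = t - s_1 - ⋯ - s_k ≥ 0`. -/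
def timeSimplexIntegral (k : ℕ) (t : ℝ) (F : (Fin (k + 1) → ℝ) → ℂ) : ℂ :=
  ∫ s in {s : Fin k → ℝ | (∀ j, 0 ≤ s j) ∧ ∑ j, s j ≤ t},
    F (Fin.snoc (α := fun _ => ℝ) s (t - ∑ j, s j))

/-- A configuration of obstacles: their number `M`, their centres and their weights. -/
abbrev Config (d : ℕ) := Σ M : ℕ, (Fin M → E d) × (Fin M → ℝ)

/-- The elementary wave function `ψ_{t,γ}` of a sequence `γ` of `k` potential labels. -/
def elemWave {d : ℕ} (B : SchwartzMap (E d) ℝ) (lam L t : ℝ) (k : ℕ) (ψ : E d → ℂ)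
    (ω : Config d) (γ : Fin k → Fin ω.1) (x : E d) : ℂ :=
  (-Complex.I) ^ k * timeSimplexIntegral k t (fun s => duhamelChain B lam L k s
    (fun j z => ((lam * obstacle B L (ω.2.1 (γ j)) (ω.2.2 (γ j)) z : ℝ) : ℂ)) ψ x)

/-- `ψ^{nr}_{t,k}`: the sum of `ψ_{t,γ}` over all sequences of `k` distinct potential labels. -/
def psiNR {d : ℕ} (B : SchwartzMap (E d) ℝ) (lam L t : ℝ) (k : ℕ) (ψ : E d → ℂ)
    (ω : Config d) (x : E d) : ℂ :=
  ∑ γ : Fin k ↪ Fin ω.1, elemWave B lam L t k ψ ω γ x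

/-- The squared norm of `L²(Λ_L)`. -/
def boxNormSq {d : ℕ} (L : ℝ) (f : E d → ℂ) : ℝ := ∫ x in box d L, ‖f x‖ ^ 2

/-- The joint law of `(M, (y_γ), (v_γ))`: `M` is Poisson with mean `|Λ_L| = L^d`; given `M`,
the centres are i.i.d. uniform on `Λ_L`, the weights are i.i.d. with law `Pv`, independent of
the centres. -/
def configLaw (d : ℕ) (L : ℝ) (Pv : Measure ℝ) : Measure (Config d) :=
  Measure.sum fun M : ℕ =>
    ProbabilityTheory.poissonMeasure (Real.toNNReal (L ^ d)) {M} •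
      (((Measure.pi fun _ : Fin M => ProbabilityTheory.cond (volume : Measure (E d)) (box d L)).prod
        (Measure.pi fun _ : Fin M => Pv)).map
          (fun z => (⟨M, z⟩ : Config d)))

/-- A family of smooth cutoff functions `χ_L`, supported on `Λ_L`, equal to `1` on `Λ_{L/2}`,
with `|∇ χ_L| ≤ C / L`. -/
structure IsBoxCutoff {d : ℕ} (χ : ℝ → E d → ℝ) : Prop where
  smooth : ∀ L, 1 ≤ L → ContDiff ℝ ((⊤ : ℕ∞) : WithTop ℕ∞) (χ L)
  support_subset : ∀ L, 1 ≤ L → Function.support (χ L) ⊆ box d L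
  eq_one : ∀ L, 1 ≤ L → ∀ x ∈ box d (L / 2), χ L x = 1
  gradient_le : ∃ C : ℝ, ∀ L, 1 ≤ L → ∀ x, ‖fderiv ℝ (χ L) x‖ ≤ C / L

/-! ### Wigner transform tested against an observable -/

/-- The Fourier transform in the space variable of the rescaled Wigner transform,
`Ŵ^ε(ξ, v) = conj (ψ̂(v - εξ/2)) ψ̂(v + εξ/2)`, in terms of `ψ̂`. -/
def wignerHat {d : ℕ} (ε : ℝ) (ψhat : E d → ℂ) (ξ v : E d) : ℂ :=
  conj (ψhat (v - (ε / 2) • ξ)) * ψhat (v + (ε / 2) • ξ)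

/-- The Fourier transform in the space variable of a phase space function. -/
def phaseHat {d : ℕ} (O : E d × E d → ℂ) (ξ v : E d) : ℂ := 𝓕 (fun X : E d => O (X, v)) ξ

/-- The pairing `⟨Ô, Ŵ^ε_ψ⟩_L = ∫ dξ dv Ô(ξ, v) conj (Ŵ^ε_ψ(ξ, v))` on the box. The two momenta
`p = v + εξ/2`, `p' = v - εξ/2` run over the dual lattice, so the double integral is
`ε^{-d} ∫∫_{Λ_L^*} dp dp'` with `ξ = (p - p')/ε` and `v = (p + p')/2`. -/
def wignerPairing {d : ℕ} (L ε : ℝ) (O : E d × E d → ℂ) (ψ : E d → ℂ) : ℂ :=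
  ((ε : ℂ) ^ d)⁻¹ * (((L : ℂ) ^ d)⁻¹ ^ 2 * ∑' n : (Fin d → ℤ) × (Fin d → ℤ),
    phaseHat O (ε⁻¹ • (dualPt L n.1 - dualPt L n.2))
        ((1 / 2 : ℝ) • (dualPt L n.1 + dualPt L n.2)) *
      conj (wignerHat ε (boxFourier L ψ) (ε⁻¹ • (dualPt L n.1 - dualPt L n.2))
        ((1 / 2 : ℝ) • (dualPt L n.1 + dualPt L n.2))))

/-! ### Feynman graphs

The circle graph has the vertices `0, 1, …, k, 0*, k~, …, 1~` in this cyclic order. A vertex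
`j` is `Sum.inl`, a vertex `j~` is `Sum.inr` (with `Fin k` for `{1, …, k}`). The momenta
`p, p' : Fin (k + 1) → ℝ^d` are those of the edges: `p_j` of `(j - 1, j)`, `p'_j` of
`(j~, (j - 1)~)`, `p_{k+1}` of `(k, 0*)`, `p'_{k+1}` of `(0*, k~)`. -/

/-- Outgoing minus incoming momentum at a vertex other than `0, 0*`. -/
def vertexFlux {d k : ℕ} (p p' : Fin (k + 1) → E d) : Fin k ⊕ Fin k → E d
  | Sum.inl j => p j.succ - p j.castSucc
  | Sum.inr j => p' j.castSucc - p' j.succ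

/-- Sum of the momenta of the edges going out of `P` minus those of the edges going into `P`
(an edge joining two vertices of `P` contributes twice, with opposite signs). -/
def lumpFlux {d k : ℕ} (p p' : Fin (k + 1) → E d) (P : Finset (Fin k ⊕ Fin k)) : E d :=
  ∑ v ∈ P, vertexFlux p p' v

/-- The approximate delta function of width `r`: the normalized indicator of the ball. -/
def deltaReg {d : ℕ} (r : ℝ) (x : E d) : ℝ :=
  (Metric.ball (0 : E d) r).indicator (fun _ => (volume.real (Metric.ball (0 : E d) r))⁻¹) x

/-- The regularization of the product of delta functions
`Δ_ξ(P, w, u ≡ 0) = δ(ξ + p'_{k+1} - p_{k+1}) ∏_{P_μ ∈ P} δ(flux of P_μ)`. -/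
def DeltaReg {d k : ℕ} (r : ℝ) (ξ : E d) (P : Finset (Finset (Fin k ⊕ Fin k)))
    (p p' : Fin (k + 1) → E d) : ℝ :=
  deltaReg r (ξ + p' (Fin.last k) - p (Fin.last k)) * ∏ S ∈ P, deltaReg r (lumpFlux p p' S)

/-- `∫ dw Δ_ξ(P, w, u ≡ 0) F(w)`, for continuous compactly supported `F`. -/
def deltaIntegral {d k : ℕ} (ξ : E d) (P : Finset (Finset (Fin k ⊕ Fin k)))
    (F : (Fin (k + 1) → E d) → (Fin (k + 1) → E d) → ℂ) : ℂ :=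
  limUnder (𝓝[>] (0 : ℝ)) fun r =>
    ∫ w : (Fin (k + 1) → E d) × (Fin (k + 1) → E d), (DeltaReg r ξ P w.1 w.2 : ℂ) * F w.1 w.2

/-- The product `M(w)` of all potential terms, of the initial data and of the observable `Q`,
for partitions without single lumps. -/
def vertexFactor {d k : ℕ} (B : SchwartzMap (E d) ℝ) (ψ : E d → ℂ) (Q : E d → ℂ)
    (p p' : Fin (k + 1) → E d) : ℂ :=
  (∏ j : Fin k, conj (Bhat B (p j.castSucc - p j.succ))) *
    (∏ j : Fin k, Bhat B (p' j.succ - p' j.castSucc)) *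
    (conj (𝓕 ψ (p 0)) * 𝓕 ψ (p' 0)) *
    Q ((1 / 2 : ℝ) • (p (Fin.last k) + p' (Fin.last k)))

/-- The value `V_ξ(P, α, β; Q)` of a partition without single lumps. -/
def graphValueAB {d k : ℕ} (B : SchwartzMap (E d) ℝ) (lam η : ℝ) (ψ : E d → ℂ) (ξ : E d)
    (P : Finset (Finset (Fin k ⊕ Fin k))) (Q : E d → ℂ) (α β : ℝ) : ℂ :=
  (lam : ℂ) ^ (2 * k) * deltaIntegral ξ P fun p p' =>
    (∏ j, 1 / ((α : ℂ) - conj (omega B lam (p j)) - Complex.I * η)) *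
    (∏ j, 1 / ((β : ℂ) - omega B lam (p' j) + Complex.I * η)) *
    vertexFactor B ψ Q p p'

/-- The value `V°_ξ(P; Q)` with unrestricted `α, β` integrations. For `k = 0` (a single
denominator, where these integrals are not absolutely convergent) the auxiliary variables
`α, β` are not introduced and the value is written directly with the free evolution. -/
def graphValue {d k : ℕ} (B : SchwartzMap (E d) ℝ) (lam η t : ℝ) (ψ : E d → ℂ) (ξ : E d)
    (P : Finset (Finset (Fin k ⊕ Fin k))) (Q : E d → ℂ) : ℂ :=
  if k = 0 then
    deltaIntegral ξ P fun p p' =>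
      Complex.exp (Complex.I * t * conj (omega B lam (p 0))) *
        Complex.exp (-Complex.I * t * omega B lam (p' 0)) * vertexFactor B ψ Q p p'
  else
    ((Real.exp (2 * t * η) / (2 * Real.pi) ^ 2 : ℝ) : ℂ) *
      ∫ α : ℝ, ∫ β : ℝ, Complex.exp (Complex.I * t * ((α : ℂ) - β)) *
        graphValueAB B lam η ψ ξ P Q α β

/-- The even partition `P(A, σ)` with lumps `A_μ ∪ σ(A_μ)~`. -/
def evenLumps {k : ℕ} (A : Finpartition (Finset.univ : Finset (Fin k)))
    (σ : Equiv.Perm (Fin k)) : Finset (Finset (Fin k ⊕ Fin k)) :=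
  A.parts.image fun a => a.disjSum (a.map σ.toEmbedding)

/-- The value `V°_ξ(A, σ, Q)` of the Feynman graph of `(A, σ)`. -/
def feynmanValue {d k : ℕ} (B : SchwartzMap (E d) ℝ) (lam η t : ℝ) (ψ : E d → ℂ) (ξ : E d)
    (A : Finpartition (Finset.univ : Finset (Fin k))) (σ : Equiv.Perm (Fin k))
    (Q : E d → ℂ) : ℂ :=
  graphValue B lam η t ψ ξ (evenLumps A σ) Q

/-- The cluster coefficients of the continuum model: `c(1) = 1`, `c(n) = 0` for `n ≥ 2`. -/
def clusterCoeff (n : ℕ) : ℂ := if n = 1 then 1 else 0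

/-- `c(A) = ∏_ν c(|A_ν|)`. -/
def partitionCoeff {k : ℕ} (A : Finpartition (Finset.univ : Finset (Fin k))) : ℂ :=
  ∏ a ∈ A.parts, clusterCoeff a.card

end

end RandomSchrodinger

open RandomSchrodinger

namespace RandomSchrodinger

/-! ### The profile in Fourier space and the self-energy -/

/-! On the box every function involved is a trigonometric series. An obstacle at `y` with weight `v`
acts on Fourier coefficients as convolution with `L^{-d} λ v e^{-2πi m·y} B̂(m)`, and since `B̂` has
compact support only finitely many lattice transfers `m` matter. Integrating the free phases over
the time simplex produces a kernel depending on the momenta along the path. Hence the coefficients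
of the wave function are sums over label sequences `γ` and transfers `m` of a deterministic
amplitude times `∏ v e^{-2πi m·y}` (`psiNR_eq_synth`). The bounds rest on `Im ω ≤ 0` and on the
continuity of `ω`; both come from writing `θ` as a time integral whose integrand decays like
`s^{-d/2}`, integrable at infinity because `d ≥ 3`.

The norm and the Wigner pairing are quadratic forms in these random factors. Independent weights of
mean 0 and variance 1 force the two label sequences to visit the same obstacles, so they differ by a
permutation `σ`; uniform centres then force the transfers to agree up to `σ`
(`integral_labelFactor`). The number `M(M-1)⋯(M-k+1)` of label sequences has Poisson mean exactly
`L^{dk}`, which is why no cluster of more than one index appears. Of the factor `L^{-2dk}` in the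
two amplitudes, `L^{-dk}` survives, and the expectation is a Riemann sum (`expectation_boxNormSq`,
`expectation_wignerPairing`).

The Riemann sums are integrals of functions rounded to the dual lattice. The transfers stay in a
ball, but the initial momenta do not, since the cutoff destroys the compact support of `ψ̂₀`. A
fixed majorant is therefore replaced by converging ones (`tendsto_integral_of_varying_bound`): the
rounded amplitudes have square integral at most `‖χ_L ψ₀‖²` by Bessel, and this tends to `‖ψ̂₀‖²` by
dominated convergence and Plancherel.

On the graph side `c(A)` leaves only the partition into singletons. A volume preserving change of
variables resolves the delta functions (`deltaIntegral_evenLumps_bot`), and the `α`, `β` integrals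
are Fourier inversions that give back the time kernel, each with a factor `e^{-ηt}`
(`integral_prod_resolvent`). These cancel `e^{2tη}`, so `η` disappears and `feynmanValue_bot` gives
the same limit integral. -/

/-- The Fourier transform of the single-site profile as a Schwartz function. -/
noncomputable def profileHat {d : ℕ} (B : SchwartzMap (E d) ℝ) : SchwartzMap (E d) ℂ :=
  𝓕 (SchwartzMap.postcompCLM Complex.ofRealCLM B)

lemma profileHat_coe {d : ℕ} (B : SchwartzMap (E d) ℝ) : (profileHat B : E d → ℂ) = Bhat B := by
  unfold profileHat Bhat
  rw [SchwartzMap.fourier_coe]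
  congr 1

lemma continuous_Bhat {d : ℕ} (B : SchwartzMap (E d) ℝ) : Continuous (Bhat B) := by
  rw [← profileHat_coe]; exact (profileHat B).continuous

/-- The graph carries `B̂(p_j - p_{j+1})` on the conjugated side, whereas the wave function produces
`B̂` of the transfer `p_{j+1} - p_j`; radial symmetry identifies the two. -/
lemma Bhat_neg {d : ℕ} (B : SchwartzMap (E d) ℝ) (hB : ∀ x y : E d, ‖x‖ = ‖y‖ → B x = B y)
    (p : E d) : Bhat B (-p) = Bhat B p := by
  unfold Bhat
  simp only [Real.fourier_eq]
  rw [← integral_neg_eq_self]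
  simp only [inner_neg_neg]
  congr 1; ext x; rw [hB (-x) x (norm_neg x)]

/-- The squared modulus `|B̂|²` as a Schwartz function. -/
noncomputable def profileSq {d : ℕ} (B : SchwartzMap (E d) ℝ) : SchwartzMap (E d) ℂ :=
  SchwartzMap.pairing (ContinuousLinearMap.mul ℝ ℂ) (SchwartzMap.postcompCLM
    (Complex.conjCLE : ℂ →L[ℝ] ℂ) (profileHat B)) (profileHat B)

lemma profileSq_apply {d : ℕ} (B : SchwartzMap (E d) ℝ) (q : E d) :
    profileSq B q = ((‖Bhat B q‖ ^ 2 : ℝ) : ℂ) := by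
  unfold profileSq
  rw [SchwartzMap.pairing_apply_apply]
  simp [profileHat_coe, Complex.conj_mul']

/-- Self-adjointness moves the Fourier transform onto the Gaussian, whose transform is explicit and
has modulus at most `(π/|b|)^{d/2}` because `Re (1/b) > 0`. The bound depends on `|b|` only, so it
survives `Re b → 0`. -/
lemma norm_integral_mul_gaussian_le {d : ℕ} (h : SchwartzMap (E d) ℂ) {b : ℂ} (hb : 0 < b.re)
    (c : E d) :
    ‖∫ u, 𝓕 h u * Complex.exp (-b * ‖u‖ ^ 2 + 2 * Real.pi * Complex.I * (inner ℝ c u : ℝ))‖ ≤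
      (Real.pi / ‖b‖) ^ ((d : ℝ) / 2) * ∫ x, ‖h x‖ := by
  have hb0 : b ≠ 0 := by rintro rfl; simp at hb
  have J : Integrable (fun w : E d ↦
      Complex.exp (-b * ‖w‖ ^ 2 + 2 * Real.pi * Complex.I * (inner ℝ c w : ℝ))) :=
    GaussianFourier.integrable_cexp_neg_mul_sq_norm_add hb _ _
  have key := VectorFourier.integral_fourierIntegral_smul_eq_flip (L := innerₗ (E d)) (μ := volume)
      (ν := volume) Real.continuous_fourierChar continuous_inner h.integrable J
  have e1 : ∫ u, 𝓕 h u *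
      Complex.exp (-b * ‖u‖ ^ 2 + 2 * Real.pi * Complex.I * (inner ℝ c u : ℝ)) =
      ∫ x, h x * 𝓕 (fun w : E d ↦
        Complex.exp (-b * ‖w‖ ^ 2 + 2 * Real.pi * Complex.I * (inner ℝ c w : ℝ))) x := by
    simpa using! key
  rw [e1, ← integral_const_mul]
  refine norm_integral_le_of_norm_le (h.integrable.norm.const_mul _) (ae_of_all _ fun x => ?_)
  rw [fourier_gaussian_innerProductSpace' hb, norm_mul, norm_mul, mul_comm]
  refine mul_le_mul_of_nonneg_right ?_ (norm_nonneg _)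
  have h1 : ‖Complex.exp (-(Real.pi : ℂ) ^ 2 * (‖c - x‖ : ℂ) ^ 2 / b)‖ ≤ 1 := by
    rw [Complex.norm_exp, Real.exp_le_one_iff]
    have : (-(Real.pi : ℂ) ^ 2 * (‖c - x‖ : ℂ) ^ 2 / b) =
      ((-(Real.pi ^ 2 * ‖c - x‖ ^ 2) : ℝ) : ℂ) * b⁻¹ := by push_cast; ring
    rw [this, Complex.re_ofReal_mul, Complex.inv_re]
    have := Complex.normSq_pos.2 hb0
    have h2 : 0 ≤ b.re / Complex.normSq b := by positivity
    nlinarith [mul_nonneg (by positivity : 0 ≤ Real.pi ^ 2 * ‖c - x‖ ^ 2) h2]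
  have h2 : ‖((Real.pi : ℂ) / b) ^ ((Module.finrank ℝ (E d) : ℂ) / 2)‖ =
      (Real.pi / ‖b‖) ^ ((d : ℝ) / 2) := by
    have : ((Module.finrank ℝ (E d) : ℂ) / 2) = (((d : ℝ) / 2 : ℝ) : ℂ) := by simp
    rw [this, Complex.norm_cpow_of_ne_zero (by simp [hb0, Real.pi_ne_zero])]
    simp [abs_of_pos Real.pi_pos]
  rw [h2]
  exact mul_le_of_le_one_right (by positivity) h1

/-- The oscillatory integral `∫ g(u) exp(-is(u²/2 + u·p)) du` with `g = |B̂|²`. -/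
noncomputable def selfEnergyPhase {d : ℕ} (B : SchwartzMap (E d) ℝ) (s : ℝ) (p : E d) : ℂ :=
  ∫ u, profileSq B u * Complex.exp (-Complex.I * s * (‖u‖ ^ 2 / 2 + (inner ℝ p u : ℝ)))

lemma norm_selfEnergyPhase_integrand {d : ℕ} (s : ℝ) (p u : E d) :
    ‖Complex.exp (-Complex.I * s * (‖u‖ ^ 2 / 2 + (inner ℝ p u : ℝ)))‖ = 1 := by
  have : (-Complex.I * s * (‖u‖ ^ 2 / 2 + (inner ℝ p u : ℝ))) =
      ((-(s * (‖u‖ ^ 2 / 2 + (inner ℝ p u : ℝ))) : ℝ) : ℂ) * Complex.I := by push_cast; ring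
  rw [this, Complex.norm_exp_ofReal_mul_I]

lemma norm_selfEnergyPhase_le {d : ℕ} (B : SchwartzMap (E d) ℝ) (s : ℝ) (p : E d) :
    ‖selfEnergyPhase B s p‖ ≤ ∫ u, ‖profileSq B u‖ := by
  refine norm_integral_le_of_norm_le (profileSq B).integrable.norm (ae_of_all _ fun u => ?_)
  rw [norm_mul, norm_selfEnergyPhase_integrand, mul_one]

/-- The dispersive estimate of the free Schrödinger evolution: damp by `e^{-δu²}`, apply the
Gaussian bound with `b = δ + is/2`, for which `|b| ≥ s/2`, and let `δ → 0`. -/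
lemma norm_selfEnergyPhase_le_rpow {d : ℕ} (B : SchwartzMap (E d) ℝ) {s : ℝ} (hs : 0 < s)
    (p : E d) :
    ‖selfEnergyPhase B s p‖ ≤ (2 * Real.pi / s) ^ ((d : ℝ) / 2) *
      ∫ x, ‖(𝓕⁻ (profileSq B) : SchwartzMap (E d) ℂ) x‖ := by
  set h : SchwartzMap (E d) ℂ := 𝓕⁻ (profileSq B) with hh
  have hF : 𝓕 h = profileSq B := by rw [hh, FourierTransform.fourier_fourierInv_eq]
  have hlim : Tendsto (fun δ : ℝ => ∫ u, 𝓕 h u * Complex.exp (-((δ : ℂ) + Complex.I * s / 2) *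
      ‖u‖ ^ 2 + 2 * Real.pi * Complex.I * (inner ℝ (-(s / (2 * Real.pi)) • p) u : ℝ))) (𝓝[>] 0)
      (𝓝 (selfEnergyPhase B s p)) := by
    unfold selfEnergyPhase
    rw [hF]
    refine tendsto_integral_filter_of_dominated_convergence (fun u => ‖profileSq B u‖) ?_ ?_
      (profileSq B).integrable.norm ?_
    · refine Eventually.of_forall fun δ => Continuous.aestronglyMeasurable ?_
      have := (profileSq B).continuous
      fun_prop
    · filter_upwards [self_mem_nhdsWithin] with δ (hδ : 0 < δ)
      refine ae_of_all _ fun u => ?_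
      rw [norm_mul]
      refine mul_le_of_le_one_right (norm_nonneg _) ?_
      rw [Complex.norm_exp, Real.exp_le_one_iff]
      have : (-((δ : ℂ) + Complex.I * s / 2) *
        ‖u‖ ^ 2 + 2 * Real.pi * Complex.I * (inner ℝ (-(s / (2 * Real.pi)) • p) u : ℝ)) =
        ((- (δ * ‖u‖ ^ 2) : ℝ) : ℂ) + ((-s / 2 * ‖u‖ ^ 2 + 2 * Real.pi *
          inner ℝ (-(s / (2 * Real.pi)) • p) u : ℝ) : ℂ) * Complex.I := by push_cast; ring
      rw [this]
      simp only [Complex.add_re, Complex.ofReal_re, Complex.re_ofReal_mul, Complex.I_re, mul_zero,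
        add_zero]
      have : 0 ≤ δ * ‖u‖ ^ 2 := by positivity
      linarith
    · refine ae_of_all _ fun u => ?_
      have hc : Continuous fun δ : ℝ => profileSq B u *
          Complex.exp (-((δ : ℂ) + Complex.I * s / 2) *
          ‖u‖ ^ 2 + 2 * Real.pi * Complex.I * (inner ℝ (-(s / (2 * Real.pi)) • p) u : ℝ)) := by
        fun_prop
      have := (hc.tendsto 0).mono_left (nhdsWithin_le_nhds (s := Set.Ioi 0))
      convert this using 4
      rw [inner_smul_left]
      have hpi : (Real.pi : ℂ) ≠ 0 := by exact_mod_cast Real.pi_ne_zero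
      simp
      field_simp
      ring
  refine le_of_tendsto hlim.norm ?_
  filter_upwards [self_mem_nhdsWithin] with δ (hδ : 0 < δ)
  refine (norm_integral_mul_gaussian_le h (by simpa using hδ) _).trans ?_
  refine mul_le_mul_of_nonneg_right ?_ (integral_nonneg fun _ => norm_nonneg _)
  refine Real.rpow_le_rpow (by positivity) ?_ (by positivity)
  have : s / 2 ≤ ‖(δ : ℂ) + Complex.I * s / 2‖ := by
    refine le_trans ?_ (Complex.abs_im_le_norm _)
    simp [le_abs_self]
  rw [div_le_div_iff₀ (by linarith) hs]
  nlinarith [Real.pi_pos]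

/-- The trivial bound serves for `s ≤ 1`, the dispersive one for `s > 1`. The dimension enters here:
`s^{-d/2}` is integrable at infinity since `d/2 > 1`. -/
lemma exists_integrableOn_selfEnergyPhase_bound {d : ℕ} (hd : 3 ≤ d) (B : SchwartzMap (E d) ℝ) :
    ∃ G : ℝ → ℝ, IntegrableOn G (Set.Ioi 0) ∧ ∀ s, 0 < s → ∀ p, ‖selfEnergyPhase B s p‖ ≤ G s := by
  set C₁ := ∫ u, ‖profileSq B u‖
  set C₂ := ∫ x, ‖(𝓕⁻ (profileSq B) : SchwartzMap (E d) ℂ) x‖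
  refine ⟨fun s => if s ≤ 1 then C₁ else (2 * Real.pi) ^ ((d : ℝ) / 2) * s ^ (-((d : ℝ) / 2)) * C₂,
    ?_, ?_⟩
  · rw [← Set.Ioc_union_Ioi_eq_Ioi (zero_le_one : (0 : ℝ) ≤ 1), integrableOn_union]
    constructor
    · refine IntegrableOn.congr_fun (f := fun _ => C₁) (by simp) ?_ measurableSet_Ioc
      intro s hs; simp [hs.2]
    · have hd' : (3 : ℝ) ≤ d := by exact_mod_cast hd
      refine IntegrableOn.congr_fun (((integrableOn_Ioi_rpow_of_lt (a := -((d : ℝ) / 2))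
        (by linarith) one_pos).const_mul ((2 * Real.pi) ^ ((d : ℝ) / 2))).mul_const C₂) ?_
        measurableSet_Ioi
      intro s hs; simp [not_le.2 (Set.mem_Ioi.1 hs)]
  · intro s hs p
    dsimp only
    split_ifs
    · exact norm_selfEnergyPhase_le B s p
    · refine (norm_selfEnergyPhase_le_rpow B hs p).trans_eq ?_
      rw [Real.div_rpow (by positivity) hs.le, Real.rpow_neg hs.le]; rfl

/-- After the shift `q = u + p` the denominator is `i(ε + iφ)` with `φ = u²/2 + p·u`, and `1/(ε +
iφ) = ∫₀^∞ e^{-(ε+iφ)s} ds`. The damping `e^{-εs}` permits Fubini. -/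
lemma ThetaReg_eq {d : ℕ} (B : SchwartzMap (E d) ℝ) {ε : ℝ} (hε : 0 < ε) (p : E d) :
    ThetaReg B ε (kin p) p =
      -Complex.I * ∫ s in Set.Ioi (0 : ℝ), Complex.exp (-(ε * s : ℝ)) * selfEnergyPhase B s p := by
  have e1 : ThetaReg B ε (kin p) p = ∫ u, -Complex.I * ∫ s in Set.Ioi (0 : ℝ),
      Complex.exp (-(ε * s : ℝ)) * (profileSq B u *
        Complex.exp (-Complex.I * s * (‖u‖ ^ 2 / 2 + (inner ℝ p u : ℝ)))) := by
    unfold ThetaReg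
    rw [← integral_add_right_eq_self _ p]
    congr 1; ext u
    obtain ⟨φ, hφ⟩ : ∃ φ : ℝ, φ = ‖u‖ ^ 2 / 2 + inner ℝ p u := ⟨_, rfl⟩
    have hint := integral_exp_mul_complex_Ioi
      (a := -((ε : ℂ) + Complex.I * φ)) (by simp [hε]) 0
    have e2 : ∀ s : ℝ, Complex.exp (-(ε * s : ℝ)) * (profileSq B u *
        Complex.exp (-Complex.I * s * (‖u‖ ^ 2 / 2 + (inner ℝ p u : ℝ)))) = profileSq B u *
        Complex.exp (-((ε : ℂ) + Complex.I * φ) * s) := by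
      intro s
      rw [hφ, mul_left_comm, ← Complex.exp_add]
      congr 2; push_cast; ring
    simp_rw [e2]
    rw [integral_const_mul, hint, add_sub_cancel_right, profileSq_apply]
    have h0 : (ε : ℂ) + Complex.I * φ ≠ 0 := by
      intro h; apply_fun Complex.re at h; simp at h; exact hε.ne' h
    have h1 : ((kin p : ℝ) : ℂ) - (kin (u + p) : ℝ) + ε * Complex.I =
        Complex.I * ((ε : ℂ) + Complex.I * φ) := by
      have : kin p - kin (u + p) = - φ := by
        unfold kin; rw [hφ, norm_add_sq_real, real_inner_comm]; ring
      rw [← Complex.ofReal_sub, this, mul_add, ← mul_assoc, Complex.I_mul_I]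
      push_cast; ring
    rw [h1]
    simp only [Complex.ofReal_zero, mul_zero, Complex.exp_zero]
    field_simp
    simp only [Complex.I_sq]
    ring
  rw [e1, integral_const_mul]
  congr 1
  rw [integral_integral_swap]
  · simp_rw [selfEnergyPhase, integral_const_mul]
  · have h1 : Integrable (fun z : E d × ℝ => ‖profileSq B z.1‖ * Real.exp (-ε * z.2))
        (volume.prod (volume.restrict (Set.Ioi 0))) :=
      (profileSq B).integrable.norm.mul_prod (integrableOn_exp_mul_Ioi (by linarith) 0)
    refine h1.mono' ?_ (ae_of_all _ fun z => ?_)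
    · refine Continuous.aestronglyMeasurable ?_
      have := (profileSq B).continuous
      unfold Function.uncurry
      fun_prop
    · simp only [Function.uncurry]
      rw [norm_mul, norm_mul, norm_selfEnergyPhase_integrand, mul_one, Complex.norm_exp, mul_comm]
      simp

lemma continuous_selfEnergyPhase {d : ℕ} (B : SchwartzMap (E d) ℝ) :
    Continuous fun z : ℝ × E d => selfEnergyPhase B z.1 z.2 := by
  unfold selfEnergyPhase
  refine continuous_of_dominated (bound := fun u => ‖profileSq B u‖) ?_ ?_
      (profileSq B).integrable.norm ?_
  · intro z
    refine Continuous.aestronglyMeasurable ?_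
    have := (profileSq B).continuous
    fun_prop
  · intro z
    refine ae_of_all _ fun u => ?_
    rw [norm_mul, norm_selfEnergyPhase_integrand, mul_one]
  · refine ae_of_all _ fun u => ?_
    fun_prop

/-- `theta` is a `limUnder`, which means nothing until convergence is known; the integrable majorant
in `s` supplies it by dominated convergence. -/
lemma tendsto_ThetaReg {d : ℕ} (hd : 3 ≤ d) (B : SchwartzMap (E d) ℝ) (p : E d) :
    Tendsto (fun ε => ThetaReg B ε (kin p) p) (𝓝[>] (0 : ℝ))
      (𝓝 (-Complex.I * ∫ s in Set.Ioi (0 : ℝ), selfEnergyPhase B s p)) := by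
  obtain ⟨G, hG, hb⟩ := exists_integrableOn_selfEnergyPhase_bound hd B
  have hc := continuous_selfEnergyPhase B
  have h1 : Tendsto (fun ε : ℝ => -Complex.I * ∫ s in Set.Ioi (0 : ℝ),
      Complex.exp (-(ε * s : ℝ)) * selfEnergyPhase B s p) (𝓝[>] (0 : ℝ))
      (𝓝 (-Complex.I * ∫ s in Set.Ioi (0 : ℝ), selfEnergyPhase B s p)) := by
    refine Tendsto.const_mul _ ?_
    refine tendsto_integral_filter_of_dominated_convergence G ?_ ?_ hG ?_
    · refine Eventually.of_forall fun δ => Continuous.aestronglyMeasurable ?_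
      fun_prop
    · filter_upwards [self_mem_nhdsWithin] with ε (hε : 0 < ε)
      filter_upwards [ae_restrict_mem measurableSet_Ioi] with s (hs : 0 < s)
      refine le_trans ?_ (hb s hs p)
      rw [norm_mul]
      refine mul_le_of_le_one_left (norm_nonneg _) ?_
      rw [Complex.norm_exp, Real.exp_le_one_iff]
      simp only [Complex.neg_re, Complex.ofReal_re]
      have := mul_pos hε hs
      linarith
    · refine ae_of_all _ fun s => ?_
      have h2 : Continuous fun ε : ℝ => Complex.exp (-(ε * s : ℝ)) * selfEnergyPhase B s p := by
        fun_prop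
      have := (h2.tendsto 0).mono_left (nhdsWithin_le_nhds (s := Set.Ioi 0))
      simpa using this
  refine h1.congr' ?_
  filter_upwards [self_mem_nhdsWithin] with ε hε
  rw [ThetaReg_eq B hε]

lemma theta_eq {d : ℕ} (hd : 3 ≤ d) (B : SchwartzMap (E d) ℝ) (p : E d) :
    theta B p = -Complex.I * ∫ s in Set.Ioi (0 : ℝ), selfEnergyPhase B s p :=
  (tendsto_ThetaReg hd B p).limUnder_eq

lemma continuous_theta {d : ℕ} (hd : 3 ≤ d) (B : SchwartzMap (E d) ℝ) : Continuous (theta B) := by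
  obtain ⟨G, hG, hb⟩ := exists_integrableOn_selfEnergyPhase_bound hd B
  have hc := continuous_selfEnergyPhase B
  have : theta B = fun p => -Complex.I * ∫ s in Set.Ioi (0 : ℝ), selfEnergyPhase B s p :=
    funext (theta_eq hd B)
  rw [this]
  refine continuous_const.mul ?_
  refine continuous_of_dominated (bound := G) ?_ ?_ hG ?_
  · intro p
    exact Continuous.aestronglyMeasurable (by fun_prop)
  · intro p
    filter_upwards [ae_restrict_mem measurableSet_Ioi] with s (hs : 0 < s)
    exact hb s hs p
  · exact ae_of_all _ fun s => by fun_prop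

lemma ThetaReg_im_nonpos {d : ℕ} (B : SchwartzMap (E d) ℝ) {ε : ℝ} (hε : 0 < ε) (α : ℝ) (p : E d) :
    (ThetaReg B ε α p).im ≤ 0 := by
  unfold ThetaReg
  by_cases hi : Integrable (fun q : E d => ((‖Bhat B (q - p)‖ ^ 2 : ℝ) : ℂ) /
      ((α : ℂ) - (kin q : ℂ) + (ε : ℂ) * Complex.I))
  · have := integral_im hi
    simp only [RCLike.im_to_complex] at this
    rw [← this]
    refine integral_nonpos fun q => ?_
    simp only [Pi.zero_apply]
    rw [Complex.div_im]
    simp only [Complex.ofReal_im, Complex.ofReal_re, Complex.add_im, Complex.sub_im,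
      Complex.mul_im, Complex.I_re, Complex.I_im, zero_mul, zero_div]
    have : 0 ≤ ‖Bhat B (q - p)‖ ^ 2 * ε /
      Complex.normSq ((α : ℂ) - (kin q : ℂ) + (ε : ℂ) * Complex.I) :=
      div_nonneg (by positivity) (Complex.normSq_nonneg _)
    simpa using this
  -- A non-integrable integrand has Bochner integral 0, so integrability need not be checked.
  · rw [integral_undef hi]; simp

lemma theta_im_nonpos {d : ℕ} (hd : 3 ≤ d) (B : SchwartzMap (E d) ℝ) (p : E d) :
    (theta B p).im ≤ 0 := by
  rw [theta_eq hd]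
  refine le_of_tendsto ((Complex.continuous_im.tendsto _).comp (tendsto_ThetaReg hd B p)) ?_
  filter_upwards [self_mem_nhdsWithin] with ε hε
  exact ThetaReg_im_nonpos B hε _ _

lemma continuous_omega {d : ℕ} (hd : 3 ≤ d) (B : SchwartzMap (E d) ℝ) (lam : ℝ) :
    Continuous (omega B lam) := by
  have := continuous_theta hd B
  unfold omega kin
  fun_prop

/-- This makes `e^{-isω}` a contraction for `s ≥ 0` and keeps the resolvents at distance at least
`η` from their poles. -/
lemma omega_im_nonpos {d : ℕ} (hd : 3 ≤ d) (B : SchwartzMap (E d) ℝ) (lam : ℝ) (p : E d) :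
    (omega B lam p).im ≤ 0 := by
  unfold omega
  rw [← Complex.ofReal_pow, Complex.add_im, Complex.im_ofReal_mul, Complex.ofReal_im, zero_add]
  exact mul_nonpos_of_nonneg_of_nonpos (sq_nonneg _) (theta_im_nonpos hd B p)

end RandomSchrodinger

namespace RandomSchrodinger

/-! ### The time kernel `∫ exp(-i ∑ s_j w_j)` over the time simplex -/

/-- The time simplex `{s ≥ 0, ∑ s ≤ t}`. -/
def timeSimplex (k : ℕ) (t : ℝ) : Set (Fin k → ℝ) := {s | (∀ j, 0 ≤ s j) ∧ ∑ j, s j ≤ t}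

lemma isClosed_timeSimplex (k : ℕ) (t : ℝ) : IsClosed (timeSimplex k t) := by
  unfold timeSimplex
  rw [Set.ofPred_and, Set.ofPred_forall]
  refine IsClosed.inter (isClosed_iInter fun j => ?_) ?_
  · exact isClosed_le continuous_const (continuous_apply j)
  · exact isClosed_le (by fun_prop) continuous_const

lemma timeSimplex_subset (k : ℕ) (t : ℝ) :
    timeSimplex k t ⊆ Set.Icc (fun _ => 0) (fun _ => t) := by
  intro s hs
  refine ⟨fun j => hs.1 j, fun j => ?_⟩
  exact (Finset.single_le_sum (fun i _ => hs.1 i) (Finset.mem_univ j)).trans hs.2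

lemma isCompact_timeSimplex (k : ℕ) (t : ℝ) : IsCompact (timeSimplex k t) :=
  isCompact_Icc.of_isClosed_subset (isClosed_timeSimplex k t) (timeSimplex_subset k t)

lemma volume_timeSimplex_lt_top (k : ℕ) (t : ℝ) : volume (timeSimplex k t) < ⊤ :=
  (isCompact_timeSimplex k t).measure_lt_top

lemma volume_timeSimplex_le (k : ℕ) {t : ℝ} (ht : 0 ≤ t) :
    volume.real (timeSimplex k t) ≤ t ^ k := by
  refine (measureReal_mono (timeSimplex_subset k t) isCompact_Icc.measure_lt_top.ne).trans_eq ?_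
  rw [measureReal_def, Real.volume_Icc_pi_toReal (fun _ => ht)]
  simp

/-- The integral of the free phases over the time simplex. -/
noncomputable def timeKernel (k : ℕ) (t : ℝ) (w : Fin (k + 1) → ℂ) : ℂ :=
  timeSimplexIntegral k t fun s => ∏ j, Complex.exp (-Complex.I * s j * w j)

/-- The phase `∏ exp(-i s_j w_j)` with the last time fixed by `∑ s_j = t`. -/
noncomputable def timePhase (k : ℕ) (t : ℝ) (w : Fin (k + 1) → ℂ) (s : Fin k → ℝ) : ℂ :=
  ∏ j, Complex.exp (-Complex.I *
    (Fin.snoc (α := fun _ => ℝ) s (t - ∑ j, s j) : Fin (k + 1) → ℝ) j * w j)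

lemma timeKernel_eq (k : ℕ) (t : ℝ) (w : Fin (k + 1) → ℂ) :
    timeKernel k t w = ∫ s in timeSimplex k t, timePhase k t w s := rfl

lemma continuous_timePhase (k : ℕ) (t : ℝ) :
    Continuous fun z : (Fin (k + 1) → ℂ) × (Fin k → ℝ) => timePhase k t z.1 z.2 := by
  unfold timePhase
  refine continuous_finsetProd _ fun j _ => ?_
  refine Complex.continuous_exp.comp (Continuous.mul (Continuous.mul continuous_const ?_)
    (by fun_prop))
  refine Complex.continuous_ofReal.comp ?_
  induction j using Fin.lastCases with
  | last => simp only [Fin.snoc_last]; fun_prop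
  | cast j => simp only [Fin.snoc_castSucc]; fun_prop

lemma snoc_nonneg_of_mem_timeSimplex {k : ℕ} {t : ℝ} {s : Fin k → ℝ} (hs : s ∈ timeSimplex k t)
    (j : Fin (k + 1)) :
    0 ≤ (Fin.snoc (α := fun _ => ℝ) s (t - ∑ j, s j) : Fin (k + 1) → ℝ) j := by
  induction j using Fin.lastCases with
  | last => simp only [Fin.snoc_last]; linarith [hs.2]
  | cast j => simp only [Fin.snoc_castSucc]; exact hs.1 j

lemma norm_exp_phase_le {s : ℝ} (hs : 0 ≤ s) {w : ℂ} (hw : w.im ≤ 0) :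
    ‖Complex.exp (-Complex.I * s * w)‖ ≤ 1 := by
  rw [Complex.norm_exp, Real.exp_le_one_iff]
  simp
  exact mul_nonpos_of_nonneg_of_nonpos hs hw

lemma norm_timePhase_le {k : ℕ} {t : ℝ} {w : Fin (k + 1) → ℂ} (hw : ∀ j, (w j).im ≤ 0)
    {s : Fin k → ℝ} (hs : s ∈ timeSimplex k t) : ‖timePhase k t w s‖ ≤ 1 := by
  unfold timePhase
  rw [norm_prod]
  exact Finset.prod_le_one (fun _ _ => norm_nonneg _) fun j _ =>
    norm_exp_phase_le (snoc_nonneg_of_mem_timeSimplex hs j) (hw j)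

lemma norm_timeKernel_le {k : ℕ} {t : ℝ} (ht : 0 ≤ t) {w : Fin (k + 1) → ℂ}
    (hw : ∀ j, (w j).im ≤ 0) : ‖timeKernel k t w‖ ≤ t ^ k := by
  rw [timeKernel_eq]
  refine (norm_setIntegral_le_of_norm_le_const (volume_timeSimplex_lt_top k t)
    (fun s hs => norm_timePhase_le hw hs)).trans ?_
  rw [one_mul]
  exact volume_timeSimplex_le k ht

lemma continuous_timeKernel (k : ℕ) (t : ℝ) : Continuous (timeKernel k t) :=
  continuous_parametric_integral_of_continuous (continuous_timePhase k t)
    (isCompact_timeSimplex k t)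

/-- The simplex is empty. The kernel is thus a causal function on all of `ℝ`, to which convolution
and Fourier inversion apply. -/
lemma timeKernel_of_neg {k : ℕ} {t : ℝ} (ht : t < 0) (w : Fin (k + 1) → ℂ) :
    timeKernel k t w = 0 := by
  have : timeSimplex k t = ∅ := by
    rw [Set.eq_empty_iff_forall_notMem]
    intro s hs
    have := Finset.sum_nonneg fun i (_ : i ∈ Finset.univ) => hs.1 i
    linarith [hs.2]
  rw [timeKernel_eq, this]
  simp

lemma timeKernel_zero {t : ℝ} (ht : 0 ≤ t) (w : Fin 1 → ℂ) :
    timeKernel 0 t w = Complex.exp (-Complex.I * t * w 0) := by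
  have : timeSimplex 0 t = Set.univ := by
    rw [Set.eq_univ_iff_forall]
    intro s
    exact ⟨fun j => j.elim0, by simpa using ht⟩
  rw [timeKernel_eq, this]
  -- With no collision the integral runs over the one-point space `Fin 0 → ℝ`, which has mass 1.
  have h1 : volume.real (Set.univ : Set (Fin 0 → ℝ)) = 1 := by
    rw [measureReal_def, volume_pi, Measure.pi_of_empty]; simp
  simp [timePhase, Fin.snoc, integral_unique, h1]

/-- The times add up to `t`, so a common energy shift factors out. It is used with `c` real, as a
Fourier frequency, and with `c = iη`, as a damping. -/
lemma timeKernel_sub_const (k : ℕ) (t : ℝ) (w : Fin (k + 1) → ℂ) (c : ℂ) :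
    timeKernel k t (fun j => w j - c) = Complex.exp (Complex.I * t * c) * timeKernel k t w := by
  rw [timeKernel_eq, timeKernel_eq, ← integral_const_mul]
  congr 1; ext s
  unfold timePhase
  simp only [mul_sub, Complex.exp_sub, div_eq_mul_inv, Finset.prod_mul_distrib]
  rw [mul_comm]
  congr 1
  simp only [← Complex.exp_neg]
  rw [← Complex.exp_sum]
  congr 1
  rw [Fin.sum_univ_castSucc]
  simp only [Fin.snoc_castSucc, Fin.snoc_last]
  push_cast
  simp only [neg_mul, neg_neg]
  rw [← Finset.sum_mul, ← Finset.mul_sum]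
  ring

/-- Fubini in the first time. No upper limit `s ≤ t` is needed, since the inner kernel vanishes at
negative time. -/
lemma timeKernel_succ (k : ℕ) (t : ℝ) (w : Fin (k + 2) → ℂ) :
    timeKernel (k + 1) t w = ∫ s in Set.Ici (0 : ℝ), Complex.exp (-Complex.I * s * w 0) *
      timeKernel k (t - s) (Fin.tail w) := by
  have hmp := volume_preserving_piFinSuccAbove (fun _ : Fin (k + 1) => ℝ) 0
  have hsymm := hmp.symm
  rw [timeKernel_eq, ← integral_indicator (isClosed_timeSimplex _ _).measurableSet,
    ← hsymm.integral_comp']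
  have hfun : ∀ z : ℝ × (Fin k → ℝ), (timeSimplex (k + 1) t).indicator (timePhase (k + 1) t w)
      ((MeasurableEquiv.piFinSuccAbove (fun _ : Fin (k + 1) => ℝ) 0).symm z) =
      (Set.Ici (0 : ℝ)).indicator (fun s => Complex.exp (-Complex.I * s * w 0) *
        (timeSimplex k (t - s)).indicator (timePhase k (t - s) (Fin.tail w)) z.2) z.1 := by
    rintro ⟨a, s⟩
    have hcons : (MeasurableEquiv.piFinSuccAbove (fun _ : Fin (k + 1) => ℝ) 0).symm (a, s) =
        Fin.cons a s := by
      simp [MeasurableEquiv.piFinSuccAbove]; rfl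
    rw [hcons]
    have hmem : (Fin.cons a s : Fin (k + 1) → ℝ) ∈ timeSimplex (k + 1) t ↔
        a ∈ Set.Ici (0 : ℝ) ∧ s ∈ timeSimplex k (t - a) := by
      simp only [timeSimplex, Set.mem_ofPred_eq, Fin.forall_fin_succ, Fin.cons_zero, Fin.cons_succ,
        Fin.sum_univ_succ, Set.mem_Ici]
      constructor
      · rintro ⟨⟨h1, h2⟩, h3⟩; exact ⟨h1, h2, by linarith⟩
      · rintro ⟨h1, h2, h3⟩; exact ⟨⟨h1, h2⟩, by linarith⟩
    have hphase : timePhase (k + 1) t w (Fin.cons a s : Fin (k + 1) → ℝ) =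
        Complex.exp (-Complex.I * a * w 0) * timePhase k (t - a) (Fin.tail w) s := by
      unfold timePhase
      rw [Fin.prod_univ_succ, ← Fin.cons_snoc_eq_snoc_cons]
      simp only [Fin.cons_zero, Fin.cons_succ, Fin.sum_univ_succ, Fin.tail]
      rw [sub_sub]
    by_cases ha : a ∈ Set.Ici (0 : ℝ)
    · by_cases hs : s ∈ timeSimplex k (t - a)
      · simp [Set.indicator_of_mem (hmem.2 ⟨ha, hs⟩), Set.indicator_of_mem ha,
          Set.indicator_of_mem hs, hphase]
      · rw [Set.indicator_of_notMem (fun h => hs (hmem.1 h).2), Set.indicator_of_mem ha]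
        simp [Set.indicator_of_notMem hs]
    · rw [Set.indicator_of_notMem (fun h => ha (hmem.1 h).1)]
      simp [Set.indicator_of_notMem ha]
  have hint : Integrable ((timeSimplex (k + 1) t).indicator (timePhase (k + 1) t w)) := by
    rw [integrable_indicator_iff (isClosed_timeSimplex _ _).measurableSet]
    exact ((continuous_timePhase (k + 1) t).comp
      (Continuous.prodMk_right w)).continuousOn.integrableOn_compact (isCompact_timeSimplex _ _)
  have hint2 := (hsymm.integrable_comp_emb (MeasurableEquiv.measurableEmbedding _)).2 hint
  rw [show (volume : Measure (ℝ × (Fin k → ℝ))) = volume.prod volume from rfl]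
  erw [integral_prod _ hint2]
  rw [← integral_indicator measurableSet_Ici]
  congr 1; ext a
  simp only [hfun, Function.comp_def]
  by_cases ha : a ∈ Set.Ici (0 : ℝ)
  · simp only [Set.indicator_of_mem ha]
    rw [integral_const_mul, integral_indicator (isClosed_timeSimplex _ _).measurableSet]
    rfl
  · simp [Set.indicator_of_notMem ha]

lemma timeKernel_zero_eq_indicator (w : Fin 1 → ℂ) :
    (fun t => timeKernel 0 t w) =
      (Set.Ici (0 : ℝ)).indicator fun t => Complex.exp (-Complex.I * t * w 0) := by
  ext t
  by_cases ht : 0 ≤ t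
  · rw [timeKernel_zero ht, Set.indicator_of_mem (Set.mem_Ici.2 ht)]
  · rw [timeKernel_of_neg (not_le.1 ht), Set.indicator_of_notMem (by simpa using ht)]

lemma timeKernel_succ_eq_convolution (k : ℕ) (w : Fin (k + 2) → ℂ) :
    (fun t => timeKernel (k + 1) t w) = convolution (fun t => timeKernel 0 t (fun _ => w 0))
      (fun t => timeKernel k t (Fin.tail w)) (ContinuousLinearMap.mul ℝ ℂ) volume := by
  ext t
  rw [timeKernel_succ k t w, convolution, ← integral_indicator measurableSet_Ici]
  congr 1; ext s
  rw [congrFun (timeKernel_zero_eq_indicator fun _ => w 0) s]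
  by_cases hs : s ∈ Set.Ici (0 : ℝ)
  · simp [Set.indicator_of_mem hs]
  · simp [Set.indicator_of_notMem hs]

/-- The kernel is an iterated convolution of causal exponentials, each of integral `1/(iw)` when `Im
w < 0`, and the integral of a convolution is the product of the integrals. -/
lemma integrable_timeKernel (k : ℕ) (w : Fin (k + 1) → ℂ) (hw : ∀ j, (w j).im < 0) :
    Integrable (fun t => timeKernel k t w) ∧
      ∫ t, timeKernel k t w = ∏ j, 1 / (Complex.I * w j) := by
  have h0 : ∀ c : ℂ, c.im < 0 → Integrable (fun t => timeKernel 0 t (fun _ => c)) ∧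
      ∫ t, timeKernel 0 t (fun _ => c) = 1 / (Complex.I * c) := by
    intro c hc
    have hre : (-Complex.I * c).re < 0 := by simpa using hc
    rw [timeKernel_zero_eq_indicator, integrable_indicator_iff measurableSet_Ici,
      integrableOn_Ici_iff_integrableOn_Ioi]
    have e : ∀ t : ℝ, -Complex.I * t * c = -Complex.I * c * t := fun t => by ring
    simp_rw [e]
    refine ⟨integrableOn_exp_mul_complex_Ioi hre 0, ?_⟩
    rw [integral_indicator measurableSet_Ici, integral_Ici_eq_integral_Ioi,
      integral_exp_mul_complex_Ioi hre]
    simp [neg_div_neg_eq]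
  induction k with
  | zero =>
    have := h0 (w 0) (hw 0)
    have e : w = fun _ => w 0 := by ext j; fin_cases j; rfl
    rw [e]; simpa using this
  | succ k ih =>
    obtain ⟨i1, v1⟩ := ih (Fin.tail w) (fun j => hw _)
    obtain ⟨i0, v0⟩ := h0 (w 0) (hw 0)
    rw [timeKernel_succ_eq_convolution k w]
    refine ⟨i0.integrable_convolution _ i1, ?_⟩
    rw [integral_convolution _ i0 i1, v0, v1,
      Fin.prod_univ_succ (fun j => 1 / (Complex.I * w j))]
    rfl

/-- A primitive of a locally integrable function is continuous. At least one collision is required: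
with none the kernel jumps at `t = 0`. -/
lemma continuous_timeKernel_time (k : ℕ) (w : Fin (k + 2) → ℂ) (hw : ∀ j, (w j).im < 0) :
    Continuous fun t => timeKernel (k + 1) t w := by
  have hi := (integrable_timeKernel k (Fin.tail w) (fun j => hw _)).1
  have hb : Continuous fun u : ℝ => Complex.exp (Complex.I * u * w 0) := by fun_prop
  have key : (fun t => timeKernel (k + 1) t w) = fun t : ℝ => Complex.exp (-Complex.I * t * w 0) *
      ∫ u in (0 : ℝ)..t, Complex.exp (Complex.I * u * w 0) * timeKernel k u (Fin.tail w) := by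
    ext t
    rw [timeKernel_succ k t w, ← integral_indicator measurableSet_Ici,
      ← integral_sub_left_eq_self _ _ t]
    rcases le_or_gt 0 t with ht | ht
    · rw [intervalIntegral.integral_of_le ht, ← integral_Icc_eq_integral_Ioc,
        ← integral_indicator measurableSet_Icc, ← integral_const_mul]
      congr 1; ext u
      by_cases hu : 0 ≤ u
      · by_cases hut : u ≤ t
        · rw [Set.indicator_of_mem (by simpa using hut),
            Set.indicator_of_mem (show u ∈ Set.Icc 0 t from ⟨hu, hut⟩), ← mul_assoc,
            ← Complex.exp_add, sub_sub_cancel]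
          congr 2; push_cast; ring
        · rw [Set.indicator_of_notMem (by simpa using hut),
            Set.indicator_of_notMem (fun h => hut h.2), mul_zero]
      · rw [Set.indicator_of_notMem (s := Set.Icc 0 t) (fun h => hu h.1), mul_zero]
        refine Set.indicator_apply_eq_zero.2 fun _ => ?_
        rw [sub_sub_cancel, timeKernel_of_neg (not_le.1 hu), mul_zero]
    · rw [intervalIntegral.integral_of_ge ht.le, ← integral_indicator measurableSet_Ioc]
      have z1 : ∀ u : ℝ, (Set.Ici (0 : ℝ)).indicator (fun s => Complex.exp (-Complex.I * s * w 0) *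
          timeKernel k (t - s) (Fin.tail w)) (t - u) = 0 := by
        intro u
        refine Set.indicator_apply_eq_zero.2 fun h => ?_
        have : u < 0 := by have := Set.mem_Ici.1 h; linarith
        rw [sub_sub_cancel, timeKernel_of_neg this, mul_zero]
      have z2 : (Set.Ioc t 0).indicator (fun u : ℝ => Complex.exp (Complex.I * u * w 0) *
          timeKernel k u (Fin.tail w)) =ᵐ[volume] 0 := by
        -- The endpoint `u = 0` must be dropped, since the kernel without collisions equals 1 there.
        filter_upwards [show ∀ᵐ u : ℝ, u ≠ 0 by simp [ae_iff]] with u hu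
        refine Set.indicator_apply_eq_zero.2 fun h => ?_
        rw [timeKernel_of_neg (lt_of_le_of_ne h.2 hu), mul_zero]
      rw [integral_congr_ae z2, integral_congr_ae (ae_of_all _ z1)]
      simp
  rw [key]
  refine Continuous.mul (by fun_prop) ?_
  refine intervalIntegral.continuous_primitive (fun a b => ?_) 0
  exact (hi.intervalIntegrable (a := a) (b := b)).continuousOn_mul hb.continuousOn

/-- With `x` the modulus of the denominator, `x ≥ η` and `|β| ≤ x + R + η`; hence `1 + |β| ≤ x + (R
+ η + 1) ≤ (1 + (R + η + 1)/η) x`. -/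
lemma resolvent_bound {R η : ℝ} (hη : 0 < η) (hR : 0 ≤ R) (β : ℝ) {w : ℂ} (hw : w.im ≤ 0)
    (hwR : ‖w‖ ≤ R) :
    ‖1 / ((β : ℂ) - w + Complex.I * η)‖ ≤ (1 + (R + η + 1) / η) / (1 + |β|) := by
  have h1 : η ≤ ‖(β : ℂ) - w + Complex.I * η‖ := by
    refine le_trans ?_ (Complex.abs_im_le_norm _)
    simp
    refine le_trans ?_ (le_abs_self _)
    linarith
  have h2 : |β| ≤ ‖(β : ℂ) - w + Complex.I * η‖ + R + η := by
    have : (β : ℂ) = ((β : ℂ) - w + Complex.I * η) + w - Complex.I * η := by ring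
    calc |β| = ‖(β : ℂ)‖ := by simp
      _ = ‖((β : ℂ) - w + Complex.I * η) + w - Complex.I * η‖ := by rw [← this]
      _ ≤ _ := (norm_sub_le _ _).trans (add_le_add ((norm_add_le _ _).trans (by gcongr))
        (by simp [abs_of_pos hη]))
  set x := ‖(β : ℂ) - w + Complex.I * η‖
  have hx : 0 < x := hη.trans_le h1
  rw [norm_div, norm_one, div_le_div_iff₀ hx (by positivity)]
  have h3 : R + η + 1 ≤ (R + η + 1) / η * x := by
    rw [div_mul_eq_mul_div, le_div_iff₀ hη]
    gcongr
  linarith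

/-- Two of the `k + 2` factors give the integrable decay `(1 + β²)⁻¹`. A single denominator would
not, which is why paths without collision are treated apart. -/
lemma prod_resolvent_bound {R η : ℝ} (hη : 0 < η) (hR : 0 ≤ R) (k : ℕ) (β : ℝ)
    {w : Fin (k + 2) → ℂ} (hw : ∀ j, (w j).im ≤ 0) (hwR : ∀ j, ‖w j‖ ≤ R) :
    ‖∏ j, 1 / ((β : ℂ) - w j + Complex.I * η)‖ ≤
      (1 + (R + η + 1) / η) ^ (k + 2) * (1 + β ^ 2)⁻¹ := by
  rw [norm_prod]
  refine (Finset.prod_le_prod (fun _ _ => norm_nonneg _) fun j _ =>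
    resolvent_bound hη hR β (hw j) (hwR j)).trans ?_
  rw [Finset.prod_const, Finset.card_univ, Fintype.card_fin, div_pow, div_eq_mul_inv]
  refine mul_le_mul_of_nonneg_left ?_ (by positivity)
  refine inv_anti₀ (by positivity) ?_
  rw [pow_add]
  have h1 : 1 ≤ (1 + |β|) ^ k := one_le_pow₀ (by linarith [abs_nonneg β])
  nlinarith [sq_abs β, abs_nonneg β]

lemma integrable_prod_resolvent {η : ℝ} (hη : 0 < η) (k : ℕ)
    {w : Fin (k + 2) → ℂ} (hw : ∀ j, (w j).im ≤ 0) :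
    Integrable fun β : ℝ => ∏ j, 1 / ((β : ℂ) - w j + Complex.I * η) := by
  have hR : ∀ j, ‖w j‖ ≤ ∑ j, ‖w j‖ := fun j =>
    Finset.single_le_sum (fun i _ => norm_nonneg (w i)) (Finset.mem_univ j)
  refine (integrable_inv_one_add_sq.const_mul _).mono' ?_ (ae_of_all _ fun β =>
    prod_resolvent_bound hη (Finset.sum_nonneg fun i _ => norm_nonneg (w i)) k β hw hR)
  refine Continuous.aestronglyMeasurable (continuous_finsetProd _ fun j _ => ?_)
  refine continuous_const.div (by fun_prop) fun β h => ?_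
  apply_fun Complex.im at h
  simp at h
  linarith [hw j]

/-- The inverse Fourier representation of the time kernel by resolvents. -/
lemma integral_prod_resolvent {η : ℝ} (hη : 0 < η) (k : ℕ) (t : ℝ)
    {w : Fin (k + 2) → ℂ} (hw : ∀ j, (w j).im ≤ 0) :
    ∫ β : ℝ, Complex.exp (-Complex.I * t * β) * ∏ j, 1 / ((β : ℂ) - w j + Complex.I * η) =
      2 * Real.pi * (Complex.I ^ (k + 2))⁻¹ * Complex.exp (-(η * t)) * timeKernel (k + 1) t w := by
  -- The shift by `iη` makes all imaginary parts strictly negative, so `f` is integrable; it equals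
  -- `e^{-ηt}` times the original kernel.
  set f : ℝ → ℂ := fun t => timeKernel (k + 1) t (fun j => w j - Complex.I * η) with hf
  have hneg : ∀ j, (w j - Complex.I * η).im < 0 := fun j => by simp; linarith [hw j]
  have hfi : Integrable f := (integrable_timeKernel (k + 1) _ hneg).1
  have hfc : Continuous f := continuous_timeKernel_time k _ hneg
  -- The Fourier phase `e^{-2πiξt}` is an energy shift by `β = -2πξ`, so the transform is a product
  -- of resolvents at `β`. Since `f` is continuous and both functions are integrable, the inversion
  -- formula holds pointwise.
  have hF : ∀ ξ : ℝ, 𝓕 f ξ = Complex.I ^ (k + 2) *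
      ∏ j, 1 / (((-2 * Real.pi * ξ : ℝ) : ℂ) - w j + Complex.I * η) := by
    intro ξ
    have e1 : 𝓕 f ξ = ∫ v, timeKernel (k + 1) v
        (fun j => (w j - Complex.I * η) - ((-2 * Real.pi * ξ : ℝ) : ℂ)) := by
      rw [Real.fourier_real_eq_integral_exp_smul]
      congr 1; ext v
      rw [timeKernel_sub_const, smul_eq_mul]
      congr 2; push_cast; ring
    have hneg' : ∀ j, ((w j - Complex.I * η) - ((-2 * Real.pi * ξ : ℝ) : ℂ)).im < 0 := by
      intro j; rw [Complex.sub_im, Complex.ofReal_im, sub_zero]; exact hneg j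
    rw [e1, (integrable_timeKernel (k + 1) _ hneg').2]
    have : (Complex.I : ℂ) ^ (k + 2) = ∏ _j : Fin (k + 1 + 1), Complex.I := by simp
    rw [this, ← Finset.prod_mul_distrib]
    refine Finset.prod_congr rfl fun j _ => ?_
    have h0 : ((-2 * Real.pi * ξ : ℝ) : ℂ) - w j + Complex.I * η ≠ 0 := by
      intro h; apply_fun Complex.im at h
      have := hneg' j
      simp at h this; linarith
    have h1 : Complex.I * (w j - Complex.I * η - ((-2 * Real.pi * ξ : ℝ) : ℂ)) =
        -Complex.I * (((-2 * Real.pi * ξ : ℝ) : ℂ) - w j + Complex.I * η) := by ring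
    rw [h1]
    field_simp
    simp [neg_div]
  have hG := integrable_prod_resolvent hη k hw
  have hπ : (-2 * Real.pi) ≠ 0 := by simp [Real.pi_ne_zero]
  have hFi : Integrable (𝓕 f) := by
    rw [show 𝓕 f = _ from funext hF]
    exact (hG.comp_mul_left' hπ).const_mul _
  have inv := congrFun (hfc.fourierInv_fourier_eq hfi hFi) t
  rw [Real.fourierInv_eq'] at inv
  simp_rw [hF] at inv
  have e2 : ∀ v : ℝ, Complex.exp (((2 * Real.pi * inner ℝ v t : ℝ) : ℂ) * Complex.I) •
      (Complex.I ^ (k + 2) * ∏ j, 1 / (((-2 * Real.pi * v : ℝ) : ℂ) - w j + Complex.I * η)) =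
      Complex.I ^ (k + 2) * (fun β : ℝ => Complex.exp (-Complex.I * t * β) *
        ∏ j, 1 / ((β : ℂ) - w j + Complex.I * η)) (-2 * Real.pi * v) := by
    intro v
    simp only [smul_eq_mul]
    rw [mul_left_comm]
    congr 3
    simp
    ring
  simp_rw [e2] at inv
  rw [integral_const_mul, Measure.integral_comp_mul_left (fun β : ℝ =>
    Complex.exp (-Complex.I * t * β) * ∏ j, 1 / ((β : ℂ) - w j + Complex.I * η))] at inv
  simp only [hf] at inv
  rw [timeKernel_sub_const] at inv
  have e3 : Complex.exp (Complex.I * t * (Complex.I * η)) = Complex.exp (-(η * t)) := by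
    congr 1
    linear_combination (t * η : ℂ) * Complex.I_sq
  rw [e3] at inv
  have hI : (Complex.I : ℂ) ^ (k + 2) ≠ 0 := pow_ne_zero _ Complex.I_ne_zero
  have hpi : (Real.pi : ℂ) ≠ 0 := by exact_mod_cast Real.pi_ne_zero
  rw [mul_assoc _ (Complex.exp _), ← inv]
  have : |(-2 * Real.pi)⁻¹| = (2 * Real.pi)⁻¹ := by
    rw [abs_inv, abs_mul, abs_neg, abs_two, abs_of_pos Real.pi_pos]
  rw [this, Complex.real_smul]
  push_cast
  field_simp

end RandomSchrodinger

namespace RandomSchrodinger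

/-! ### Measure preserving maps between products -/

section Volume

variable {α β γ δ : Type*} [MeasureSpace α] [MeasureSpace β] [MeasureSpace γ] [MeasureSpace δ]

lemma volume_preserving_swap [SFinite (volume : Measure α)] [SFinite (volume : Measure β)] :
    MeasurePreserving (Prod.swap : α × β → β × α) := Measure.measurePreserving_swap

lemma volume_preserving_skew [SFinite (volume : Measure α)] [SFinite (volume : Measure β)]
    [SFinite (volume : Measure γ)] [SFinite (volume : Measure δ)] {f : α → γ}
    (hf : MeasurePreserving f) {g : α → β → δ} (hgm : Measurable (Function.uncurry g))
    (hg : ∀ a, MeasurePreserving (g a)) :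
    MeasurePreserving fun z : α × β => (f z.1, g z.1 z.2) :=
  hf.skew_product hgm (ae_of_all _ fun a => (hg a).map_eq)

lemma volume_preserving_skew_fst [SFinite (volume : Measure α)] [SFinite (volume : Measure β)]
    [SFinite (volume : Measure γ)] {g : β → α → γ} (hgm : Measurable (Function.uncurry g))
    (hg : ∀ b, MeasurePreserving (g b)) :
    MeasurePreserving fun z : α × β => (g z.2 z.1, z.2) :=
  volume_preserving_swap.comp
    ((volume_preserving_skew (MeasurePreserving.id _) hgm hg).comp volume_preserving_swap)

lemma volume_preserving_prodMap [SFinite (volume : Measure α)] [SFinite (volume : Measure β)]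
    [SFinite (volume : Measure γ)] [SFinite (volume : Measure δ)] {f : α → γ} {g : β → δ}
    (hf : MeasurePreserving f) (hg : MeasurePreserving g) : MeasurePreserving (Prod.map f g) :=
  hf.prod hg

instance [TopologicalSpace α] [TopologicalSpace β] [OpensMeasurableSpace α]
    [OpensMeasurableSpace β] [SFinite (volume : Measure β)]
    [IsFiniteMeasureOnCompacts (volume : Measure α)]
    [IsFiniteMeasureOnCompacts (volume : Measure β)] :
    IsFiniteMeasureOnCompacts (volume : Measure (α × β)) :=
  inferInstanceAs (IsFiniteMeasureOnCompacts ((volume : Measure α).prod volume))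

end Volume

/-! ### Momentum paths -/

/-- The path with starting point `p` and increments `m`. -/
def incrPath {G : Type*} [AddCommGroup G] {k : ℕ} (p : G) (m : Fin k → G) : Fin (k + 1) → G :=
  fun j => p + Fin.partialSum m j

section Path

variable {G : Type*} [AddCommGroup G] {k : ℕ}

@[simp] lemma incrPath_zero (p : G) (m : Fin k → G) : incrPath p m 0 = p := by simp [incrPath]

lemma incrPath_succ (p : G) (m : Fin k → G) (j : Fin k) :
    incrPath p m j.succ = incrPath p m j.castSucc + m j := by
  simp [incrPath, Fin.partialSum_succ, add_assoc]

lemma incrPath_cons (p a : G) (m : Fin k → G) :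
    incrPath p (Fin.cons a m : Fin (k + 1) → G) = Fin.cons p (incrPath (p + a) m) := by
  ext j
  induction j using Fin.cases with
  | zero => simp
  | succ j => simp [incrPath, Fin.partialSum_succ', add_assoc]

lemma incrPath_snoc_castSucc (p a : G) (m : Fin k → G) (j : Fin (k + 1)) :
    incrPath p (Fin.snoc (α := fun _ => G) m a) j.castSucc = incrPath p m j := by
  simp only [incrPath]
  rw [← Fin.partialSum_init, Fin.init_snoc]

lemma incrPath_last (p : G) (m : Fin k → G) : incrPath p m (Fin.last k) = p + ∑ j, m j := by
  induction k generalizing p with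
  | zero => simp [incrPath]
  | succ k ih =>
    obtain ⟨a, m, rfl⟩ : ∃ a m', m = Fin.cons a m' := ⟨m 0, Fin.tail m, (Fin.cons_self_tail m).symm⟩
    rw [incrPath_cons, ← Fin.succ_last, Fin.cons_succ, ih, Fin.sum_univ_succ]
    simp [add_assoc]

lemma map_incrPath {H : Type*} [AddCommGroup H] (f : G →+ H) (p : G) (m : Fin k → G)
    (j : Fin (k + 1)) : f (incrPath p m j) = incrPath (f p) (fun i => f (m i)) j := by
  induction j using Fin.induction with
  | zero => simp
  | succ j ih => rw [incrPath_succ, incrPath_succ, map_add, ih]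

end Path

lemma continuous_incrPath {d k : ℕ} :
    Continuous fun z : E d × (Fin k → E d) => incrPath z.1 z.2 := by
  refine continuous_pi fun j => ?_
  induction j using Fin.induction with
  | zero => simpa using continuous_fst
  | succ j ih =>
    simp only [incrPath_succ]
    exact ih.add ((continuous_apply j).comp continuous_snd)

/-- The map from a starting point and increments to the path is triangular with unit diagonal. The
induction peels off the first increment, and the rest is a path started from the translated point.
-/
lemma measurePreserving_incrPath (d k : ℕ) :
    MeasurePreserving (fun z : E d × (Fin k → E d) => incrPath z.1 z.2) := by
  induction k with
  | zero =>
    have h := (volume_preserving_piFinSuccAbove (fun _ : Fin 1 => E d) 0).symm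
    have e : (fun z : E d × (Fin 0 → E d) => incrPath z.1 z.2) =
        (MeasurableEquiv.piFinSuccAbove (fun _ : Fin 1 => E d) 0).symm := by
      ext z j : 2
      fin_cases j
      simp [MeasurableEquiv.piFinSuccAbove]
    rw [e]; exact h
  | succ k ih =>
    have h1 := (MeasurePreserving.id (volume : Measure (E d))).prod
      (volume_preserving_piFinSuccAbove (fun _ : Fin (k + 1) => E d) 0)
    have h2 : MeasurePreserving (fun z : E d × (E d × (Fin k → E d)) =>
        (z.1, incrPath (z.1 + z.2.1) z.2.2)) := by
      have hc : Continuous fun z : E d × (E d × (Fin k → E d)) => (z.1 + z.2.1, z.2.2) := by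
        fun_prop
      refine volume_preserving_skew (MeasurePreserving.id (volume : Measure (E d)))
        (g := fun (p : E d) (z : E d × (Fin k → E d)) => incrPath (p + z.1) z.2)
        (continuous_incrPath.comp hc).measurable fun p => ?_
      exact ih.comp ((measurePreserving_add_left (volume : Measure (E d)) p).prod
          (MeasurePreserving.id (volume : Measure (Fin k → E d))))
    have h4 := (volume_preserving_piFinSuccAbove (fun _ : Fin (k + 2) => E d) 0).symm
    have h5 := h4.comp (h2.comp h1)
    have e : (fun z : E d × (Fin (k + 1) → E d) => incrPath z.1 z.2) =
        (MeasurableEquiv.piFinSuccAbove (fun _ : Fin (k + 2) => E d) 0).symm ∘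
        (fun z : E d × (E d × (Fin k → E d)) => (z.1, incrPath (z.1 + z.2.1) z.2.2)) ∘
        Prod.map id (MeasurableEquiv.piFinSuccAbove (fun _ : Fin (k + 1) => E d) 0) := by
      ext z j : 2
      obtain ⟨p, m⟩ := z
      obtain ⟨a, m, rfl⟩ : ∃ a m', m = Fin.cons a m' :=
        ⟨m 0, Fin.tail m, (Fin.cons_self_tail m).symm⟩
      rw [incrPath_cons]
      simp [MeasurableEquiv.piFinSuccAbove]
    rw [e]; exact h5

/-! ### Resolution of the delta functions -/

/-- The product of the approximate delta functions in the momentum transfers. -/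
noncomputable def deltaProd {d k : ℕ} (r : ℝ) (a : E d × (Fin k → E d)) : ℝ :=
  deltaReg r a.1 * ∏ j, deltaReg r (a.2 j)

lemma measurable_deltaReg {d : ℕ} (r : ℝ) : Measurable (deltaReg r : E d → ℝ) := by
  unfold deltaReg
  exact measurable_const.indicator Metric.isOpen_ball.measurableSet

lemma integral_deltaReg {d : ℕ} {r : ℝ} (hr : 0 < r) : ∫ x : E d, deltaReg r x = 1 := by
  unfold deltaReg
  rw [integral_indicator Metric.isOpen_ball.measurableSet]
  have : volume.real (Metric.ball (0 : E d) r) ≠ 0 := by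
    rw [measureReal_def, ENNReal.toReal_ne_zero]
    exact ⟨(Metric.measure_ball_pos _ _ hr).ne', measure_ball_lt_top.ne⟩
  simp [this]

lemma deltaReg_nonneg {d : ℕ} (r : ℝ) (x : E d) : 0 ≤ deltaReg r x :=
  Set.indicator_nonneg (fun _ _ => by positivity) _

lemma deltaReg_le {d : ℕ} (r : ℝ) (x : E d) :
    deltaReg r x ≤ (volume.real (Metric.ball (0 : E d) r))⁻¹ :=
  Set.indicator_le_self' (fun _ _ => by positivity) _

lemma deltaReg_of_le {d : ℕ} {r : ℝ} {x : E d} (h : r ≤ ‖x‖) : deltaReg r x = 0 :=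
  Set.indicator_of_notMem (by simpa using h) _

lemma deltaProd_nonneg {d k : ℕ} (r : ℝ) (a : E d × (Fin k → E d)) : 0 ≤ deltaProd r a :=
  mul_nonneg (deltaReg_nonneg _ _) (Finset.prod_nonneg fun _ _ => deltaReg_nonneg _ _)

lemma measurable_deltaProd {d k : ℕ} (r : ℝ) :
    Measurable (deltaProd r : E d × (Fin k → E d) → ℝ) := by
  unfold deltaProd
  refine ((measurable_deltaReg r).comp measurable_fst).mul
    (Finset.measurable_prod _ fun j _ => (measurable_deltaReg r).comp
      ((measurable_pi_apply j).comp measurable_snd))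

lemma integral_deltaProd {d k : ℕ} {r : ℝ} (hr : 0 < r) :
    ∫ a : E d × (Fin k → E d), deltaProd r a = 1 := by
  unfold deltaProd
  have := integral_prod_mul (μ := (volume : Measure (E d))) (ν := (volume : Measure (Fin k → E d)))
    (deltaReg r) (fun m => ∏ j, deltaReg r (m j))
  rw [← Measure.volume_eq_prod] at this
  rw [this, integral_deltaReg hr, integral_fintype_prod_volume_eq_prod]
  simp [integral_deltaReg hr]

lemma deltaProd_eq_zero {d k : ℕ} {r : ℝ} (hr : 0 < r) {a : E d × (Fin k → E d)} (h : r ≤ ‖a‖) :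
    deltaProd r a = 0 := by
  unfold deltaProd
  rw [Prod.norm_def, le_max_iff] at h
  rcases h with h | h
  · rw [deltaReg_of_le h, zero_mul]
  · obtain ⟨j, hj⟩ : ∃ j, r ≤ ‖a.2 j‖ := by
      by_contra! hc
      exact absurd h (not_le.2 ((pi_norm_lt_iff hr).2 hc))
    rw [Finset.prod_eq_zero (Finset.mem_univ j) (deltaReg_of_le hj), mul_zero]

/-- A non-integrable function would have integral 0, not 1. -/
lemma integrable_deltaProd {d k : ℕ} {r : ℝ} (hr : 0 < r) :
    Integrable (deltaProd r : E d × (Fin k → E d) → ℝ) := by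
  by_contra h
  have := integral_deltaProd (d := d) (k := k) hr
  rw [integral_undef h] at this
  exact zero_ne_one this

/-- An approximate identity: nonnegative, of mass 1, and supported in the ball of radius `r` of the
sup norm, where `f` is close to `f 0`. Boundedness of `f` is not needed. -/
lemma tendsto_integral_deltaProd_mul {d k : ℕ} {f : E d × (Fin k → E d) → ℂ} (hf : Continuous f) :
    Tendsto (fun r => ∫ a, (deltaProd r a : ℂ) * f a) (𝓝[>] (0 : ℝ)) (𝓝 (f 0)) := by
  rw [Metric.tendsto_nhdsWithin_nhds]
  intro ε hε
  obtain ⟨δ, hδ, h⟩ := Metric.continuousAt_iff.1 (hf.continuousAt (x := 0)) (ε / 2) (half_pos hε)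
  refine ⟨δ, hδ, fun r (hr : 0 < r) hrδ => ?_⟩
  have hrδ' : r < δ := by simpa [abs_of_pos hr] using hrδ
  have hbound : ∀ a, ‖(deltaProd r a : ℂ) * (f a - f 0)‖ ≤ deltaProd r a * (ε / 2) := by
    intro a
    rw [norm_mul, Complex.norm_real, Real.norm_of_nonneg (deltaProd_nonneg r a)]
    by_cases ha : ‖a‖ < r
    · refine mul_le_mul_of_nonneg_left ?_ (deltaProd_nonneg r a)
      rw [← dist_eq_norm]
      exact (h (by simpa using ha.trans hrδ')).le
    · rw [deltaProd_eq_zero hr (not_lt.1 ha)]; simp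
  have hi1 : Integrable fun a => (deltaProd r a : ℂ) * (f a - f 0) :=
    ((integrable_deltaProd hr).mul_const _).mono'
      ((Complex.measurable_ofReal.comp (measurable_deltaProd r)).aestronglyMeasurable.mul
      (hf.sub continuous_const).aestronglyMeasurable) (ae_of_all _ hbound)
  have hi2 : Integrable fun a : E d × (Fin k → E d) => (deltaProd r a : ℂ) * f 0 :=
    (integrable_deltaProd hr).ofReal.mul_const _
  have e : ∫ a, (deltaProd r a : ℂ) * f a = (∫ a, (deltaProd r a : ℂ) * (f a - f 0)) + f 0 := by
    have : ∫ a : E d × (Fin k → E d), (deltaProd r a : ℂ) * f 0 = f 0 := by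
      rw [integral_mul_const, integral_complex_ofReal, integral_deltaProd hr]; simp
    have h3 := integral_add hi1 hi2
    rw [this] at h3
    rw [← h3]
    congr 1; ext a; ring
  rw [e, dist_eq_norm, add_sub_cancel_right]
  refine (norm_integral_le_of_norm_le ((integrable_deltaProd hr).mul_const _)
    (ae_of_all _ hbound)).trans_lt ?_
  rw [integral_mul_const, integral_deltaProd hr]
  linarith

/-- Momenta in terms of the defects `a` of the momentum conservation laws. -/
def resolvedMomenta {d k : ℕ} (ξ : E d) (σ : Equiv.Perm (Fin k))
    (x : (E d × (Fin k → E d)) × (E d × (Fin k → E d))) :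
    (Fin (k + 1) → E d) × (Fin (k + 1) → E d) :=
  (incrPath (x.2.1 + ξ - ∑ j, x.1.2 j - x.1.1) (x.2.2 ∘ σ + x.1.2), incrPath x.2.1 x.2.2)

lemma continuous_resolvedMomenta {d k : ℕ} (ξ : E d) (σ : Equiv.Perm (Fin k)) :
    Continuous (resolvedMomenta ξ σ : _ → (Fin (k + 1) → E d) × (Fin (k + 1) → E d)) := by
  unfold resolvedMomenta
  refine Continuous.prodMk (continuous_incrPath.comp (Continuous.prodMk (by fun_prop)
    (Continuous.add ?_ (by fun_prop)))) (continuous_incrPath.comp continuous_snd)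
  exact continuous_pi fun j => (continuous_apply (σ j)).comp (continuous_snd.comp continuous_snd)

/-- For fixed `p'` data the defects enter by a translation in the increments followed by a reflected
translation in the starting point; two path maps complete the change of variables. -/
lemma measurePreserving_resolvedMomenta {d k : ℕ} (ξ : E d) (σ : Equiv.Perm (Fin k)) :
    MeasurePreserving (resolvedMomenta (d := d) ξ σ) := by
  have hm : Continuous (Function.uncurry fun (q a : E d × (Fin k → E d)) =>
      (q.1 + ξ - ∑ j, a.2 j - a.1, q.2 ∘ σ + a.2)) := by
    refine Continuous.prodMk (by fun_prop) (Continuous.add ?_ (by fun_prop))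
    exact continuous_pi fun j => (continuous_apply (σ j)).comp (continuous_snd.comp continuous_fst)
  have h1 : ∀ q : E d × (Fin k → E d), MeasurePreserving (fun a : E d × (Fin k → E d) =>
      (q.1 + ξ - ∑ j, a.2 j - a.1, q.2 ∘ σ + a.2)) := by
    intro q
    have h2 := volume_preserving_skew (measurePreserving_add_left
      (volume : Measure (Fin k → E d)) (q.2 ∘ σ))
      (g := fun (ν : Fin k → E d) (u : E d) => q.1 + ξ - ∑ j, ν j - u)
      (by unfold Function.uncurry; fun_prop)
      (fun ν => Measure.measurePreserving_sub_left (volume : Measure (E d)) _)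
    exact volume_preserving_swap.comp (h2.comp volume_preserving_swap)
  have h3 := volume_preserving_skew_fst hm.measurable h1
  have h4 := measurePreserving_incrPath d k
  exact (volume_preserving_prodMap h4 h4).comp h3

lemma prod_evenLumps_bot {k : ℕ} (σ : Equiv.Perm (Fin k))
    (f : Finset (Fin k ⊕ Fin k) → ℝ) :
    ∏ S ∈ evenLumps (⊥ : Finpartition (Finset.univ : Finset (Fin k))) σ, f S =
      ∏ j, f {Sum.inl j, Sum.inr (σ j)} := by
  unfold evenLumps
  rw [Finset.prod_image]
  · rw [Finpartition.parts_bot, Finset.prod_map]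
    refine Finset.prod_congr rfl fun j _ => ?_
    congr 1
  -- The lumps form a `Finset.image`, so the product needs distinct lumps; the left part of a lump
  -- recovers its block.
  · intro a _ b _ hab
    have := congrArg Finset.toLeft hab
    simpa using this

/-- The transfer on the `p` side is `m_{σ(j)} + ν_j` and that on the `p'` side is `m_{σ(j)}`, so the
flux through lump `j` is the defect `ν_j`; the starting point is chosen so that the remaining
argument is `u`. -/
lemma DeltaReg_resolvedMomenta {d k : ℕ} (r : ℝ) (ξ : E d) (σ : Equiv.Perm (Fin k))
    (x : (E d × (Fin k → E d)) × (E d × (Fin k → E d))) :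
    DeltaReg r ξ (evenLumps ⊥ σ) (resolvedMomenta ξ σ x).1 (resolvedMomenta ξ σ x).2 =
      deltaProd r x.1 := by
  obtain ⟨⟨u, ν⟩, ⟨q, m⟩⟩ := x
  unfold DeltaReg deltaProd
  rw [prod_evenLumps_bot]
  congr 1
  · congr 1
    simp only [resolvedMomenta, incrPath_last, Pi.add_apply, Function.comp_apply,
      Finset.sum_add_distrib]
    rw [Equiv.sum_comp σ m]
    abel
  · refine Finset.prod_congr rfl fun j _ => ?_
    congr 1
    simp [lumpFlux, vertexFlux, resolvedMomenta, incrPath_succ]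

/-- The integral against the delta functions of the Feynman graph of a permutation. -/
lemma deltaIntegral_evenLumps_bot {d k : ℕ} (ξ : E d) (σ : Equiv.Perm (Fin k))
    (F : (Fin (k + 1) → E d) → (Fin (k + 1) → E d) → ℂ) (hF : Continuous (Function.uncurry F))
    (hc : HasCompactSupport (Function.uncurry F)) :
    deltaIntegral ξ (evenLumps ⊥ σ) F =
      ∫ z : E d × (Fin k → E d), F (incrPath (z.1 + ξ) (z.2 ∘ σ)) (incrPath z.1 z.2) := by
  have hmp := measurePreserving_resolvedMomenta (d := d) ξ σ
  set G : E d × (Fin k → E d) → ℂ := fun a => ∫ z : E d × (Fin k → E d),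
    Function.uncurry F (resolvedMomenta ξ σ (a, z)) with hG
  -- The `p'` component does not depend on the defects `a`, so the projection of the support to it
  -- yields a majorant uniform in `a`, and `G` is continuous.
  set K := Prod.snd '' tsupport (Function.uncurry F) with hK
  have hKc : IsCompact K := hc.isCompact.image continuous_snd
  obtain ⟨C, hC⟩ := hF.bounded_above_of_compact_support hc
  have hcont : Continuous G := by
    refine continuous_of_dominated (bound := fun z => (K.indicator (fun _ => C)) (incrPath z.1 z.2))
      ?_ ?_ ?_ ?_
    · intro a
      exact ((hF.comp (continuous_resolvedMomenta ξ σ)).comp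
        (Continuous.prodMk_right a)).aestronglyMeasurable
    · intro a
      refine ae_of_all _ fun z => ?_
      by_cases hz : incrPath z.1 z.2 ∈ K
      · rw [Set.indicator_of_mem hz]; exact hC _
      · rw [Set.indicator_of_notMem hz, image_eq_zero_of_notMem_tsupport (f := Function.uncurry F), norm_zero]
        exact fun h => hz ⟨_, h, rfl⟩
    · refine ((measurePreserving_incrPath d k).integrable_comp
        (g := K.indicator (fun _ => C)) ?_).2 ?_
      · exact (measurable_const.indicator hKc.measurableSet).aestronglyMeasurable
      · rw [integrable_indicator_iff hKc.measurableSet]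
        exact integrableOn_const hKc.measure_lt_top.ne
    · exact ae_of_all _ fun z => (hF.comp (continuous_resolvedMomenta ξ σ)).comp
        (Continuous.prodMk_left z)
  have hlim := tendsto_integral_deltaProd_mul hcont
  have hG0 : G 0 = ∫ z : E d × (Fin k → E d),
      F (incrPath (z.1 + ξ) (z.2 ∘ σ)) (incrPath z.1 z.2) := by
    simp [hG, resolvedMomenta, Function.uncurry]
  rw [hG0] at hlim
  unfold deltaIntegral
  refine Tendsto.limUnder_eq (hlim.congr' ?_)
  filter_upwards [self_mem_nhdsWithin] with r (hr : 0 < r)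
  have hFi : Integrable (Function.uncurry F) := hF.integrable_of_hasCompactSupport hc
  have hDm : Measurable fun w : (Fin (k + 1) → E d) × (Fin (k + 1) → E d) =>
      (DeltaReg r ξ (evenLumps ⊥ σ) w.1 w.2 : ℂ) := by
    refine Complex.measurable_ofReal.comp ?_
    unfold DeltaReg lumpFlux
    refine ((measurable_deltaReg r).comp (by fun_prop)).mul (Finset.measurable_prod _ fun S _ =>
      (measurable_deltaReg r).comp (Finset.measurable_sum _ fun v _ => ?_))
    cases v <;> (simp only [vertexFlux]; fun_prop)
  have hm : AEStronglyMeasurable (fun w : (Fin (k + 1) → E d) × (Fin (k + 1) → E d) =>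
      (DeltaReg r ξ (evenLumps ⊥ σ) w.1 w.2 : ℂ) * F w.1 w.2) volume :=
    hDm.aestronglyMeasurable.mul hF.aestronglyMeasurable
  rw [← hmp.map_eq] at hm
  conv_rhs => rw [← hmp.map_eq, integral_map hmp.measurable.aemeasurable hm]
  simp_rw [DeltaReg_resolvedMomenta]
  have hFi' : Integrable (fun x => Function.uncurry F (resolvedMomenta ξ σ x)) :=
    (hmp.integrable_comp hF.aestronglyMeasurable).2 hFi
  have hint : Integrable (fun x : (E d × (Fin k → E d)) × (E d × (Fin k → E d)) =>
      (deltaProd r x.1 : ℂ) * Function.uncurry F (resolvedMomenta ξ σ x)) := by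
    refine hFi'.bdd_mul (c := (volume.real (Metric.ball (0 : E d) r))⁻¹ ^ (k + 1)) ?_ ?_
    · exact (Complex.measurable_ofReal.comp
        ((measurable_deltaProd r).comp measurable_fst)).aestronglyMeasurable
    · refine ae_of_all _ fun x => ?_
      rw [Complex.norm_real, Real.norm_of_nonneg (deltaProd_nonneg r _), pow_succ']
      unfold deltaProd
      refine mul_le_mul (deltaReg_le _ _) ?_ (Finset.prod_nonneg fun _ _ => deltaReg_nonneg _ _)
        (by positivity)
      refine (Finset.prod_le_prod (fun _ _ => deltaReg_nonneg _ _)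
        fun j _ => deltaReg_le r (x.1.2 j)).trans_eq (by simp)
  refine Eq.trans ?_ (integral_prod _ hint).symm
  congr 1; ext a
  exact (integral_const_mul _ _).symm

end RandomSchrodinger

namespace RandomSchrodinger

/-! ### The value of the Feynman graph of a permutation -/

lemma exists_radius_of_hasCompactSupport {d : ℕ} {f : E d → ℂ} (hf : HasCompactSupport f) :
    ∃ R : ℝ, 0 < R ∧ ∀ p, f p ≠ 0 → ‖p‖ ≤ R := by
  obtain ⟨R, hR⟩ := hf.isCompact.isBounded.subset_closedBall 0
  refine ⟨max R 1, by positivity, fun p hp => ?_⟩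
  have := hR (subset_tsupport f hp)
  exact (by simpa using this : ‖p‖ ≤ R).trans (le_max_left _ _)

lemma norm_le_of_increments_le {d k : ℕ} {R : ℝ} {p : Fin (k + 1) → E d} (h0 : ‖p 0‖ ≤ R)
    (h : ∀ j : Fin k, ‖p j.succ - p j.castSucc‖ ≤ R) (j : Fin (k + 1)) :
    ‖p j‖ ≤ (k + 1) * R := by
  have hR : 0 ≤ R := (norm_nonneg _).trans h0
  have key : ‖p j‖ ≤ ((j : ℕ) + 1) * R := by
    induction j using Fin.induction with
    | zero => simpa using h0
    | succ j ih =>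
      have e : p j.succ = (p j.succ - p j.castSucc) + p j.castSucc := by abel
      rw [e]
      refine (norm_add_le _ _).trans ((add_le_add (h j) ih).trans_eq ?_)
      simp; ring
  refine key.trans (mul_le_mul_of_nonneg_right ?_ hR)
  have : ((j : ℕ) : ℝ) ≤ k := by exact_mod_cast Nat.lt_succ_iff.1 j.2
  linarith

section Vertex

variable {d k : ℕ} (B : SchwartzMap (E d) ℝ) (ψ : SchwartzMap (E d) ℂ) (Q : E d → ℂ)

lemma continuous_vertexFactor (hQ : Continuous Q) :
    Continuous fun w : (Fin (k + 1) → E d) × (Fin (k + 1) → E d) =>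
      vertexFactor B (fun x => ψ x) Q w.1 w.2 := by
  have hB := continuous_Bhat B
  have hψ : Continuous (𝓕 (fun x => ψ x)) := (𝓕 ψ : SchwartzMap (E d) ℂ).continuous
  unfold vertexFactor
  fun_prop

variable {B ψ}

lemma norm_le_of_vertexFactor_ne_zero {R : ℝ} (hRB : ∀ p, Bhat B p ≠ 0 → ‖p‖ ≤ R)
    (hRψ : ∀ p, 𝓕 (fun x => ψ x) p ≠ 0 → ‖p‖ ≤ R) {p p' : Fin (k + 1) → E d}
    (h : vertexFactor B (fun x => ψ x) Q p p' ≠ 0) :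
    ‖p 0‖ ≤ R ∧ ‖p' 0‖ ≤ R ∧ (∀ j : Fin k, ‖p j.succ - p j.castSucc‖ ≤ R) ∧
      ∀ j : Fin k, ‖p' j.succ - p' j.castSucc‖ ≤ R := by
  unfold vertexFactor at h
  simp only [ne_eq, mul_eq_zero, not_or, Finset.prod_eq_zero_iff, not_exists, Finset.mem_univ,
    true_and, map_eq_zero] at h
  obtain ⟨⟨⟨h1, h2⟩, h3, h4⟩, -⟩ := h
  refine ⟨hRψ _ h3, hRψ _ h4, fun j => ?_, fun j => hRB _ (h2 j)⟩
  rw [norm_sub_rev]; exact hRB _ (h1 j)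

/-- The factors `ψ̂₀` bound the two starting points and the factors `B̂` bound all increments, hence
every momentum of both paths; no decay of `Q` is used. -/
lemma hasCompactSupport_vertexFactor (hB : HasCompactSupport (Bhat B))
    (hψ : HasCompactSupport (𝓕 (fun x => ψ x))) :
    HasCompactSupport fun w : (Fin (k + 1) → E d) × (Fin (k + 1) → E d) =>
      vertexFactor B (fun x => ψ x) Q w.1 w.2 := by
  obtain ⟨R₁, h₁, hR₁⟩ := exists_radius_of_hasCompactSupport hB
  obtain ⟨R₂, h₂, hR₂⟩ := exists_radius_of_hasCompactSupport hψ
  set R := max R₁ R₂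
  refine HasCompactSupport.of_support_subset_isCompact
    (isCompact_closedBall 0 ((k + 1) * R)) fun w hw => ?_
  obtain ⟨a, b, c, e⟩ := norm_le_of_vertexFactor_ne_zero Q
    (fun p hp => (hR₁ p hp).trans (le_max_left _ _))
    (fun p hp => (hR₂ p hp).trans (le_max_right _ _)) hw
  rw [mem_closedBall_zero_iff]
  have hR : 0 ≤ (k + 1) * R := by positivity
  rw [Prod.norm_def, max_le_iff, pi_norm_le_iff_of_nonneg hR, pi_norm_le_iff_of_nonneg hR]
  exact ⟨norm_le_of_increments_le a c, norm_le_of_increments_le b e⟩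

lemma continuous_comp_perm (σ : Equiv.Perm (Fin k)) :
    Continuous fun m : Fin k → E d => m ∘ σ :=
  continuous_pi fun j => continuous_apply (σ j)

variable (B ψ)

/-- The vertex factor of the graph of `σ` after resolution of the delta functions. -/
noncomputable def pathFactor (ξ : E d) (σ : Equiv.Perm (Fin k)) (z : E d × (Fin k → E d)) : ℂ :=
  vertexFactor B (fun x => ψ x) Q (incrPath (z.1 + ξ) (z.2 ∘ σ)) (incrPath z.1 z.2)

variable {Q}

lemma continuous_paths (ξ : E d) (σ : Equiv.Perm (Fin k)) :
    Continuous fun z : E d × (Fin k → E d) => incrPath (z.1 + ξ) (z.2 ∘ σ) :=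
  continuous_incrPath.comp (Continuous.prodMk (by fun_prop)
    ((continuous_comp_perm σ).comp continuous_snd))

lemma continuous_pathFactor (hQ : Continuous Q) (ξ : E d) (σ : Equiv.Perm (Fin k)) :
    Continuous (pathFactor B ψ Q ξ σ) := by
  have h1 := continuous_vertexFactor (k := k) B ψ Q hQ
  have h2 : Continuous fun z : E d × (Fin k → E d) =>
      (incrPath (z.1 + ξ) (z.2 ∘ σ), incrPath z.1 z.2) :=
    (continuous_paths ξ σ).prodMk continuous_incrPath
  have h3 := h1.comp h2
  exact h3

variable {B ψ} (Q)

lemma hasCompactSupport_pathFactor (hB : HasCompactSupport (Bhat B))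
    (hψ : HasCompactSupport (𝓕 (fun x => ψ x))) (ξ : E d) (σ : Equiv.Perm (Fin k)) :
    HasCompactSupport (pathFactor B ψ Q ξ σ) := by
  obtain ⟨R₁, h₁, hR₁⟩ := exists_radius_of_hasCompactSupport hB
  obtain ⟨R₂, h₂, hR₂⟩ := exists_radius_of_hasCompactSupport hψ
  obtain ⟨R, hRd⟩ : ∃ R, R = max R₁ R₂ := ⟨_, rfl⟩
  refine HasCompactSupport.of_support_subset_isCompact (isCompact_closedBall 0 R) fun z hz => ?_
  obtain ⟨-, b, -, e⟩ := norm_le_of_vertexFactor_ne_zero Q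
    (fun p hp => (hR₁ p hp).trans (hRd ▸ le_max_left _ _))
    (fun p hp => (hR₂ p hp).trans (hRd ▸ le_max_right _ _)) hz
  rw [mem_closedBall_zero_iff]
  have hR : 0 ≤ R := by rw [hRd]; positivity
  rw [Prod.norm_def, max_le_iff, pi_norm_le_iff_of_nonneg hR]
  refine ⟨by simpa using b, fun j => ?_⟩
  simpa [incrPath_succ] using e j

end Vertex

/-- The product of resolvents along a momentum path. -/
noncomputable def pathResolvent {d k : ℕ} (B : SchwartzMap (E d) ℝ) (lam η : ℝ) (β : ℝ)
    (p : Fin (k + 1) → E d) : ℂ :=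
  ∏ j, 1 / ((β : ℂ) - omega B lam (p j) + Complex.I * η)

/-- The time kernel along a momentum path. -/
noncomputable def pathKernel {d k : ℕ} (B : SchwartzMap (E d) ℝ) (lam t : ℝ)
    (p : Fin (k + 1) → E d) : ℂ :=
  timeKernel k t fun j => omega B lam (p j)

lemma continuous_pathKernel {d k : ℕ} (hd : 3 ≤ d) (B : SchwartzMap (E d) ℝ) (lam : ℝ)
    (t : ℝ) :
    Continuous (pathKernel B lam t : (Fin (k + 1) → E d) → ℂ) := by
  have := continuous_omega hd B lam
  exact (continuous_timeKernel k t).comp (by fun_prop)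

lemma norm_pathKernel_le {d k : ℕ} (hd : 3 ≤ d) (B : SchwartzMap (E d) ℝ) (lam : ℝ)
    {t : ℝ} (ht : 0 ≤ t) (p : Fin (k + 1) → E d) :
    ‖pathKernel B lam t p‖ ≤ t ^ k :=
  norm_timeKernel_le ht fun _ => omega_im_nonpos hd B lam _

lemma continuous_pathResolvent {d k : ℕ} (hd : 3 ≤ d) (B : SchwartzMap (E d) ℝ) (lam : ℝ)
    {η : ℝ} (hη : 0 < η) :
    Continuous fun z : ℝ × (Fin (k + 1) → E d) => pathResolvent B lam η z.1 z.2 := by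
  have := continuous_omega hd B lam
  unfold pathResolvent
  refine continuous_finsetProd _ fun j _ => continuous_const.div (by fun_prop) fun z h => ?_
  apply_fun Complex.im at h
  simp at h
  linarith [omega_im_nonpos hd B lam (z.2 j)]

section Swap

variable {Z : Type*} [TopologicalSpace Z] [MeasureSpace Z] [OpensMeasurableSpace Z]
  [SecondCountableTopology Z] [IsFiniteMeasureOnCompacts (volume : Measure Z)]

/-- Decay `(1 + α²)⁻¹` is required only over the support of `V`, where the energies are bounded. -/
lemma integrable_resolvent_mul {f : ℝ × Z → ℂ} {V : Z → ℂ} (hf : Continuous f) (hV : Continuous V)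
    (hVc : HasCompactSupport V) {C : ℝ}
    (hC : ∀ α, ∀ z ∈ tsupport V, ‖f (α, z)‖ ≤ C * (1 + α ^ 2)⁻¹) :
    Integrable (fun x : ℝ × Z => f x * V x.2) ((volume : Measure ℝ).prod (volume : Measure Z)) := by
  have h1 : Integrable (fun x : ℝ × Z => (C * (1 + x.1 ^ 2)⁻¹) * ‖V x.2‖)
      ((volume : Measure ℝ).prod (volume : Measure Z)) :=
    (integrable_inv_one_add_sq.const_mul C).mul_prod
      (hV.integrable_of_hasCompactSupport hVc).norm
  refine h1.mono' (hf.mul (hV.comp continuous_snd)).aestronglyMeasurable (ae_of_all _ fun x => ?_)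
  rw [norm_mul]
  by_cases hx : x.2 ∈ tsupport V
  · exact mul_le_mul_of_nonneg_right (hC x.1 x.2 hx) (norm_nonneg _)
  · rw [image_eq_zero_of_notMem_tsupport hx]; simp

/-- Interchange of the energy integrals with the momentum integral. -/
lemma integral_integral_resolvent_swap [SFinite (volume : Measure Z)] {f g : ℝ × Z → ℂ} {V : Z → ℂ} (hf : Continuous f)
    (hg : Continuous g) (hV : Continuous V) (hVc : HasCompactSupport V) {C : ℝ}
    (hfC : ∀ α, ∀ z ∈ tsupport V, ‖f (α, z)‖ ≤ C * (1 + α ^ 2)⁻¹)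
    (hgC : ∀ α, ∀ z ∈ tsupport V, ‖g (α, z)‖ ≤ C * (1 + α ^ 2)⁻¹)
    {F G : Z → ℂ} (hG : Continuous G) (hF' : ∀ z, ∫ α, f (α, z) = F z)
    (hG' : ∀ z, ∫ β, g (β, z) = G z) :
    ∫ α, ∫ β, ∫ z, f (α, z) * g (β, z) * V z = ∫ z, F z * G z * V z := by
  have h1 : ∀ α, ∫ β, ∫ z, f (α, z) * g (β, z) * V z = ∫ z, f (α, z) * (G z * V z) := by
    intro α
    rw [integral_integral_swap]
    · congr 1; ext z
      rw [← hG', ← integral_mul_const, ← integral_const_mul]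
      congr 1; ext β; ring
    · have hV2 : Continuous fun z => f (α, z) * V z := by fun_prop
      have hc2 : HasCompactSupport fun z => f (α, z) * V z := hVc.mul_left
      have := integrable_resolvent_mul hg hV2 hc2 (C := C) fun β z hz =>
        hgC β z (closure_mono (fun y hy => right_ne_zero_of_mul hy) hz)
      refine this.congr (ae_of_all _ fun x => ?_)
      simp only [Function.uncurry]; ring
  simp_rw [h1]
  rw [integral_integral_swap]
  · congr 1; ext z
    rw [integral_mul_const, hF']; ring
  · have hc2 : HasCompactSupport fun z => G z * V z := hVc.mul_left
    exact integrable_resolvent_mul hf (hG.mul hV) hc2 (C := C) fun β z hz =>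
        hfC β z (closure_mono (fun y hy => right_ne_zero_of_mul hy) hz)

end Swap

lemma conj_pathResolvent {d k : ℕ} (B : SchwartzMap (E d) ℝ) (lam η α : ℝ)
    (p : Fin (k + 1) → E d) :
    conj (pathResolvent B lam η α p) =
      ∏ j, 1 / ((α : ℂ) - conj (omega B lam (p j)) - Complex.I * η) := by
  unfold pathResolvent
  rw [map_prod]
  refine Finset.prod_congr rfl fun j _ => ?_
  simp [sub_eq_add_neg]

/-- The resolvents are continuous because `η > 0` and `Im ω ≤ 0`, so the compactly supported vertex
factor makes the resolution of the delta functions applicable. -/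
lemma graphValueAB_evenLumps_bot {d k : ℕ} (hd : 3 ≤ d) {B : SchwartzMap (E d) ℝ}
    (hB : HasCompactSupport (Bhat B)) {ψ : SchwartzMap (E d) ℂ}
    (hψ : HasCompactSupport (𝓕 (fun x => ψ x))) (lam : ℝ) {η : ℝ} (hη : 0 < η)
    (ξ : E d) (σ : Equiv.Perm (Fin k)) {Q : E d → ℂ} (hQ : Continuous Q) (α β : ℝ) :
    graphValueAB B lam η (fun x => ψ x) ξ (evenLumps ⊥ σ) Q α β =
      (lam : ℂ) ^ (2 * k) * ∫ z : E d × (Fin k → E d),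
        conj (pathResolvent B lam η α (incrPath (z.1 + ξ) (z.2 ∘ σ))) *
          pathResolvent B lam η β (incrPath z.1 z.2) * pathFactor B ψ Q ξ σ z := by
  unfold graphValueAB
  simp_rw [← conj_pathResolvent]
  have h1 := continuous_vertexFactor (k := k) B ψ Q hQ
  have hres := continuous_pathResolvent (k := k) hd B lam hη
  have h2 := hres.comp (Continuous.prodMk_right α)
  have h3 := hres.comp (Continuous.prodMk_right β)
  have h4 := ((Complex.continuous_conj.comp (h2.comp continuous_fst)).mul
    (h3.comp continuous_snd)).mul h1
  rw [deltaIntegral_evenLumps_bot]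
  · rfl
  · exact h4
  · exact (hasCompactSupport_vertexFactor (k := k) Q hB hψ).mul_left

/-- The value of the Feynman graph of a permutation in terms of the time kernels. -/
lemma feynmanValue_bot {d : ℕ} (hd : 3 ≤ d) {B : SchwartzMap (E d) ℝ}
    (hB : HasCompactSupport (Bhat B)) {ψ : SchwartzMap (E d) ℂ}
    (hψ : HasCompactSupport (𝓕 (fun x => ψ x))) (lam : ℝ) {η t : ℝ} (hη : 0 < η) (ht : 0 ≤ t)
    (k : ℕ) (ξ : E d) (σ : Equiv.Perm (Fin k)) {Q : E d → ℂ} (hQ : Continuous Q) :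
    feynmanValue B lam η t (fun x => ψ x) ξ ⊥ σ Q = (lam : ℂ) ^ (2 * k) *
      ∫ z : E d × (Fin k → E d), conj (pathKernel B lam t (incrPath (z.1 + ξ) (z.2 ∘ σ))) *
        pathKernel B lam t (incrPath z.1 z.2) * pathFactor B ψ Q ξ σ z := by
  have hω := continuous_omega hd B lam
  unfold feynmanValue graphValue
  rcases k with _ | k
  · rw [if_pos rfl, deltaIntegral_evenLumps_bot]
    · simp only [mul_zero, pow_zero, one_mul]
      congr 1; ext z
      unfold pathKernel pathFactor
      rw [timeKernel_zero ht, timeKernel_zero ht, ← Complex.exp_conj]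
      simp
    · have := continuous_vertexFactor (k := 0) B ψ Q hQ
      unfold Function.uncurry
      fun_prop
    · exact (hasCompactSupport_vertexFactor (k := 0) Q hB hψ).mul_left
  · rw [if_neg (by simp)]
    have hV := continuous_pathFactor B ψ hQ ξ σ
    have hVc := hasCompactSupport_pathFactor Q hB hψ ξ σ
    have hp := continuous_paths ξ σ
    have hp' := continuous_incrPath (d := d) (k := k + 1)
    have hres := continuous_pathResolvent (k := k + 1) hd B lam hη
    have e1 : ∀ α β : ℝ, Complex.exp (Complex.I * t * ((α : ℂ) - β)) *
        graphValueAB B lam η (fun x => ψ x) ξ (evenLumps ⊥ σ) Q α β =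
        (lam : ℂ) ^ (2 * (k + 1)) * ∫ z : E d × (Fin (k + 1) → E d),
          (conj (Complex.exp (-Complex.I * t * α) *
            pathResolvent B lam η α (incrPath (z.1 + ξ) (z.2 ∘ σ)))) *
          (Complex.exp (-Complex.I * t * β) * pathResolvent B lam η β (incrPath z.1 z.2)) *
          pathFactor B ψ Q ξ σ z := by
      intro α β
      rw [graphValueAB_evenLumps_bot hd hB hψ lam hη ξ σ hQ, mul_left_comm, ← integral_const_mul]
      congr 2; ext z
      rw [map_mul, ← Complex.exp_conj, mul_sub, Complex.exp_sub]
      simp only [map_mul, map_neg, Complex.conj_I, Complex.conj_ofReal, neg_neg]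
      rw [neg_mul, neg_mul, Complex.exp_neg]
      ring
    simp_rw [e1, integral_const_mul]
    -- On the compact support of the path factor the energies along both paths are bounded, which
    -- makes the resolvent estimates uniform in `z`.
    obtain ⟨R₁, hR₁⟩ := hVc.isCompact.exists_bound_of_continuousOn
      (f := fun z => fun j => omega B lam (incrPath (z.1 + ξ) (z.2 ∘ σ) j))
      (Continuous.continuousOn (by fun_prop))
    obtain ⟨R₂, hR₂⟩ := hVc.isCompact.exists_bound_of_continuousOn
      (f := fun z => fun j => omega B lam (incrPath z.1 z.2 j))
      (Continuous.continuousOn (by fun_prop))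
    set R := max 0 (max R₁ R₂)
    have hR0 : 0 ≤ R := le_max_left _ _
    have hint : ∀ p : Fin (k + 1 + 1) → E d,
        ∫ β : ℝ, Complex.exp (-Complex.I * t * β) * pathResolvent B lam η β p =
        2 * Real.pi * (Complex.I ^ (k + 1 + 1))⁻¹ * Complex.exp (-(η * t)) *
          pathKernel B lam t p := fun p =>
      integral_prod_resolvent hη k t (w := fun j => omega B lam (p j))
        fun _ => omega_im_nonpos hd B lam _
    have hphase : ∀ α : ℝ, ‖Complex.exp (-Complex.I * t * α)‖ = 1 := by
      intro α
      have : -Complex.I * t * α = ((-(t * α) : ℝ) : ℂ) * Complex.I := by push_cast; ring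
      rw [this, Complex.norm_exp_ofReal_mul_I]
    rw [integral_integral_resolvent_swap
      (f := fun x : ℝ × (E d × (Fin (k + 1) → E d)) => conj (Complex.exp (-Complex.I * t * x.1) *
            pathResolvent B lam η x.1 (incrPath (x.2.1 + ξ) (x.2.2 ∘ σ))))
      (g := fun x : ℝ × (E d × (Fin (k + 1) → E d)) => Complex.exp (-Complex.I * t * x.1) *
            pathResolvent B lam η x.1 (incrPath x.2.1 x.2.2))
      (C := (1 + (R + η + 1) / η) ^ (k + 2))
      (F := fun z => conj (2 * Real.pi * (Complex.I ^ (k + 1 + 1))⁻¹ * Complex.exp (-(η * t)) *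
        pathKernel B lam t (incrPath (z.1 + ξ) (z.2 ∘ σ))))
      (G := fun z => 2 * Real.pi * (Complex.I ^ (k + 1 + 1))⁻¹ * Complex.exp (-(η * t)) *
        pathKernel B lam t (incrPath z.1 z.2)) ?_ ?_ hV hVc ?_ ?_ ?_ ?_ ?_]
    · rw [mul_left_comm, ← integral_const_mul]
      congr 2; ext z
      simp only [map_mul, Complex.conj_ofReal, map_inv₀, map_pow, Complex.conj_I, Complex.conj_ofNat,
        ← Complex.exp_conj, map_neg]
      have hpi : (Real.pi : ℂ) ≠ 0 := by exact_mod_cast Real.pi_ne_zero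
      have hI : (-Complex.I) ^ (k + 1 + 1) * Complex.I ^ (k + 1 + 1) = 1 := by
        rw [← mul_pow]; simp
      have hI' : ((-Complex.I) ^ (k + 1 + 1))⁻¹ * (Complex.I ^ (k + 1 + 1))⁻¹ = 1 := by
        rw [← mul_inv, hI, inv_one]
      -- Here `η` drops out: each energy integral contributes `e^{-ηt}`, against the prefactor
      -- `e^{2tη}`.
      have hexp : Complex.exp (-(η * t)) * Complex.exp (-(η * t)) * Complex.exp (2 * t * η) = 1 := by
        rw [← Complex.exp_add, ← Complex.exp_add, ← Complex.exp_zero]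
        congr 1; ring
      push_cast
      generalize conj (pathKernel B lam t (incrPath (z.1 + ξ) (z.2 ∘ σ))) = a
      generalize pathKernel B lam t (incrPath z.1 z.2) = b
      generalize pathFactor B ψ Q ξ σ z = c
      have : Complex.exp (2 * t * η) / (2 * Real.pi) ^ 2 *
        (2 * Real.pi * ((-Complex.I) ^ (k + 1 + 1))⁻¹ * Complex.exp (-(η * t)) * a *
          (2 * Real.pi * (Complex.I ^ (k + 1 + 1))⁻¹ * Complex.exp (-(η * t)) * b) * c) =
        (Complex.exp (-(η * t)) * Complex.exp (-(η * t)) * Complex.exp (2 * t * η)) *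
        (((-Complex.I) ^ (k + 1 + 1))⁻¹ * (Complex.I ^ (k + 1 + 1))⁻¹) * (a * b * c) *
        ((2 * Real.pi) ^ 2 / (2 * Real.pi) ^ 2) := by ring
      rw [this, hexp, hI', div_self (by simp [hpi])]
      ring
    · have h2 := hres.comp (continuous_fst.prodMk (hp.comp continuous_snd))
      exact Complex.continuous_conj.comp (Continuous.mul (by fun_prop) h2)
    · have h2 := hres.comp (continuous_fst.prodMk (hp'.comp continuous_snd))
      exact Continuous.mul (by fun_prop) h2
    · intro α z hz
      rw [RCLike.norm_conj, norm_mul, hphase, one_mul]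
      refine prod_resolvent_bound hη hR0 k α
        (w := fun j => omega B lam (incrPath (z.1 + ξ) (z.2 ∘ σ) j))
        (fun _ => omega_im_nonpos hd B lam _) fun j => ?_
      exact (norm_le_pi_norm _ j).trans ((hR₁ z hz).trans
        ((le_max_left _ _).trans (le_max_right _ _)))
    · intro α z hz
      rw [norm_mul, hphase, one_mul]
      refine prod_resolvent_bound hη hR0 k α
        (w := fun j => omega B lam (incrPath z.1 z.2 j))
        (fun _ => omega_im_nonpos hd B lam _) fun j => ?_
      exact (norm_le_pi_norm _ j).trans ((hR₂ z hz).trans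
        ((le_max_right _ _).trans (le_max_right _ _)))
    · exact continuous_const.mul ((continuous_pathKernel hd B lam t).comp hp')
    · intro z
      have h1 := hint (incrPath (z.1 + ξ) (z.2 ∘ σ))
      dsimp only
      rw [integral_conj, h1]
    · intro z
      exact hint (incrPath z.1 z.2)

/-- One block of size at least 2 annihilates the product, so only the partition into singletons,
which is the least one, survives. -/
lemma eq_bot_of_partitionCoeff_ne_zero {k : ℕ}
    {A : Finpartition (Finset.univ : Finset (Fin k))} (h : partitionCoeff A ≠ 0) : A = ⊥ := by
  unfold partitionCoeff at h
  rw [Finset.prod_ne_zero_iff] at h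
  have h1 : ∀ a ∈ A.parts, a.card = 1 := by
    intro a ha
    have := h a ha
    unfold clusterCoeff at this
    by_contra hc
    simp [hc] at this
  refine le_bot_iff.1 fun b hb => ?_
  obtain ⟨i, rfl⟩ := Finset.card_eq_one.1 (h1 b hb)
  exact ⟨{i}, by simp [Finpartition.parts_bot], le_rfl⟩

lemma partitionCoeff_bot (k : ℕ) :
    partitionCoeff (⊥ : Finpartition (Finset.univ : Finset (Fin k))) = 1 := by
  unfold partitionCoeff
  rw [Finpartition.parts_bot, Finset.prod_map]
  simp [clusterCoeff]

lemma sum_partitionCoeff_mul {k : ℕ}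
    (f : Finpartition (Finset.univ : Finset (Fin k)) → ℂ) :
    ∑ A, partitionCoeff A * f A = f ⊥ := by
  rw [Finset.sum_eq_single ⊥]
  · rw [partitionCoeff_bot, one_mul]
  · intro A _ hA
    by_contra h
    exact hA (eq_bot_of_partitionCoeff_ne_zero (left_ne_zero_of_mul h))
  · simp

end RandomSchrodinger

namespace RandomSchrodinger

/-! ### Lattice cells -/

section Cells

variable {d : ℕ}

/-- The label of the cell of the lattice `ℓ ℤ^d` that contains `x`. -/
noncomputable def cellIndex (ℓ : ℝ) (x : E d) : Fin d → ℤ := fun i => ⌊x i / ℓ + 1 / 2⌋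

lemma measurable_cellIndex (ℓ : ℝ) : Measurable (cellIndex (d := d) ℓ) :=
  measurable_pi_iff.2 fun i => Int.measurable_floor.comp (by fun_prop)

lemma period_apply (ℓ : ℝ) (n : Fin d → ℤ) (i : Fin d) : period ℓ n i = n i * ℓ := rfl

lemma dualPt_apply (L : ℝ) (n : Fin d → ℤ) (i : Fin d) : dualPt L n i = n i / L := rfl

lemma cellIndex_add_period {ℓ : ℝ} (hℓ : 0 < ℓ) (x : E d) (n : Fin d → ℤ) :
    cellIndex ℓ (x + period ℓ n) = cellIndex ℓ x + n := by
  ext i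
  simp only [cellIndex, PiLp.add_apply, period_apply, Pi.add_apply]
  rw [add_div, mul_div_cancel_right₀ _ hℓ.ne', add_right_comm, Int.floor_add_intCast]

lemma cellIndex_eq_zero_iff {ℓ : ℝ} (hℓ : 0 < ℓ) (x : E d) :
    cellIndex ℓ x = 0 ↔ ∀ i, x i ∈ Set.Ico (-(ℓ / 2)) (ℓ / 2) := by
  rw [funext_iff]
  refine forall_congr' fun i => ?_
  simp only [cellIndex, Pi.zero_apply, Int.floor_eq_zero_iff, Set.mem_Ico]
  have h : x i / ℓ + 1 / 2 = (x i + ℓ / 2) / ℓ := by field_simp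
  rw [h, le_div_iff₀ hℓ, zero_mul, div_lt_one hℓ]
  constructor <;> rintro ⟨h1, h2⟩ <;> constructor <;> linarith

lemma box_eq_preimage (ℓ : ℝ) : box d ℓ = (WithLp.ofLp : E d → Fin d → ℝ) ⁻¹'
    Set.Icc (fun _ => -(ℓ / 2)) (fun _ => ℓ / 2) := by
  ext x
  simp only [box, Set.mem_ofPred_eq, Set.mem_preimage, Set.mem_Icc, Pi.le_def, abs_le, forall_and]

lemma volume_box {ℓ : ℝ} (hℓ : 0 < ℓ) : volume (box d ℓ) = ENNReal.ofReal (ℓ ^ d) := by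
  rw [box_eq_preimage, (PiLp.volume_preserving_ofLp (Fin d)).measure_preimage
    measurableSet_Icc.nullMeasurableSet, Real.volume_Icc_pi]
  simp only [sub_neg_eq_add, add_halves]
  rw [Finset.prod_const, Finset.card_univ, Fintype.card_fin, ENNReal.ofReal_pow hℓ.le]

lemma volume_box_lt_top {ℓ : ℝ} (hℓ : 0 < ℓ) : volume (box d ℓ) < ⊤ := by
  rw [volume_box hℓ]; exact ENNReal.ofReal_lt_top

lemma isCompact_box (ℓ : ℝ) : IsCompact (box d ℓ) := by
  rw [box_eq_preimage]
  exact (PiLp.homeomorph 2 (fun _ : Fin d => ℝ)).isCompact_preimage.2 isCompact_Icc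

/-- The half-open cell with label `n`. -/
def cell (d : ℕ) (ℓ : ℝ) (n : Fin d → ℤ) : Set (E d) := cellIndex ℓ ⁻¹' {n}

lemma measurableSet_cell (ℓ : ℝ) (n : Fin d → ℤ) : MeasurableSet (cell d ℓ n) :=
  measurable_cellIndex ℓ (measurableSet_singleton n)

/-- Half-open cells tile the space exactly; the closed box of the statement differs from one only by
a null set. -/
lemma cell_zero_ae_eq_box {ℓ : ℝ} (hℓ : 0 < ℓ) : cell d ℓ 0 =ᵐ[volume] box d ℓ := by
  have h : cell d ℓ 0 = (WithLp.ofLp : E d → Fin d → ℝ) ⁻¹'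
      Set.univ.pi fun _ => Set.Ico (-(ℓ / 2)) (ℓ / 2) := by
    ext x
    simp only [cell, Set.mem_preimage, Set.mem_singleton_iff, cellIndex_eq_zero_iff hℓ,
      Set.mem_univ_pi]
  rw [h, box_eq_preimage]
  exact (PiLp.volume_preserving_ofLp (Fin d)).quasiMeasurePreserving.preimage_ae_eq
    Measure.univ_pi_Ico_ae_eq_Icc

lemma cell_add_preimage {ℓ : ℝ} (hℓ : 0 < ℓ) (n : Fin d → ℤ) :
    (fun x => x + period ℓ n) ⁻¹' cell d ℓ n = cell d ℓ 0 := by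
  ext x
  simp [cell, cellIndex_add_period hℓ]

lemma volume_cell {ℓ : ℝ} (hℓ : 0 < ℓ) (n : Fin d → ℤ) :
    volume (cell d ℓ n) = ENNReal.ofReal (ℓ ^ d) := by
  rw [← volume_box hℓ, ← measure_congr (cell_zero_ae_eq_box hℓ), ← cell_add_preimage hℓ n,
    measure_preimage_add_right]

lemma iUnion_cell (ℓ : ℝ) : ⋃ n, cell d ℓ n = Set.univ := by
  ext x; simp [cell]

lemma pairwise_disjoint_cell (ℓ : ℝ) : Pairwise (Function.onFun Disjoint (cell d ℓ)) := by
  intro m n hmn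
  refine Set.disjoint_left.2 fun x hx hx' => hmn ?_
  rw [← (hx : cellIndex ℓ x = m), ← (hx' : cellIndex ℓ x = n)]

lemma lintegral_eq_tsum_box {ℓ : ℝ} (hℓ : 0 < ℓ) (f : E d → ENNReal) :
    ∫⁻ x, f x = ∑' n, ∫⁻ x in box d ℓ, f (x + period ℓ n) := by
  rw [← setLIntegral_univ, ← iUnion_cell ℓ, lintegral_iUnion (fun n => measurableSet_cell ℓ n)
    (pairwise_disjoint_cell ℓ)]
  congr 1; ext n
  rw [← setLIntegral_congr (cell_zero_ae_eq_box hℓ), ← cell_add_preimage hℓ n]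
  exact ((measurePreserving_add_right volume (period ℓ n)).setLIntegral_comp_preimage_emb
    (MeasurableEquiv.addRight _).measurableEmbedding f _).symm

/-- Unfolding: box integrals over all translates add up to the integral over the space. This relates
a periodized obstacle to its profile on `ℝ^d`. -/
lemma hasSum_integral_box {V : Type*} [NormedAddCommGroup V] [NormedSpace ℝ V]
    {ℓ : ℝ} (hℓ : 0 < ℓ) {f : E d → V} (hf : Integrable f) :
    HasSum (fun n => ∫ x in box d ℓ, f (x + period ℓ n)) (∫ x, f x) := by
  have h := hasSum_integral_iUnion (fun n => measurableSet_cell ℓ n) (pairwise_disjoint_cell ℓ)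
    (f := f) (μ := volume) hf.integrableOn
  rw [iUnion_cell, setIntegral_univ] at h
  convert h using 2 with n
  rw [← setIntegral_congr_set (cell_zero_ae_eq_box hℓ), ← cell_add_preimage hℓ n]
  exact (measurePreserving_add_right volume (period ℓ n)).setIntegral_preimage_emb
    (MeasurableEquiv.addRight _).measurableEmbedding f _

/-- Periodization of an integrable function. -/
lemma integrableOn_box_tsum {ℓ : ℝ} (hℓ : 0 < ℓ) {f : E d → ℂ} (hf : Integrable f)
    (hfm : Measurable f) :
    (∀ᵐ x ∂(volume.restrict (box d ℓ)), Summable fun n => ‖f (x + period ℓ n)‖) ∧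
    IntegrableOn (fun x => ∑' n, f (x + period ℓ n)) (box d ℓ) := by
  have h1 := lintegral_eq_tsum_box (d := d) hℓ (fun x => ‖f x‖ₑ)
  have hm : ∀ n, Measurable fun x => ‖f (x + period ℓ n)‖ₑ := fun n =>
    (hfm.comp (measurable_add_const _)).enorm
  rw [← lintegral_tsum (fun n => (hm n).aemeasurable)] at h1
  have h2 : ∫⁻ x in box d ℓ, ∑' n, ‖f (x + period ℓ n)‖ₑ ≠ ⊤ := by
    rw [← h1]; exact hf.2.ne
  have h3 : ∀ᵐ x ∂(volume.restrict (box d ℓ)), ∑' n, ‖f (x + period ℓ n)‖ₑ < ⊤ :=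
    ae_lt_top' (AEMeasurable.tsum fun n => (hm n).aemeasurable) h2
  have h4 : ∀ᵐ x ∂(volume.restrict (box d ℓ)), Summable fun n => ‖f (x + period ℓ n)‖ := by
    filter_upwards [h3] with x hx
    have := ENNReal.summable_toReal hx.ne
    simpa using this
  refine ⟨h4, ?_, ?_⟩
  · exact (Measurable.tsum fun n => hfm.comp (measurable_add_const _)).aestronglyMeasurable
  · refine lt_of_le_of_lt (lintegral_mono_ae ?_) h2.lt_top
    filter_upwards [h4] with x hx
    exact enorm_tsum_le_tsum_enorm
end Cells

/-! ### Plane waves and trigonometric series on the box -/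

section PlaneWaves

variable {d : ℕ}

/-- The plane wave `exp(2πi p·x)`. -/
noncomputable def planeWave (p x : E d) : ℂ :=
  Complex.exp (2 * Real.pi * Complex.I * ((inner ℝ p x : ℝ) : ℂ))

lemma planeWave_eq (p x : E d) :
    planeWave p x = Complex.exp (((2 * Real.pi * inner ℝ p x : ℝ) : ℂ) * Complex.I) := by
  unfold planeWave; congr 1; push_cast; ring

@[simp] lemma norm_planeWave (p x : E d) : ‖planeWave p x‖ = 1 := by
  rw [planeWave_eq, Complex.norm_exp_ofReal_mul_I]

lemma planeWave_add (p q x : E d) : planeWave (p + q) x = planeWave p x * planeWave q x := by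
  unfold planeWave; rw [← Complex.exp_add, inner_add_left]; congr 1; push_cast; ring

lemma planeWave_add_right (p x y : E d) :
    planeWave p (x + y) = planeWave p x * planeWave p y := by
  unfold planeWave; rw [← Complex.exp_add, inner_add_right]; congr 1; push_cast; ring

@[simp] lemma planeWave_zero (x : E d) : planeWave 0 x = 1 := by simp [planeWave]

lemma planeWave_neg (p x : E d) : planeWave (-p) x = conj (planeWave p x) := by
  rw [planeWave_eq, planeWave_eq, ← Complex.exp_conj, inner_neg_left, map_mul,
    Complex.conj_ofReal, Complex.conj_I]
  congr 1; push_cast; ring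

lemma continuous_planeWave_right (p : E d) : Continuous (planeWave p) := by
  unfold planeWave; fun_prop

lemma dualPt_add (L : ℝ) (m n : Fin d → ℤ) : dualPt L (m + n) = dualPt L m + dualPt L n := by
  ext i; simp [dualPt_apply, add_div]

lemma dualPt_neg (L : ℝ) (m : Fin d → ℤ) : dualPt L (-m) = -dualPt L m := by
  ext i; simp [dualPt_apply, neg_div]

lemma dualPt_sub (L : ℝ) (m n : Fin d → ℤ) : dualPt L (m - n) = dualPt L m - dualPt L n := by
  ext i; simp [dualPt_apply, sub_div]

@[simp] lemma dualPt_zero (L : ℝ) : dualPt L (0 : Fin d → ℤ) = 0 := by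
  ext i; simp [dualPt_apply]

/-- The dual lattice embedding as an additive homomorphism. -/
noncomputable def dualHom (d : ℕ) (L : ℝ) : (Fin d → ℤ) →+ E d where
  toFun := dualPt L
  map_zero' := dualPt_zero L
  map_add' := dualPt_add L

lemma planeWave_dualPt_period {L : ℝ} (hL : 0 < L) (m n : Fin d → ℤ) :
    planeWave (dualPt L m) (period L n) = 1 := by
  have h : inner ℝ (dualPt L m) (period L n) = ((∑ i, m i * n i : ℤ) : ℝ) := by
    simp only [PiLp.inner_apply, dualPt_apply, period_apply]
    push_cast
    refine Finset.sum_congr rfl fun i _ => ?_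
    simp
    field_simp
  unfold planeWave
  rw [h, Complex.exp_eq_one_iff]
  exact ⟨∑ i, m i * n i, by push_cast; ring⟩

lemma planeWave_add_period {L : ℝ} (hL : 0 < L) (m n : Fin d → ℤ) (x : E d) :
    planeWave (dualPt L m) (x + period L n) = planeWave (dualPt L m) x := by
  rw [planeWave_add_right, planeWave_dualPt_period hL, mul_one]

lemma integral_Icc_exp {L : ℝ} (hL : 0 < L) (n : ℤ) :
    ∫ x in Set.Icc (-(L / 2)) (L / 2), Complex.exp (2 * Real.pi * Complex.I * (n / L) * x) =
      if n = 0 then (L : ℂ) else 0 := by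
  rw [integral_Icc_eq_integral_Ioc, ← intervalIntegral.integral_of_le (by linarith)]
  split_ifs with hn
  · subst hn
    simp
  · have hL' : (L : ℂ) ≠ 0 := by exact_mod_cast hL.ne'
    have hn' : (n : ℂ) ≠ 0 := by exact_mod_cast hn
    have hpi : (Real.pi : ℂ) ≠ 0 := by exact_mod_cast Real.pi_ne_zero
    rw [integral_exp_mul_complex (by simp [hn', hL', hpi])]
    rw [div_eq_zero_iff]
    left
    rw [sub_eq_zero, Complex.exp_eq_exp_iff_exists_int]
    refine ⟨n, ?_⟩
    push_cast
    field_simp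
    ring

lemma integral_box_planeWave {L : ℝ} (hL : 0 < L) (n : Fin d → ℤ) :
    ∫ x in box d L, planeWave (dualPt L n) x = if n = 0 then (L : ℂ) ^ d else 0 := by
  have h1 : ∀ x : E d, planeWave (dualPt L n) x =
      ∏ i, Complex.exp (2 * Real.pi * Complex.I * (n i / L) * (WithLp.ofLp x i : ℝ)) := by
    intro x
    unfold planeWave
    rw [← Complex.exp_sum, PiLp.inner_apply]
    congr 1
    push_cast
    rw [Finset.mul_sum]
    refine Finset.sum_congr rfl fun i _ => ?_
    simp [dualPt_apply]
    ring
  simp_rw [h1]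
  rw [box_eq_preimage]
  rw [(PiLp.volume_preserving_ofLp (Fin d)).setIntegral_preimage_emb
    (MeasurableEquiv.toLp 2 (Fin d → ℝ)).symm.measurableEmbedding
    (fun y : Fin d → ℝ => ∏ i, Complex.exp (2 * Real.pi * Complex.I * (n i / L) * (y i : ℝ)))]
  rw [← Set.pi_univ_Icc, volume_pi, Measure.restrict_pi_pi]
  rw [integral_fintype_prod_eq_prod (𝕜 := ℂ) (fun (i : Fin d) (x : ℝ) =>
    Complex.exp (2 * Real.pi * Complex.I * (n i / L) * x))]
  simp_rw [integral_Icc_exp hL]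
  split_ifs with hn
  · simp [hn]
  · obtain ⟨i, hi⟩ := Function.ne_iff.1 hn
    exact Finset.prod_eq_zero (Finset.mem_univ i) (if_neg hi)

/-- The trigonometric series with Fourier coefficients `c`. -/
noncomputable def synth (L : ℝ) (c : (Fin d → ℤ) → ℂ) (x : E d) : ℂ :=
  ((L : ℂ) ^ d)⁻¹ * ∑' n, planeWave (dualPt L n) x * c n

lemma freeEvol_eq_synth (B : SchwartzMap (E d) ℝ) (lam L s : ℝ) (f : E d → ℂ) :
    freeEvol B lam L s f = synth L fun n =>
      Complex.exp (-Complex.I * s * omega B lam (dualPt L n)) * boxFourier L f (dualPt L n) := rfl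

lemma boxFourier_eq (L : ℝ) (f : E d → ℂ) (p : E d) :
    boxFourier L f p = ∫ x in box d L, planeWave (-p) x * f x := by
  unfold boxFourier planeWave
  congr 1; ext x
  congr 2
  rw [inner_neg_left]; push_cast; ring

lemma summable_synth {c : (Fin d → ℤ) → ℂ} (hc : Summable fun n => ‖c n‖) (L : ℝ) (x : E d) :
    Summable fun n => planeWave (dualPt L n) x * c n :=
  hc.of_norm_bounded fun n => by rw [norm_mul, norm_planeWave, one_mul]

lemma continuous_synth {c : (Fin d → ℤ) → ℂ} (hc : Summable fun n => ‖c n‖) (L : ℝ) :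
    Continuous (synth L c) := by
  unfold synth
  refine continuous_const.mul (continuous_tsum (fun n => ?_) hc fun n x => ?_)
  · exact (continuous_planeWave_right _).mul continuous_const
  · rw [norm_mul, norm_planeWave, one_mul]

/-- Absolute summability of the coefficients allows termwise integration. The Fourier inversion,
Parseval and multiplication formulas on the box all reduce to this exchange. -/
lemma integral_mul_synth {μ : Measure (E d)} {g : E d → ℂ} (hg : Integrable g μ)
    {c : (Fin d → ℤ) → ℂ} (hc : Summable fun n => ‖c n‖) (L : ℝ) :
    ∫ x, g x * synth L c x ∂μ =
      ((L : ℂ) ^ d)⁻¹ * ∑' n, c n * ∫ x, planeWave (dualPt L n) x * g x ∂μ := by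
  have hi : ∀ n, Integrable (fun x => planeWave (dualPt L n) x * g x) μ := fun n =>
    hg.bdd_mul (c := 1) (continuous_planeWave_right _).aestronglyMeasurable
      (ae_of_all _ fun x => (norm_planeWave _ _).le)
  have h := integral_tsum_of_summable_integral_norm
    (F := fun n x => c n * (planeWave (dualPt L n) x * g x)) (μ := μ)
    (fun n => (hi n).const_mul _) ?_
  · simp_rw [← integral_const_mul]
    rw [h, ← integral_const_mul]
    congr 1; ext x
    unfold synth
    rw [← tsum_mul_left, ← tsum_mul_left, ← tsum_mul_left]
    congr 1; ext n; ring
  · simp only [norm_mul, norm_planeWave, one_mul, integral_const_mul]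
    exact hc.mul_right _

lemma boxFourier_synth {L : ℝ} (hL : 0 < L) {c : (Fin d → ℤ) → ℂ}
    (hc : Summable fun n => ‖c n‖) (m : Fin d → ℤ) :
    boxFourier L (synth L c) (dualPt L m) = c m := by
  rw [boxFourier_eq, integral_mul_synth _ hc]
  · have h : ∀ n, ∫ x in box d L, planeWave (dualPt L n) x * planeWave (-dualPt L m) x =
        if n = m then (L : ℂ) ^ d else 0 := by
      intro n
      simp_rw [← planeWave_add, ← sub_eq_add_neg, ← dualPt_sub, integral_box_planeWave hL,
        sub_eq_zero]
    simp_rw [h]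
    rw [tsum_eq_single m (by intro n hn; simp [hn])]
    have hL' : (L : ℂ) ≠ 0 := by exact_mod_cast hL.ne'
    rw [if_pos rfl]
    field_simp
  · exact (continuous_planeWave_right _).continuousOn.integrableOn_compact (isCompact_box L)

lemma boxNormSq_synth {L : ℝ} (hL : 0 < L) {c : (Fin d → ℤ) → ℂ}
    (hc : Summable fun n => ‖c n‖) :
    (boxNormSq L (synth L c) : ℂ) = ((L : ℂ) ^ d)⁻¹ * ∑' n, conj (c n) * c n := by
  have h1 : (boxNormSq L (synth L c) : ℂ) =
      ∫ x in box d L, conj (synth L c x) * synth L c x := by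
    unfold boxNormSq
    rw [← integral_complex_ofReal]
    congr 1; ext x
    rw [Complex.conj_mul']; push_cast; rfl
  rw [h1, integral_mul_synth _ hc]
  · congr 2; ext n
    rw [mul_comm]
    congr 1
    have : ∀ x, planeWave (dualPt L n) x * conj (synth L c x) =
        conj (planeWave (-dualPt L n) x * synth L c x) := by
      intro x; rw [planeWave_neg]; simp
    simp_rw [this]
    rw [integral_conj, ← boxFourier_eq, boxFourier_synth hL hc]
  · exact (Complex.continuous_conj.comp
      (continuous_synth hc L)).continuousOn.integrableOn_compact (isCompact_box L)

lemma obstacle_aux (B : SchwartzMap (E d) ℝ) (y : E d) :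
    Integrable (fun x => (B (x - y) : ℂ)) ∧ Measurable (fun x => (B (x - y) : ℂ)) := by
  have hc := B.continuous
  exact ⟨(B.integrable.comp_sub_right y).ofReal, (by fun_prop : Continuous _).measurable⟩

lemma ofReal_obstacle (B : SchwartzMap (E d) ℝ) (L : ℝ) (y : E d) (v : ℝ) (x : E d) :
    (obstacle B L y v x : ℂ) = v * ∑' n, (B (x + period L n - y) : ℂ) := by
  unfold obstacle
  rw [Complex.ofReal_mul, Complex.ofReal_tsum]
  simp_rw [sub_add_eq_add_sub]

lemma integrableOn_obstacle (B : SchwartzMap (E d) ℝ) {L : ℝ} (hL : 0 < L) (y : E d) (v : ℝ) :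
    IntegrableOn (fun x => (obstacle B L y v x : ℂ)) (box d L) := by
  simp_rw [ofReal_obstacle]
  exact (integrableOn_box_tsum hL (obstacle_aux B y).1 (obstacle_aux B y).2).2.const_mul _

lemma integral_planeWave_neg_mul (B : SchwartzMap (E d) ℝ) (p y : E d) :
    ∫ x, planeWave (-p) x * (B (x - y) : ℂ) = planeWave (-p) y * Bhat B p := by
  rw [← integral_add_right_eq_self _ y]
  unfold Bhat
  rw [Real.fourier_eq', ← integral_const_mul]
  congr 1; ext x
  rw [add_sub_cancel_right, planeWave_add_right, smul_eq_mul, planeWave_eq (-p) x]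
  rw [inner_neg_left, real_inner_comm p x]
  have e : ((2 * Real.pi * -inner ℝ p x : ℝ) : ℂ) = ((-2 * Real.pi * inner ℝ p x : ℝ) : ℂ) := by
    push_cast; ring
  rw [e]
  ring

/-- Plane waves with dual lattice momenta are `L`-periodic, so the box integral of the periodized
obstacle unfolds to an integral over `ℝ^d`: the coefficients are exact values of `B̂`, with no
finite-size error. -/
lemma boxFourier_obstacle (B : SchwartzMap (E d) ℝ) {L : ℝ} (hL : 0 < L) (y : E d) (v : ℝ)
    (m : Fin d → ℤ) :
    ∫ x in box d L, planeWave (-dualPt L m) x * (obstacle B L y v x : ℂ) =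
      v * (planeWave (-dualPt L m) y * Bhat B (dualPt L m)) := by
  obtain ⟨h1, h2⟩ := obstacle_aux B y
  have hi : Integrable fun x => planeWave (-dualPt L m) x * (B (x - y) : ℂ) :=
    h1.bdd_mul (c := 1) (continuous_planeWave_right _).aestronglyMeasurable
      (ae_of_all _ fun x => (norm_planeWave _ _).le)
  have hs := hasSum_integral_box hL hi
  rw [integral_planeWave_neg_mul] at hs
  rw [← hs.tsum_eq, integral_tsum_of_summable_integral_norm
    (F := fun n x => planeWave (-dualPt L m) (x + period L n) * (B (x + period L n - y) : ℂ)),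
    ← integral_const_mul]
  · congr 1; ext x
    rw [ofReal_obstacle]
    have : ∀ n, planeWave (-dualPt L m) (x + period L n) = planeWave (-dualPt L m) x := by
      intro n; rw [← dualPt_neg, planeWave_add_period hL]
    simp_rw [this, tsum_mul_left]
    ring
  · intro n
    exact (hi.comp_add_right (period L n)).integrableOn
  · exact (hasSum_integral_box hL hi.norm).summable

/-- The Fourier coefficients of the product of an obstacle with a trigonometric series. -/
lemma boxFourier_obstacle_mul_synth (B : SchwartzMap (E d) ℝ) {L : ℝ} (hL : 0 < L) (lam : ℝ)
    (y : E d) (v : ℝ) {c : (Fin d → ℤ) → ℂ} (hc : Summable fun n => ‖c n‖) (m : Fin d → ℤ) :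
    boxFourier L (fun x => ((lam * obstacle B L y v x : ℝ) : ℂ) * synth L c x) (dualPt L m) =
      ((L : ℂ) ^ d)⁻¹ * ∑' n, c n *
        (lam * (v * (planeWave (-dualPt L (m - n)) y * Bhat B (dualPt L (m - n))))) := by
  rw [boxFourier_eq]
  simp_rw [← mul_assoc]
  have hi : IntegrableOn (fun x => planeWave (-dualPt L m) x * ((lam * obstacle B L y v x : ℝ) : ℂ))
      (box d L) := by
    refine Integrable.bdd_mul (c := 1) ?_ (continuous_planeWave_right _).aestronglyMeasurable
      (ae_of_all _ fun x => (norm_planeWave _ _).le)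
    simp only [Complex.ofReal_mul]
    exact (integrableOn_obstacle B hL y v).const_mul _
  rw [integral_mul_synth hi hc]
  congr 2; ext n
  simp only [mul_assoc]
  congr 1
  rw [← boxFourier_obstacle B hL, ← integral_const_mul]
  congr 1; ext x
  rw [dualPt_sub, neg_sub, sub_eq_add_neg, planeWave_add]
  push_cast; ring

end PlaneWaves
end RandomSchrodinger

namespace RandomSchrodinger

/-! ### The wave function in Fourier space -/

lemma sum_piFinset_snoc {α M : Type*} [DecidableEq α] [AddCommMonoid M] (S : Finset α) (k : ℕ)
    (g : (Fin (k + 1) → α) → M) :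
    ∑ m ∈ Fintype.piFinset (fun _ : Fin (k + 1) => S), g m =
      ∑ a ∈ S, ∑ m ∈ Fintype.piFinset (fun _ : Fin k => S),
        g (Fin.snoc (α := fun _ => α) m a) := by
  rw [← Finset.sum_product']
  refine Finset.sum_bij' (fun m _ => (m (Fin.last k), Fin.init m))
    (fun z _ => Fin.snoc (α := fun _ => α) z.2 z.1) ?_ ?_ ?_ ?_ ?_
  · intro m hm
    rw [Fintype.mem_piFinset] at hm
    simp only [Finset.mem_product, Fintype.mem_piFinset]
    exact ⟨hm _, fun j => hm _⟩
  · intro z hz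
    simp only [Finset.mem_product, Fintype.mem_piFinset] at hz
    rw [Fintype.mem_piFinset]
    intro j
    induction j using Fin.lastCases with
    | last => simpa using hz.1
    | cast j => simpa using hz.2 j
  · intro m _; simp
  · intro z _; simp
  · intro m _; simp

section Chain

variable {d : ℕ} (B : SchwartzMap (E d) ℝ) (lam L : ℝ) (S : Finset (Fin d → ℤ))
  (a : (Fin d → ℤ) → ℂ)

/-- Weight of the momentum transfers `m` in a sequence of collisions. -/
noncomputable def transferWeight {k : ℕ} (y : Fin k → E d) (v : Fin k → ℝ)
    (m : Fin k → Fin d → ℤ) : ℂ :=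
  ∏ j, (((L : ℂ) ^ d)⁻¹ *
    (lam * (v j * (planeWave (-dualPt L (m j)) (y j) * Bhat B (dualPt L (m j))))))

/-- Fourier coefficients of the Duhamel chain. -/
noncomputable def chainCoeff {k : ℕ} (s : Fin (k + 1) → ℝ) (y : Fin k → E d) (v : Fin k → ℝ)
    (n : Fin d → ℤ) : ℂ :=
  ∑ m ∈ Fintype.piFinset (fun _ : Fin k => S), transferWeight B lam L y v m *
    ((∏ j, Complex.exp (-Complex.I * s j *
      omega B lam (dualPt L (incrPath (n - ∑ i, m i) m j)))) * a (n - ∑ i, m i))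

variable {B lam L S a}

lemma summable_norm_comp_sub (ha : Summable fun n => ‖a n‖) (m : Fin d → ℤ) :
    Summable fun n => ‖a (n - m)‖ :=
  (Equiv.subRight m).summable_iff.2 ha

/-- For nonnegative times all phases are contractions, so the bound is independent of the times;
this later justifies exchanging the time integral with the lattice sum. -/
lemma norm_chainCoeff_le (hd : 3 ≤ d) {k : ℕ} {s : Fin (k + 1) → ℝ} (hs : ∀ j, 0 ≤ s j)
    (y : Fin k → E d) (v : Fin k → ℝ) (n : Fin d → ℤ) :
    ‖chainCoeff B lam L S a s y v n‖ ≤ ∑ m ∈ Fintype.piFinset (fun _ : Fin k => S),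
      ‖transferWeight B lam L y v m‖ * ‖a (n - ∑ i, m i)‖ := by
  refine (norm_sum_le _ _).trans (Finset.sum_le_sum fun m _ => ?_)
  rw [norm_mul, norm_mul]
  refine mul_le_mul_of_nonneg_left (mul_le_of_le_one_left (norm_nonneg _) ?_) (norm_nonneg _)
  rw [norm_prod]
  exact Finset.prod_le_one (fun _ _ => norm_nonneg _) fun j _ =>
    norm_exp_phase_le (hs j) (omega_im_nonpos hd B lam _)

lemma summable_chain_bound (ha : Summable fun n => ‖a n‖) {k : ℕ}
    (w : (Fin k → Fin d → ℤ) → ℝ) :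
    Summable fun n => ∑ m ∈ Fintype.piFinset (fun _ : Fin k => S), w m * ‖a (n - ∑ i, m i)‖ :=
  summable_sum fun _ _ => (summable_norm_comp_sub ha _).mul_left _

lemma summable_chainCoeff (hd : 3 ≤ d) (ha : Summable fun n => ‖a n‖) {k : ℕ}
    {s : Fin (k + 1) → ℝ} (hs : ∀ j, 0 ≤ s j) (y : Fin k → E d) (v : Fin k → ℝ) :
    Summable fun n => ‖chainCoeff B lam L S a s y v n‖ :=
  Summable.of_nonneg_of_le (fun _ => norm_nonneg _) (norm_chainCoeff_le hd hs y v)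
    (summable_chain_bound ha _)

/-- Multiplication by an obstacle convolves Fourier coefficients, so each collision adds one
momentum transfer. The final momentum is `n`, hence the initial one is `n - ∑ m_i`. -/
lemma duhamelChain_eq_synth (hd : 3 ≤ d) (hL : 0 < L) (hS : ∀ m ∉ S, Bhat B (dualPt L m) = 0)
    (ha : Summable fun n => ‖a n‖) {f : E d → ℂ} (hf : ∀ n, boxFourier L f (dualPt L n) = a n)
    (k : ℕ) (s : Fin (k + 1) → ℝ) (hs : ∀ j, 0 ≤ s j) (y : Fin k → E d) (v : Fin k → ℝ) :
    duhamelChain B lam L k s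
      (fun j z => ((lam * obstacle B L (y j) (v j) z : ℝ) : ℂ)) f =
      synth L (chainCoeff B lam L S a s y v) := by
  induction k with
  | zero =>
    rw [duhamelChain, freeEvol_eq_synth]
    congr 1; ext n
    simp [chainCoeff, transferWeight, hf]
  | succ k ih =>
    rw [duhamelChain, ih (fun j => s j.castSucc) (fun j => hs _) (fun j => y j.castSucc)
      (fun j => v j.castSucc), freeEvol_eq_synth]
    congr 1; ext n
    rw [boxFourier_obstacle_mul_synth B hL lam _ _ (summable_chainCoeff hd ha (fun j => hs _) _ _),
      ← (Equiv.subLeft n).tsum_eq]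
    simp only [Equiv.subLeft_apply, sub_sub_cancel]
    -- After reindexing by the transfer, terms outside `S` carry a vanishing factor `B̂`, and the
    -- series becomes a finite sum.
    rw [tsum_eq_sum (s := S) (by intro m hm; simp [hS m hm])]
    unfold chainCoeff
    rw [sum_piFinset_snoc, Finset.mul_sum, Finset.mul_sum]
    refine Finset.sum_congr rfl fun b _ => ?_
    rw [Finset.sum_mul, Finset.mul_sum, Finset.mul_sum]
    refine Finset.sum_congr rfl fun m _ => ?_
    have e1 : n - ∑ i, (Fin.snoc (α := fun _ => Fin d → ℤ) m b : Fin (k + 1) → Fin d → ℤ) i =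
        n - b - ∑ i, m i := by
      rw [Fin.sum_univ_castSucc]; simp; abel
    rw [e1, Fin.prod_univ_castSucc (n := k + 1)]
    simp only [incrPath_snoc_castSucc]
    have e2 : incrPath (n - b - ∑ i, m i)
        (Fin.snoc (α := fun _ => Fin d → ℤ) m b : Fin (k + 1) → Fin d → ℤ)
        (Fin.last (k + 1)) = n := by
      rw [incrPath_last, Fin.sum_univ_castSucc]; simp only [Fin.snoc_castSucc, Fin.snoc_last]; abel
    rw [e2]
    have e3 : transferWeight B lam L y v
        (Fin.snoc (α := fun _ => Fin d → ℤ) m b : Fin (k + 1) → Fin d → ℤ) =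
        transferWeight B lam L (fun j => y j.castSucc) (fun j => v j.castSucc) m *
        (((L : ℂ) ^ d)⁻¹ * (lam * (v (Fin.last k) *
          (planeWave (-dualPt L b) (y (Fin.last k)) * Bhat B (dualPt L b))))) := by
      unfold transferWeight
      rw [Fin.prod_univ_castSucc]; simp
    rw [e3]
    ring

variable (B lam L a) in
/-- The deterministic part of the Fourier coefficients of the wave function. -/
noncomputable def collisionCoeff {k : ℕ} (t : ℝ) (m : Fin k → Fin d → ℤ) (n : Fin d → ℤ) : ℂ :=
  (-Complex.I) ^ k * (((L : ℂ) ^ d)⁻¹ * lam) ^ k * (∏ j, Bhat B (dualPt L (m j))) *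
    (pathKernel B lam t (fun j => dualPt L (incrPath (n - ∑ i, m i) m j)) * a (n - ∑ i, m i))

/-- The time integral passes inside the lattice sum and acts only on the phases, which it turns into
`pathKernel`. The randomness is then confined to the last product. -/
lemma elemWave_eq_synth (hd : 3 ≤ d) (hL : 0 < L) (hS : ∀ m ∉ S, Bhat B (dualPt L m) = 0)
    (ha : Summable fun n => ‖a n‖) {f : E d → ℂ} (hf : ∀ n, boxFourier L f (dualPt L n) = a n)
    (t : ℝ) (k : ℕ) (ω : Config d) (γ : Fin k → Fin ω.1) :
    elemWave B lam L t k f ω γ = synth L fun n =>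
      ∑ m ∈ Fintype.piFinset (fun _ : Fin k => S), collisionCoeff B lam L a t m n *
        ∏ j, ((ω.2.2 (γ j) : ℂ) * planeWave (-dualPt L (m j)) (ω.2.1 (γ j))) := by
  ext x
  set y : Fin k → E d := fun j => ω.2.1 (γ j)
  set v : Fin k → ℝ := fun j => ω.2.2 (γ j)
  set sn : (Fin k → ℝ) → Fin (k + 1) → ℝ := fun s =>
    Fin.snoc (α := fun _ => ℝ) s (t - ∑ j, s j) with hsn
  have h1 : elemWave B lam L t k f ω γ x = (-Complex.I) ^ k * ∫ s in timeSimplex k t,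
      synth L (chainCoeff B lam L S a (sn s) y v) x := by
    unfold elemWave timeSimplexIntegral
    congr 1
    refine setIntegral_congr_fun (isClosed_timeSimplex k t).measurableSet fun s hs => ?_
    dsimp only
    rw [← duhamelChain_eq_synth hd hL hS ha hf k (sn s) (snoc_nonneg_of_mem_timeSimplex hs)]
  have h2 : ∀ n s, chainCoeff B lam L S a (sn s) y v n =
      ∑ m ∈ Fintype.piFinset (fun _ : Fin k => S), transferWeight B lam L y v m *
        (timePhase k t (fun j => omega B lam (dualPt L (incrPath (n - ∑ i, m i) m j))) s *
          a (n - ∑ i, m i)) := fun n s => rfl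
  have hphi : ∀ w : Fin (k + 1) → ℂ, IntegrableOn (timePhase k t w) (timeSimplex k t) := fun w =>
    ((continuous_timePhase k t).comp
      (Continuous.prodMk_right w)).continuousOn.integrableOn_compact (isCompact_timeSimplex _ _)
  have hi : ∀ n, IntegrableOn (fun s => chainCoeff B lam L S a (sn s) y v n)
      (timeSimplex k t) := by
    intro n
    simp_rw [h2]
    exact integrable_finsetSum _ fun m _ => ((hphi _).mul_const _).const_mul _
  have h3 : ∫ s in timeSimplex k t, synth L (chainCoeff B lam L S a (sn s) y v) x =
      ((L : ℂ) ^ d)⁻¹ * ∑' n, planeWave (dualPt L n) x *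
        ∫ s in timeSimplex k t, chainCoeff B lam L S a (sn s) y v n := by
    unfold synth
    rw [integral_const_mul]
    congr 1
    simp_rw [← integral_const_mul]
    rw [integral_tsum_of_summable_integral_norm
      (F := fun n s => planeWave (dualPt L n) x * chainCoeff B lam L S a (sn s) y v n)]
    · intro n; exact (hi n).const_mul _
    · simp only [norm_mul, norm_planeWave, one_mul]
      refine Summable.of_nonneg_of_le (fun n => integral_nonneg fun s => norm_nonneg _) (fun n => ?_)
        ((summable_chain_bound (S := S) ha fun m => ‖transferWeight B lam L y v m‖).mul_right
          (volume.real (timeSimplex k t)))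
      have := norm_setIntegral_le_of_norm_le_const (volume_timeSimplex_lt_top k t)
        (f := fun s => ‖chainCoeff B lam L S a (sn s) y v n‖) (fun s hs => by
          rw [norm_norm]
          exact norm_chainCoeff_le hd (snoc_nonneg_of_mem_timeSimplex hs) y v n)
      exact (Real.le_norm_self _).trans this
  rw [h1, h3]
  unfold synth
  rw [mul_left_comm, ← tsum_mul_left]
  congr 2; ext n
  rw [mul_left_comm]
  congr 1
  simp_rw [h2]
  rw [integral_finsetSum _ fun m _ => ((hphi _).mul_const _).const_mul _, Finset.mul_sum]
  refine Finset.sum_congr rfl fun m _ => ?_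
  rw [integral_const_mul, integral_mul_const, ← timeKernel_eq]
  unfold collisionCoeff transferWeight pathKernel
  have e : ∀ j, ((L : ℂ) ^ d)⁻¹ * (lam * (v j *
      (planeWave (-dualPt L (m j)) (y j) * Bhat B (dualPt L (m j))))) =
      (((L : ℂ) ^ d)⁻¹ * lam) * Bhat B (dualPt L (m j)) *
        (v j * planeWave (-dualPt L (m j)) (y j)) := fun j => by ring
  simp_rw [e, Finset.prod_mul_distrib]
  simp only [Finset.prod_const, Finset.card_univ, Fintype.card_fin, mul_pow, v, y]
  ring

variable (B lam L S a) in
/-- The Fourier coefficients of the wave function. -/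
noncomputable def waveCoeff (t : ℝ) (k : ℕ) (ω : Config d) (n : Fin d → ℤ) : ℂ :=
  ∑ γ : Fin k ↪ Fin ω.1, ∑ m ∈ Fintype.piFinset (fun _ : Fin k => S),
    collisionCoeff B lam L a t m n *
      ∏ j, ((ω.2.2 (γ j) : ℂ) * planeWave (-dualPt L (m j)) (ω.2.1 (γ j)))

lemma summable_collisionCoeff (hd : 3 ≤ d) (ha : Summable fun n => ‖a n‖) {t : ℝ} (ht : 0 ≤ t)
    {k : ℕ} (m : Fin k → Fin d → ℤ) : Summable fun n => ‖collisionCoeff B lam L a t m n‖ := by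
  refine Summable.of_nonneg_of_le (fun _ => norm_nonneg _) (fun n => ?_)
    ((summable_norm_comp_sub ha (∑ i, m i)).mul_left
      (‖(-Complex.I) ^ k * (((L : ℂ) ^ d)⁻¹ * lam) ^ k * (∏ j, Bhat B (dualPt L (m j)))‖ * t ^ k))
  unfold collisionCoeff
  rw [norm_mul, norm_mul _ (a _)]
  exact (mul_le_mul_of_nonneg_left (mul_le_mul_of_nonneg_right (norm_pathKernel_le hd B lam ht _)
    (norm_nonneg _)) (norm_nonneg _)).trans_eq (mul_assoc _ _ _).symm

variable (B lam L S a) in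
/-- Deterministic majorant of the Fourier coefficients of the wave function. -/
noncomputable def waveBound (t : ℝ) (k : ℕ) (n : Fin d → ℤ) : ℝ :=
  ∑ m ∈ Fintype.piFinset (fun _ : Fin k => S), ‖collisionCoeff B lam L a t m n‖

/-- The sum over label sequences of the absolute values of the weights. -/
noncomputable def weightSum (k : ℕ) (ω : Config d) : ℝ :=
  ∑ γ : Fin k ↪ Fin ω.1, ∏ j, |ω.2.2 (γ j)|

lemma norm_waveCoeff_le (t : ℝ) (k : ℕ) (ω : Config d) (n : Fin d → ℤ) :
    ‖waveCoeff B lam L S a t k ω n‖ ≤ weightSum k ω * waveBound B lam L S a t k n := by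
  unfold waveCoeff weightSum waveBound
  rw [Finset.sum_mul]
  refine (norm_sum_le _ _).trans (Finset.sum_le_sum fun γ _ => ?_)
  rw [Finset.mul_sum]
  refine (norm_sum_le _ _).trans (Finset.sum_le_sum fun m _ => ?_)
  rw [norm_mul, norm_prod, mul_comm]
  simp

lemma summable_waveBound (hd : 3 ≤ d) (ha : Summable fun n => ‖a n‖) {t : ℝ} (ht : 0 ≤ t) (k : ℕ) :
    Summable (waveBound B lam L S a t k) :=
  summable_sum fun m _ => summable_collisionCoeff hd ha ht m

lemma summable_waveCoeff (hd : 3 ≤ d) (ha : Summable fun n => ‖a n‖) {t : ℝ} (ht : 0 ≤ t) (k : ℕ)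
    (ω : Config d) : Summable fun n => ‖waveCoeff B lam L S a t k ω n‖ :=
  Summable.of_nonneg_of_le (fun _ => norm_nonneg _) (norm_waveCoeff_le t k ω)
    ((summable_waveBound hd ha ht k).mul_left _)

lemma synth_sum {ι : Type*} (s : Finset ι) (c : ι → (Fin d → ℤ) → ℂ)
    (hc : ∀ i ∈ s, Summable fun n => ‖c i n‖) :
    synth L (fun n => ∑ i ∈ s, c i n) = fun x => ∑ i ∈ s, synth L (c i) x := by
  ext x
  unfold synth
  simp_rw [Finset.mul_sum]
  rw [Summable.tsum_finsetSum fun i hi => summable_synth (hc i hi) L x, Finset.mul_sum]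

lemma psiNR_eq_synth (hd : 3 ≤ d) (hL : 0 < L) (hS : ∀ m ∉ S, Bhat B (dualPt L m) = 0)
    (ha : Summable fun n => ‖a n‖) {f : E d → ℂ} (hf : ∀ n, boxFourier L f (dualPt L n) = a n)
    {t : ℝ} (ht : 0 ≤ t) (k : ℕ) (ω : Config d) :
    psiNR B lam L t k f ω = synth L (waveCoeff B lam L S a t k ω) := by
  unfold waveCoeff
  rw [synth_sum]
  · ext x
    unfold psiNR
    refine Finset.sum_congr rfl fun γ _ => ?_
    rw [elemWave_eq_synth hd hL hS ha hf]
  · intro γ _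
    refine Summable.of_nonneg_of_le (fun _ => norm_nonneg _) (fun n => norm_sum_le _ _)
      (summable_sum fun m _ => ?_)
    simp_rw [norm_mul]
    exact (summable_collisionCoeff hd ha ht m).mul_right _

end Chain
end RandomSchrodinger

namespace RandomSchrodinger

/-! ### Expectation over the obstacles -/

/-! ### Moments of the random weights. -/

section Weights

variable {Pv : Measure ℝ} [IsProbabilityMeasure Pv] {M k : ℕ}

/-- The value 1 is not the default value 0 of the integral of a non-integrable function. -/
lemma integrable_sq_of_integral (hm2 : ∫ v, v ^ 2 ∂Pv = 1) : Integrable (fun v : ℝ => v ^ 2) Pv := by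
  by_contra h
  rw [integral_undef h] at hm2
  exact zero_ne_one hm2

lemma integrable_id_of_integral (hm2 : ∫ v, v ^ 2 ∂Pv = 1) : Integrable (fun v : ℝ => v) Pv := by
  refine ((integrable_const (1 : ℝ)).add (integrable_sq_of_integral hm2)).mono'
    measurable_id.aestronglyMeasurable (Eventually.of_forall fun v => ?_)
  simp only [Real.norm_eq_abs, Pi.add_apply]
  nlinarith [abs_nonneg v, sq_abs v, sq_nonneg (|v| - 1)]

open Classical in
-- A product over the visited obstacles becomes one over all obstacles, so that it factorizes under
-- the product measure.
lemma prod_embedding (γ : Fin k ↪ Fin M) (v : Fin M → ℝ) :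
    ∏ j, v (γ j) = ∏ l, if l ∈ Set.range γ then v l else 1 :=
  Fintype.prod_of_injective γ γ.injective _ _ (fun _ h => if_neg h) fun j =>
    (if_pos (Set.mem_range_self j)).symm

open Classical in
lemma integrable_weights (hm2 : ∫ v, v ^ 2 ∂Pv = 1) (γ γ' : Fin k ↪ Fin M) :
    Integrable (fun v : Fin M → ℝ => (∏ j, v (γ j)) * ∏ j, v (γ' j))
      (Measure.pi fun _ : Fin M => Pv) := by
  simp_rw [prod_embedding, ← Finset.prod_mul_distrib]
  refine Integrable.fintype_prod (f := fun l x => (if l ∈ Set.range γ then x else 1) *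
    (if l ∈ Set.range γ' then x else 1)) fun l => ?_
  by_cases h : l ∈ Set.range γ <;> by_cases h' : l ∈ Set.range γ' <;>
    simp only [h, h', if_true, if_false, mul_one, one_mul]
  · simpa [sq] using integrable_sq_of_integral hm2
  · exact integrable_id_of_integral hm2
  · exact integrable_id_of_integral hm2
  · exact integrable_const _

open Classical in
-- An obstacle visited by both sequences contributes the second moment 1, one visited by exactly one
-- sequence contributes the mean 0.
lemma integral_weights (hm1 : ∫ v, v ∂Pv = 0) (hm2 : ∫ v, v ^ 2 ∂Pv = 1) (γ γ' : Fin k ↪ Fin M) :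
    ∫ v, (∏ j, v (γ j)) * ∏ j, v (γ' j) ∂(Measure.pi fun _ : Fin M => Pv) =
      if Set.range γ = Set.range γ' then 1 else 0 := by
  simp_rw [prod_embedding, ← Finset.prod_mul_distrib]
  rw [integral_fintype_prod_eq_prod (fun l (x : ℝ) => (if l ∈ Set.range γ then x else 1) *
    (if l ∈ Set.range γ' then x else 1))]
  split_ifs with h
  · refine Finset.prod_eq_one fun l _ => ?_
    by_cases h' : l ∈ Set.range γ
    · have h2 : l ∈ Set.range γ' := h ▸ h'
      simpa only [h', h2, if_true, sq] using hm2
    · have h2 : l ∉ Set.range γ' := h ▸ h'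
      simp only [h', h2, if_false, mul_one, integral_const, smul_eq_mul, probReal_univ]
  · obtain ⟨l, hl⟩ : ∃ l, ¬ (l ∈ Set.range γ ↔ l ∈ Set.range γ') := by
      by_contra! h'
      exact h (Set.ext h')
    refine Finset.prod_eq_zero (Finset.mem_univ l) ?_
    by_cases h1 : l ∈ Set.range γ <;> by_cases h2 : l ∈ Set.range γ' <;>
      simp only [h1, h2, iff_self, not_true, if_true, if_false, mul_one, one_mul] at hl ⊢ <;>
      exact hm1

/-- `|ab| ≤ (a² + b²)/2` reduces the bound to the two diagonal cases, each equal to 1. -/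
lemma integral_abs_weights_le (hm1 : ∫ v, v ∂Pv = 0) (hm2 : ∫ v, v ^ 2 ∂Pv = 1)
    (γ γ' : Fin k ↪ Fin M) :
    ∫ v, |(∏ j, v (γ j)) * ∏ j, v (γ' j)| ∂(Measure.pi fun _ : Fin M => Pv) ≤ 1 := by
  have h1 := integral_weights hm1 hm2 γ γ
  have h2 := integral_weights hm1 hm2 γ' γ'
  rw [if_pos rfl] at h1 h2
  calc _ ≤ ∫ v, (1 / 2 : ℝ) * ((∏ j, v (γ j)) * (∏ j, v (γ j)) + (∏ j, v (γ' j)) * ∏ j, v (γ' j))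
        ∂(Measure.pi fun _ : Fin M => Pv) := by
        refine integral_mono (integrable_weights hm2 γ γ').abs
          (((integrable_weights hm2 γ γ).add (integrable_weights hm2 γ' γ')).const_mul _) fun v => ?_
        dsimp only
        generalize (∏ j, v (γ j)) = a
        generalize (∏ j, v (γ' j)) = b
        rw [abs_le]
        constructor <;> nlinarith [sq_nonneg (a + b), sq_nonneg (a - b)]
    _ = 1 := by
        rw [integral_const_mul, integral_add (integrable_weights hm2 γ γ)
          (integrable_weights hm2 γ' γ'), h1, h2]
        norm_num

end Weights

/-! ### Expectation for a fixed number of obstacles. -/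

section Slice

variable {d : ℕ} {L : ℝ} {Pv : Measure ℝ} [IsProbabilityMeasure Pv] {M k : ℕ}

/-- The uniform distribution on the box. -/
noncomputable abbrev boxLaw (d : ℕ) (L : ℝ) : Measure (E d) :=
  ProbabilityTheory.cond (volume : Measure (E d)) (box d L)

lemma isProbabilityMeasure_boxLaw (hL : 0 < L) : IsProbabilityMeasure (boxLaw d L) := by
  refine ProbabilityTheory.cond_isProbabilityMeasure_of_finite ?_ (volume_box_lt_top hL).ne
  rw [volume_box hL]
  simp [pow_pos hL]

lemma integral_boxLaw_planeWave (hL : 0 < L) (n : Fin d → ℤ) :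
    ∫ y, planeWave (dualPt L n) y ∂(boxLaw d L) = if n = 0 then 1 else 0 := by
  have : (0 : ℝ) < L ^ d := pow_pos hL d
  rw [boxLaw, ProbabilityTheory.cond, integral_smul_measure, integral_box_planeWave hL,
    volume_box hL, ENNReal.toReal_inv, ENNReal.toReal_ofReal this.le]
  split_ifs
  · rw [Complex.real_smul]
    push_cast
    exact inv_mul_cancel₀ (by exact_mod_cast this.ne')
  · simp

/-- The random factor of the labels `γ` with momentum transfers `m`. -/
noncomputable def labelFactor (L : ℝ) (γ : Fin k → Fin M) (m : Fin k → Fin d → ℤ)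
    (z : (Fin M → E d) × (Fin M → ℝ)) : ℂ :=
  ∏ j, ((z.2 (γ j) : ℂ) * planeWave (-dualPt L (m j)) (z.1 (γ j)))

lemma continuous_labelFactor (γ : Fin k → Fin M) (m : Fin k → Fin d → ℤ) :
    Continuous (labelFactor (d := d) L γ m) := by
  unfold labelFactor
  refine continuous_finsetProd _ fun j _ => ?_
  refine Continuous.mul (by fun_prop) ?_
  exact (continuous_planeWave_right _).comp (by fun_prop)

lemma norm_labelFactor (γ : Fin k → Fin M) (m : Fin k → Fin d → ℤ)
    (z : (Fin M → E d) × (Fin M → ℝ)) :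
    ‖labelFactor L γ m z‖ = |∏ j, z.2 (γ j)| := by
  simp [labelFactor, norm_prod, norm_planeWave, Finset.abs_prod]

lemma conj_labelFactor_mul (γ γ' : Fin k → Fin M) (m m' : Fin k → Fin d → ℤ)
    (z : (Fin M → E d) × (Fin M → ℝ)) :
    conj (labelFactor L γ m z) * labelFactor L γ' m' z =
      ((∏ j, planeWave (dualPt L (m j)) (z.1 (γ j))) *
        ∏ j, planeWave (-dualPt L (m' j)) (z.1 (γ' j))) *
      (((∏ j, z.2 (γ j)) * ∏ j, z.2 (γ' j) : ℝ) : ℂ) := by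
  have h : ∀ j, conj (planeWave (-dualPt L (m j)) (z.1 (γ j))) =
      planeWave (dualPt L (m j)) (z.1 (γ j)) := fun j => by rw [planeWave_neg, Complex.conj_conj]
  simp only [labelFactor, map_prod, map_mul, Complex.conj_ofReal, h, Finset.prod_mul_distrib]
  push_cast
  ring

/-- Extending the transfers by 0 to unvisited obstacles gives a product over all centres, and a
plane wave has mean 0 on the box unless its momentum vanishes. -/
lemma integral_planeWaves_embedding (hL : 0 < L) (γ : Fin k ↪ Fin M) (n : Fin k → Fin d → ℤ) :
    ∫ y, ∏ j, planeWave (dualPt L (n j)) (y (γ j)) ∂(Measure.pi fun _ : Fin M => boxLaw d L) =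
      if n = 0 then 1 else 0 := by
  have := isProbabilityMeasure_boxLaw (d := d) hL
  have hz : dualPt (d := d) L 0 = 0 := (dualHom d L).map_zero
  have hN : ∀ y : Fin M → E d, ∏ j, planeWave (dualPt L (n j)) (y (γ j)) =
      ∏ l, planeWave (dualPt L (Function.extend γ n 0 l)) (y l) := fun y => by
    refine Fintype.prod_of_injective γ γ.injective _ _ (fun l hl => ?_) fun j => ?_
    · rw [Function.extend_apply' _ _ _ (by simpa using hl)]
      simp [hz, planeWave_zero]
    · rw [γ.injective.extend_apply]
  simp_rw [hN]
  rw [integral_fintype_prod_eq_prod (fun l y => planeWave (dualPt L (Function.extend γ n 0 l)) y)]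
  simp_rw [integral_boxLaw_planeWave hL]
  split_ifs with h
  · refine Finset.prod_eq_one fun l _ => if_pos ?_
    subst h
    by_cases hl : ∃ j, γ j = l
    · obtain ⟨j, rfl⟩ := hl
      rw [γ.injective.extend_apply]; rfl
    · rw [Function.extend_apply' _ _ _ hl]; rfl
  · obtain ⟨j, hj⟩ := Function.ne_iff.1 h
    refine Finset.prod_eq_zero (Finset.mem_univ (γ j)) (if_neg ?_)
    rwa [γ.injective.extend_apply]

/-- The law of the centres and weights of `M` obstacles. -/
noncomputable abbrev sliceLaw (d : ℕ) (L : ℝ) (Pv : Measure ℝ) (M : ℕ) :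
    Measure ((Fin M → E d) × (Fin M → ℝ)) :=
  (Measure.pi fun _ : Fin M => boxLaw d L).prod (Measure.pi fun _ : Fin M => Pv)

lemma integrable_labelFactor (hL : 0 < L) (hm2 : ∫ v, v ^ 2 ∂Pv = 1)
    (γ γ' : Fin k ↪ Fin M) (m m' : Fin k → Fin d → ℤ) :
    Integrable (fun z => conj (labelFactor L γ m z) * labelFactor L γ' m' z)
      (sliceLaw d L Pv M) := by
  have := isProbabilityMeasure_boxLaw (d := d) hL
  have h := (integrable_weights (M := M) hm2 γ γ').comp_snd (Measure.pi fun _ : Fin M => boxLaw d L)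
  refine h.mono ?_ (Eventually.of_forall fun z => ?_)
  · exact ((Complex.continuous_conj.comp (continuous_labelFactor _ _)).mul
      (continuous_labelFactor _ _)).aestronglyMeasurable
  · rw [norm_mul, RCLike.norm_conj, norm_labelFactor, norm_labelFactor, norm_mul]
    rfl

lemma integral_norm_labelFactor_le (hL : 0 < L) (hm1 : ∫ v, v ∂Pv = 0)
    (hm2 : ∫ v, v ^ 2 ∂Pv = 1) (γ γ' : Fin k ↪ Fin M) (m m' : Fin k → Fin d → ℤ) :
    ∫ z, ‖conj (labelFactor L γ m z) * labelFactor L γ' m' z‖ ∂(sliceLaw d L Pv M) ≤ 1 := by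
  have := isProbabilityMeasure_boxLaw (d := d) hL
  have h : ∀ z : (Fin M → E d) × (Fin M → ℝ),
      ‖conj (labelFactor L γ m z) * labelFactor L γ' m' z‖ =
        |(∏ j, z.2 (γ j)) * ∏ j, z.2 (γ' j)| := fun z => by
    rw [norm_mul, RCLike.norm_conj, norm_labelFactor, norm_labelFactor, abs_mul]
  simp_rw [h]
  rw [integral_fun_snd (μ := Measure.pi fun _ : Fin M => boxLaw d L)
    (fun v : Fin M → ℝ => |(∏ j, v (γ j)) * ∏ j, v (γ' j)|)]
  simpa using integral_abs_weights_le hm1 hm2 γ γ'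

open Classical in
-- Nonzero weights force equal ranges, so `γ = γ' ∘ σ`, with `σ` unique by injectivity of `γ'`. Each
-- common centre then carries momentum `m_j - m'_{σ(j)}`, which must vanish. At most one term of the
-- sum is nonzero.
lemma integral_labelFactor (hL : 0 < L) (hm1 : ∫ v, v ∂Pv = 0)
    (hm2 : ∫ v, v ^ 2 ∂Pv = 1) (γ γ' : Fin k ↪ Fin M) (m m' : Fin k → Fin d → ℤ) :
    ∫ z, conj (labelFactor L γ m z) * labelFactor L γ' m' z ∂(sliceLaw d L Pv M) =
      ∑ σ : Equiv.Perm (Fin k), if γ = σ.toEmbedding.trans γ' ∧ m = m' ∘ σ then 1 else 0 := by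
  have := isProbabilityMeasure_boxLaw (d := d) hL
  simp_rw [conj_labelFactor_mul]
  rw [integral_prod_mul (fun y : Fin M → E d => (∏ j, planeWave (dualPt L (m j)) (y (γ j))) *
        ∏ j, planeWave (-dualPt L (m' j)) (y (γ' j)))
      (fun v : Fin M → ℝ => (((∏ j, v (γ j)) * ∏ j, v (γ' j) : ℝ) : ℂ)),
    integral_complex_ofReal, integral_weights hm1 hm2]
  by_cases h : Set.range γ = Set.range γ'
  · rw [if_pos h]
    have hex : ∀ j, ∃ i, γ' i = γ j := fun j => by
      have : γ j ∈ Set.range γ' := h ▸ Set.mem_range_self j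
      exact this
    choose τ hτ using hex
    have hinj : Function.Injective τ := fun i j hij => γ.injective (by rw [← hτ i, ← hτ j, hij])
    let σ : Equiv.Perm (Fin k) := Equiv.ofBijective τ (Finite.injective_iff_bijective.1 hinj)
    have hσ : ∀ j, γ' (σ j) = γ j := hτ
    have hun : ∀ σ' : Equiv.Perm (Fin k), γ = σ'.toEmbedding.trans γ' → σ' = σ := fun σ' h' => by
      ext j
      have : γ' (σ' j) = γ' (σ j) := by rw [hσ, h']; rfl
      rw [γ'.injective this]
    rw [Finset.sum_eq_single σ]
    · have hp : ∀ y : Fin M → E d, (∏ j, planeWave (dualPt L (m j)) (y (γ j))) *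
          ∏ j, planeWave (-dualPt L (m' j)) (y (γ' j)) =
          ∏ j, planeWave (dualPt L (m j - m' (σ j))) (y (γ j)) := fun y => by
        rw [← Equiv.prod_comp σ (fun j => planeWave (-dualPt L (m' j)) (y (γ' j))),
          ← Finset.prod_mul_distrib]
        refine Finset.prod_congr rfl fun j _ => ?_
        rw [hσ, ← planeWave_add, dualPt_sub, sub_eq_add_neg]
      simp_rw [hp]
      rw [integral_planeWaves_embedding hL γ (fun j => m j - m' (σ j))]
      have h1 : γ = σ.toEmbedding.trans γ' := by
        ext j
        rw [← hσ j]; rfl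
      have h2 : ((fun j => m j - m' (σ j)) = 0) ↔ m = m' ∘ σ := by
        simp only [funext_iff, Pi.zero_apply, sub_eq_zero, Function.comp_apply]
      simp [← h1, funext_iff, sub_eq_zero]
    · intro σ' _ hne
      exact if_neg fun h' => hne (hun σ' h'.1)
    · simp
  · rw [if_neg h]
    simp only [Complex.ofReal_zero, mul_zero]
    refine (Finset.sum_eq_zero fun σ _ => if_neg fun h' => h ?_).symm
    rw [h'.1]
    simp [Function.Embedding.trans, Set.range_comp]

end Slice

/-! ### Moments of the Poisson number of obstacles. -/

section Poisson

/-- Factorial moments of a Poisson variable are pure powers of the mean. The first `k` terms vanish,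
and the shift `M → M + k` leaves the exponential series. -/
lemma hasSum_poisson_descFactorial (r : ℝ) (k : ℕ) :
    HasSum (fun M : ℕ => Real.exp (-r) * r ^ M / M.factorial * M.descFactorial k) (r ^ k) := by
  rw [← hasSum_nat_add_iff' k, Finset.sum_eq_zero, sub_zero]
  · have h : HasSum (fun M : ℕ => r ^ M / M.factorial) (Real.exp r) := by
      rw [Real.exp_eq_exp_ℝ]
      exact NormedSpace.expSeries_div_hasSum_exp r
    have h2 := h.mul_left (Real.exp (-r) * r ^ k)
    rw [mul_right_comm, ← Real.exp_add, neg_add_cancel, Real.exp_zero, one_mul] at h2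
    refine (congrArg (HasSum · _) (funext fun M => ?_)).mpr h2
    have h3 := Nat.factorial_mul_descFactorial (Nat.le_add_left k M)
    rw [Nat.add_sub_cancel] at h3
    have h4 : ((M.factorial : ℝ)) * (M + k).descFactorial k = (M + k).factorial := by
      exact_mod_cast h3
    rw [← h4]
    have : (M.factorial : ℝ) ≠ 0 := by positivity
    have : ((M + k).descFactorial k : ℝ) ≠ 0 := by
      intro h
      rw [h, mul_zero] at h4
      exact absurd h4.symm (by positivity)
    field_simp
    ring
  · intro M hM
    rw [Nat.descFactorial_eq_zero_iff_lt.2 (Finset.mem_range.1 hM)]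
    simp

/-- `M^k ≤ k! e^M` turns the series into an exponential series with argument `e r`. -/
lemma summable_poisson_pow (r : ℝ) (hr : 0 ≤ r) (k : ℕ) :
    Summable (fun M : ℕ => Real.exp (-r) * r ^ M / M.factorial * (M : ℝ) ^ k) := by
  refine Summable.of_nonneg_of_le (fun M => by positivity) (fun M => ?_)
    ((Real.summable_pow_div_factorial (Real.exp 1 * r)).mul_left (Real.exp (-r) * k.factorial))
  have h := Real.pow_div_factorial_le_exp (M : ℝ) (Nat.cast_nonneg M) k
  rw [div_le_iff₀ (by positivity)] at h
  have h2 : Real.exp (M : ℝ) = Real.exp 1 ^ M := by rw [← Real.exp_nat_mul, mul_one]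
  rw [h2] at h
  calc _ ≤ Real.exp (-r) * r ^ M / M.factorial * (Real.exp 1 ^ M * k.factorial) := by gcongr
    _ = _ := by rw [mul_pow]; ring

end Poisson

/-! ### Averaging over the full configuration. -/

section Expectation

variable {d : ℕ} {L : ℝ} {Pv : Measure ℝ} [IsProbabilityMeasure Pv]

lemma measurable_sigmaMk (M : ℕ) : Measurable (fun z => (⟨M, z⟩ : Config d)) := fun _ hs =>
  MeasurableSpace.measurableSet_iInf.1 hs M

lemma measurable_config {β : Type*} [MeasurableSpace β] {f : Config d → β}
    (hf : ∀ M, Measurable fun z => f ⟨M, z⟩) : Measurable f := fun _ hs =>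
  MeasurableSpace.measurableSet_iInf.2 fun M => hf M hs

lemma poissonWeight_toReal {r : ℝ} (hr : 0 ≤ r) (M : ℕ) :
    (ProbabilityTheory.poissonMeasure r.toNNReal {M}).toReal =
      Real.exp (-r) * r ^ M / M.factorial := by
  rw [ProbabilityTheory.poissonMeasure_singleton, Real.coe_toNNReal _ hr,
    ENNReal.toReal_ofReal (by positivity)]

/-- The law is a Poisson mixture of laws on the slices of fixed `M`, so integrability and
expectation are decided slice by slice. -/
lemma configLaw_integrable_hasSum (hL : 0 < L) {f : Config d → ℂ}
    (hf : ∀ M, Measurable fun z => f ⟨M, z⟩)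
    (hi : ∀ M, Integrable (fun z => f ⟨M, z⟩) (sliceLaw d L Pv M))
    (hs : Summable fun M : ℕ => Real.exp (-L ^ d) * (L ^ d) ^ M / M.factorial *
      ∫ z, ‖f ⟨M, z⟩‖ ∂(sliceLaw d L Pv M)) :
    Integrable f (configLaw d L Pv) ∧
    HasSum (fun M : ℕ => ((Real.exp (-L ^ d) * (L ^ d) ^ M / M.factorial : ℝ) : ℂ) *
      ∫ z, f ⟨M, z⟩ ∂(sliceLaw d L Pv M)) (∫ ω, f ω ∂(configLaw d L Pv)) := by
  have hr : (0 : ℝ) ≤ L ^ d := (pow_pos hL d).le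
  have hm : Measurable f := measurable_config hf
  have hI : Integrable f (configLaw d L Pv) := by
    refine integrable_sum_measure (fun M => ?_) ?_
    · refine Integrable.smul_measure ?_ (measure_ne_top _ _)
      exact (integrable_map_measure hm.aestronglyMeasurable
        (measurable_sigmaMk M).aemeasurable).2 (hi M)
    · refine hs.congr fun M => ?_
      rw [integral_smul_measure, integral_map (measurable_sigmaMk M).aemeasurable
        hm.norm.aestronglyMeasurable, poissonWeight_toReal hr, smul_eq_mul]
  refine ⟨hI, ?_⟩
  refine (congrArg (HasSum · _) (funext fun M => ?_)).mpr (hasSum_integral_measure hI)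
  rw [integral_smul_measure, integral_map (measurable_sigmaMk M).aemeasurable
    hm.aestronglyMeasurable, poissonWeight_toReal hr, Complex.real_smul]

/-- The quadratic form in the label factors with coefficients `K`. -/
noncomputable def labelForm {k : ℕ} (L : ℝ) (S : Finset (Fin d → ℤ))
    (K : (Fin k → Fin d → ℤ) → (Fin k → Fin d → ℤ) → ℂ) (ω : Config d) : ℂ :=
  ∑ γ : Fin k ↪ Fin ω.1, ∑ γ' : Fin k ↪ Fin ω.1,
    ∑ m ∈ Fintype.piFinset (fun _ => S), ∑ m' ∈ Fintype.piFinset (fun _ => S),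
      K m m' * (conj (labelFactor L γ m ω.2) * labelFactor L γ' m' ω.2)

lemma labelForm_mk {k : ℕ} (L : ℝ) (S : Finset (Fin d → ℤ))
    (K : (Fin k → Fin d → ℤ) → (Fin k → Fin d → ℤ) → ℂ) (M : ℕ)
    (z : (Fin M → E d) × (Fin M → ℝ)) : labelForm L S K ⟨M, z⟩ =
      ∑ γ : Fin k ↪ Fin M, ∑ γ' : Fin k ↪ Fin M,
        ∑ m ∈ Fintype.piFinset (fun _ => S), ∑ m' ∈ Fintype.piFinset (fun _ => S),
          K m m' * (conj (labelFactor L γ m z) * labelFactor L γ' m' z) := rfl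

open Classical in
-- Given `γ'` and `σ`, exactly one `γ` contributes, and given `m'` exactly one `m`. What remains
-- does not depend on `γ'`, so the labels only contribute their number.
lemma integral_labelForm_slice {k : ℕ} (hL : 0 < L) (hm1 : ∫ v, v ∂Pv = 0) (hm2 : ∫ v, v ^ 2 ∂Pv = 1)
    (S : Finset (Fin d → ℤ)) (K : (Fin k → Fin d → ℤ) → (Fin k → Fin d → ℤ) → ℂ) (M : ℕ) :
    ∫ z, labelForm L S K ⟨M, z⟩ ∂(sliceLaw d L Pv M) = M.descFactorial k *
      ∑ σ : Equiv.Perm (Fin k), ∑ m ∈ Fintype.piFinset (fun _ => S), K (m ∘ σ) m := by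
  have hint := fun (γ γ' : Fin k ↪ Fin M) m m' =>
    (integrable_labelFactor (d := d) hL hm2 γ γ' m m').const_mul (K m m')
  simp_rw [labelForm_mk]
  rw [integral_finsetSum _ fun γ _ => integrable_finsetSum _ fun γ' _ => integrable_finsetSum _
    fun m _ => integrable_finsetSum _ fun m' _ => hint γ γ' m m']
  have h1 : ∀ γ : Fin k ↪ Fin M,
      ∫ z, ∑ γ' : Fin k ↪ Fin M, ∑ m ∈ Fintype.piFinset (fun _ => S),
        ∑ m' ∈ Fintype.piFinset (fun _ => S),
          K m m' * (conj (labelFactor L γ m z) * labelFactor L γ' m' z) ∂(sliceLaw d L Pv M) =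
      ∑ γ' : Fin k ↪ Fin M, ∑ m ∈ Fintype.piFinset (fun _ => S),
        ∑ m' ∈ Fintype.piFinset (fun _ => S), ∑ σ : Equiv.Perm (Fin k),
          if γ = σ.toEmbedding.trans γ' then if m = m' ∘ σ then K m m' else 0 else 0 := fun γ => by
    rw [integral_finsetSum _ fun γ' _ => integrable_finsetSum _
      fun m _ => integrable_finsetSum _ fun m' _ => hint γ γ' m m']
    refine Finset.sum_congr rfl fun γ' _ => ?_
    rw [integral_finsetSum _ fun m _ => integrable_finsetSum _ fun m' _ => hint γ γ' m m']
    refine Finset.sum_congr rfl fun m _ => ?_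
    rw [integral_finsetSum _ fun m' _ => hint γ γ' m m']
    refine Finset.sum_congr rfl fun m' _ => ?_
    rw [integral_const_mul, integral_labelFactor hL hm1 hm2, Finset.mul_sum]
    refine Finset.sum_congr rfl fun σ _ => ?_
    split_ifs <;> simp_all
  simp_rw [h1]
  have h2 : ∀ (σ : Equiv.Perm (Fin k)), ∀ m' ∈ Fintype.piFinset (fun _ : Fin k => S),
      ∑ m ∈ Fintype.piFinset (fun _ => S), (if m = m' ∘ σ then K m m' else 0) = K (m' ∘ σ) m' := by
    intro σ m' hm'
    rw [Finset.sum_ite_eq', if_pos]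
    rw [Fintype.mem_piFinset] at hm' ⊢
    exact fun j => hm' _
  calc _ = ∑ γ' : Fin k ↪ Fin M, ∑ σ : Equiv.Perm (Fin k), ∑ m' ∈ Fintype.piFinset (fun _ => S),
        ∑ m ∈ Fintype.piFinset (fun _ => S), (if m = m' ∘ σ then K m m' else 0) := by
        rw [Finset.sum_comm]
        refine Finset.sum_congr rfl fun γ' _ => ?_
        have h3 : ∀ γ : Fin k ↪ Fin M, ∑ m ∈ Fintype.piFinset (fun _ => S),
          ∑ m' ∈ Fintype.piFinset (fun _ => S), ∑ σ : Equiv.Perm (Fin k),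
          (if γ = σ.toEmbedding.trans γ' then if m = m' ∘ σ then K m m' else 0 else 0) =
          ∑ σ : Equiv.Perm (Fin k), if γ = σ.toEmbedding.trans γ' then
            ∑ m' ∈ Fintype.piFinset (fun _ => S), ∑ m ∈ Fintype.piFinset (fun _ => S),
              (if m = m' ∘ σ then K m m' else 0) else 0 := fun γ => by
          rw [Finset.sum_comm]
          simp_rw [Finset.sum_comm (t := (Finset.univ : Finset (Equiv.Perm (Fin k))))]
          refine Finset.sum_congr rfl fun σ _ => ?_
          split_ifs <;> simp
        simp_rw [h3]
        rw [Finset.sum_comm]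
        refine Finset.sum_congr rfl fun σ _ => ?_
        rw [Finset.sum_ite_eq', if_pos (Finset.mem_univ _)]
    _ = ∑ γ' : Fin k ↪ Fin M, ∑ σ : Equiv.Perm (Fin k), ∑ m' ∈ Fintype.piFinset (fun _ => S),
        K (m' ∘ σ) m' := by
        refine Finset.sum_congr rfl fun γ' _ => Finset.sum_congr rfl fun σ _ =>
          Finset.sum_congr rfl fun m' hm' => h2 σ m' hm'
    _ = _ := by
        rw [Finset.sum_const, Finset.card_univ, Fintype.card_embedding_eq]
        simp

lemma integral_norm_labelForm_slice_le {k : ℕ} (hL : 0 < L) (hm1 : ∫ v, v ∂Pv = 0)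
    (hm2 : ∫ v, v ^ 2 ∂Pv = 1)
    (S : Finset (Fin d → ℤ)) (K : (Fin k → Fin d → ℤ) → (Fin k → Fin d → ℤ) → ℂ) (M : ℕ) :
    ∫ z, ‖labelForm L S K ⟨M, z⟩‖ ∂(sliceLaw d L Pv M) ≤ (M : ℝ) ^ (2 * k) *
      ∑ m ∈ Fintype.piFinset (fun _ => S), ∑ m' ∈ Fintype.piFinset (fun _ => S), ‖K m m'‖ := by
  have hint := fun (γ γ' : Fin k ↪ Fin M) m m' =>
    (integrable_labelFactor (d := d) hL hm2 γ γ' m m').norm.const_mul ‖K m m'‖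
  calc _ ≤ ∫ z, ∑ γ : Fin k ↪ Fin M, ∑ γ' : Fin k ↪ Fin M,
        ∑ m ∈ Fintype.piFinset (fun _ => S), ∑ m' ∈ Fintype.piFinset (fun _ => S),
        ‖K m m'‖ * ‖conj (labelFactor L γ m z) * labelFactor L γ' m' z‖ ∂(sliceLaw d L Pv M) := by
        refine integral_mono_of_nonneg (Eventually.of_forall fun z => norm_nonneg _)
          (integrable_finsetSum _ fun γ _ => integrable_finsetSum _ fun γ' _ =>
            integrable_finsetSum _ fun m _ => integrable_finsetSum _ fun m' _ => hint γ γ' m m')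
          (Eventually.of_forall fun z => ?_)
        simp only [labelForm_mk]
        refine (norm_sum_le _ _).trans (Finset.sum_le_sum fun γ _ => ?_)
        refine (norm_sum_le _ _).trans (Finset.sum_le_sum fun γ' _ => ?_)
        refine (norm_sum_le _ _).trans (Finset.sum_le_sum fun m _ => ?_)
        refine (norm_sum_le _ _).trans (Finset.sum_le_sum fun m' _ => ?_)
        rw [norm_mul]
    _ ≤ ∑ γ : Fin k ↪ Fin M, ∑ γ' : Fin k ↪ Fin M,
        ∑ m ∈ Fintype.piFinset (fun _ => S), ∑ m' ∈ Fintype.piFinset (fun _ => S), ‖K m m'‖ := by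
        rw [integral_finsetSum _ fun γ _ => integrable_finsetSum _ fun γ' _ =>
          integrable_finsetSum _ fun m _ => integrable_finsetSum _ fun m' _ => hint γ γ' m m']
        refine Finset.sum_le_sum fun γ _ => ?_
        rw [integral_finsetSum _ fun γ' _ => integrable_finsetSum _
          fun m _ => integrable_finsetSum _ fun m' _ => hint γ γ' m m']
        refine Finset.sum_le_sum fun γ' _ => ?_
        rw [integral_finsetSum _ fun m _ => integrable_finsetSum _ fun m' _ => hint γ γ' m m']
        refine Finset.sum_le_sum fun m _ => ?_
        rw [integral_finsetSum _ fun m' _ => hint γ γ' m m']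
        refine Finset.sum_le_sum fun m' _ => ?_
        rw [integral_const_mul]
        exact mul_le_of_le_one_right (norm_nonneg _)
          (integral_norm_labelFactor_le hL hm1 hm2 γ γ' m m')
    _ ≤ _ := by
        simp only [Finset.sum_const, Finset.card_univ, Fintype.card_embedding_eq, nsmul_eq_mul,
          Fintype.card_fin]
        rw [← mul_assoc]
        refine mul_le_mul_of_nonneg_right ?_ (by positivity)
        have : (M.descFactorial k : ℝ) ≤ (M : ℝ) ^ k := by
          exact_mod_cast Nat.descFactorial_le_pow M k
        calc _ ≤ (M : ℝ) ^ k * (M : ℝ) ^ k := by gcongr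
          _ = _ := by ring

/-- The slice bound `M^{2k}` gives integrability; the factorial moment turns the count of labels
into `L^{dk}`. -/
lemma expectation_labelForm {k : ℕ} (hL : 0 < L) (hm1 : ∫ v, v ∂Pv = 0) (hm2 : ∫ v, v ^ 2 ∂Pv = 1)
    (S : Finset (Fin d → ℤ)) (K : (Fin k → Fin d → ℤ) → (Fin k → Fin d → ℤ) → ℂ) :
    Integrable (labelForm L S K) (configLaw d L Pv) ∧
    ∫ ω, labelForm L S K ω ∂(configLaw d L Pv) = ((L : ℂ) ^ d) ^ k *
      ∑ σ : Equiv.Perm (Fin k), ∑ m ∈ Fintype.piFinset (fun _ => S), K (m ∘ σ) m := by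
  have hr : (0 : ℝ) ≤ L ^ d := (pow_pos hL d).le
  have hm : ∀ M, Continuous fun z => labelForm L S K (⟨M, z⟩ : Config d) := fun M => by
    simp_rw [labelForm_mk]
    refine continuous_finsetSum _ fun γ _ => continuous_finsetSum _ fun γ' _ =>
      continuous_finsetSum _ fun m _ => continuous_finsetSum _ fun m' _ => ?_
    exact continuous_const.mul ((Complex.continuous_conj.comp (continuous_labelFactor _ _)).mul
      (continuous_labelFactor _ _))
  obtain ⟨h1, h2⟩ := configLaw_integrable_hasSum (Pv := Pv) hL (f := labelForm L S K)
    (fun M => (hm M).measurable)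
    (fun M => by
      simp_rw [labelForm_mk]
      exact integrable_finsetSum _ fun γ _ => integrable_finsetSum _ fun γ' _ =>
        integrable_finsetSum _ fun m _ => integrable_finsetSum _ fun m' _ =>
        (integrable_labelFactor hL hm2 γ γ' m m').const_mul _)
    (by
      refine Summable.of_nonneg_of_le (fun M => by positivity) (fun M => ?_)
        ((summable_poisson_pow (L ^ d) hr (2 * k)).mul_right
          (∑ m ∈ Fintype.piFinset (fun _ => S), ∑ m' ∈ Fintype.piFinset (fun _ => S), ‖K m m'‖))
      rw [mul_assoc]
      exact mul_le_mul_of_nonneg_left (integral_norm_labelForm_slice_le hL hm1 hm2 S K M)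
        (by positivity))
  refine ⟨h1, h2.unique ?_⟩
  simp_rw [integral_labelForm_slice hL hm1 hm2 S K, ← mul_assoc]
  refine HasSum.mul_right _ ?_
  have := (hasSum_poisson_descFactorial (L ^ d) k).mapL Complex.ofRealCLM
  simpa using this

end Expectation

end RandomSchrodinger

namespace RandomSchrodinger

/-! ### Limits of integrals and of lattice sums -/

/-- Dominated convergence with varying dominating functions. -/
lemma tendsto_integral_of_varying_bound {α ι : Type*} [MeasurableSpace α] {μ : Measure α}
    {l : Filter ι} [l.IsCountablyGenerated] [l.NeBot] {F : ι → α → ℂ} {f : α → ℂ} {G : ι → α → ℝ}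
    {g : α → ℝ} {A : ι → ℝ} (hFm : ∀ i, AEStronglyMeasurable (F i) μ)
    (hfm : AEStronglyMeasurable f μ) (hFG : ∀ i x, ‖F i x‖ ≤ G i x) (hG : ∀ i, Integrable (G i) μ)
    (hg : Integrable g μ) (hF : ∀ x, Tendsto (fun i => F i x) l (𝓝 (f x)))
    (hGg : ∀ x, Tendsto (fun i => G i x) l (𝓝 (g x))) (hA : ∀ i, ∫ x, G i x ∂μ ≤ A i)
    (hAg : Tendsto A l (𝓝 (∫ x, g x ∂μ))) :
    Integrable f μ ∧ Tendsto (fun i => ∫ x, F i x ∂μ) l (𝓝 (∫ x, f x ∂μ)) := by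
  have hfg : ∀ x, ‖f x‖ ≤ g x := fun x =>
    le_of_tendsto_of_tendsto' (hF x).norm (hGg x) fun i => hFG i x
  have hfi : Integrable f μ := hg.mono' hfm (Eventually.of_forall hfg)
  have hFi : ∀ i, Integrable (F i) μ := fun i => (hG i).mono' (hFm i) (Eventually.of_forall (hFG i))
  refine ⟨hfi, ?_⟩
  set I := ∫ x, g x ∂μ with hI
  set N : ι → ℝ := fun i => ∫ x, ‖F i x - f x‖ ∂μ with hN
  have hI0 : 0 ≤ I := integral_nonneg fun x => (norm_nonneg _).trans (hfg x)
  have hpos : ∀ i x, 0 ≤ G i x + g x - ‖F i x - f x‖ := fun i x => by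
    have := norm_sub_le (F i x) (f x)
    linarith [hFG i x, hfg x]
  have hint : ∀ i, Integrable (fun x => G i x + g x - ‖F i x - f x‖) μ := fun i =>
    ((hG i).add hg).sub ((hFi i).sub hfi).norm
  have hval : ∀ i, ∫ x, (G i x + g x - ‖F i x - f x‖) ∂μ ≤ A i + I - N i := fun i => by
    have h1 : ∫ x, (G i x + g x - ‖F i x - f x‖) ∂μ = ∫ x, (G i x + g x) ∂μ - N i :=
      integral_sub ((hG i).add hg) ((hFi i).sub hfi).norm
    rw [h1, integral_add (hG i) hg]
    linarith [hA i]
  have hN0 : ∀ i, 0 ≤ N i := fun i => integral_nonneg fun x => norm_nonneg _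
  have hNle : ∀ i, N i ≤ A i + I := fun i => by
    have := (integral_nonneg (hpos i)).trans (hval i)
    linarith
  have hNlim : Tendsto N l (𝓝 0) := by
    -- `ENNReal.ofReal` truncates at 0, so the strict inequality `2I - δ/2 < 2I` survives it only
    -- for `I > 0`; for `I = 0` the bound on `N` suffices.
    rcases hI0.eq_or_lt with h0 | h0
    · refine squeeze_zero hN0 hNle ?_
      simpa [← h0] using hAg.add_const I
    · have hfatou : ENNReal.ofReal (2 * I) ≤
          liminf (fun i => ENNReal.ofReal (A i + I - N i)) l := by
        calc ENNReal.ofReal (2 * I) = ∫⁻ x, ENNReal.ofReal (2 * g x) ∂μ := by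
              rw [hI, ← integral_const_mul, ofReal_integral_eq_lintegral_ofReal (hg.const_mul 2)
                (Eventually.of_forall fun x => by
                  have := (norm_nonneg _).trans (hfg x)
                  simpa using this)]
          _ = ∫⁻ x, liminf (fun i => ENNReal.ofReal (G i x + g x - ‖F i x - f x‖)) l ∂μ := by
              refine lintegral_congr fun x => ?_
              have h1 : Tendsto (fun i => G i x + g x - ‖F i x - f x‖) l (𝓝 (2 * g x)) := by
                have := ((hGg x).add_const (g x)).sub ((hF x).sub_const (f x)).norm
                simpa [two_mul] using this
              exact ((ENNReal.continuous_ofReal.tendsto _).comp h1).liminf_eq.symm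
          _ ≤ liminf (fun i => ∫⁻ x, ENNReal.ofReal (G i x + g x - ‖F i x - f x‖) ∂μ) l :=
              lintegral_liminf_le' fun i => (hint i).aemeasurable.ennreal_ofReal
          _ ≤ _ := by
              refine liminf_le_liminf (Eventually.of_forall fun i => ?_)
              rw [← ofReal_integral_eq_lintegral_ofReal (hint i) (Eventually.of_forall (hpos i))]
              exact ENNReal.ofReal_le_ofReal (hval i)
      rw [Metric.tendsto_nhds]
      intro δ hδ
      have hc : ENNReal.ofReal (2 * I - δ / 2) < ENNReal.ofReal (2 * I) :=
        (ENNReal.ofReal_lt_ofReal_iff (by linarith)).2 (by linarith)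
      filter_upwards [eventually_lt_of_lt_liminf (hc.trans_le hfatou),
        hAg.eventually (gt_mem_nhds (show I < I + δ / 2 by linarith))] with i h1 h2
      rw [ENNReal.ofReal_lt_ofReal_iff'] at h1
      rw [Real.dist_eq, sub_zero, abs_of_nonneg (hN0 i)]
      linarith [h1.1]
  rw [tendsto_iff_norm_sub_tendsto_zero]
  refine squeeze_zero (fun _ => norm_nonneg _) (fun i => ?_) hNlim
  rw [← integral_sub (hFi i) hfi]
  exact norm_integral_le_integral_norm _

/-! ### Lattice sums as integrals of functions constant on cells. -/

section Fibers

variable {X N : Type*} [MeasurableSpace X] [MeasurableSpace N] [Countable N]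
  [MeasurableSingletonClass N] {μ : Measure X} {r : X → N} {c : ℝ}

/-- All fibres have the same volume `c`, so integrating a function of the label is `c` times summing
over the labels. -/
lemma map_eq_smul_count (hr : Measurable r) (hc : ∀ n, μ (r ⁻¹' {n}) = ENNReal.ofReal c) :
    μ.map r = ENNReal.ofReal c • Measure.count := by
  refine Measure.ext_of_singleton fun n => ?_
  rw [Measure.map_apply hr (measurableSet_singleton n), hc]
  simp

lemma integrable_comp_of_fibers (hr : Measurable r) (hc : ∀ n, μ (r ⁻¹' {n}) = ENNReal.ofReal c)
    {Φ : N → ℂ} (hΦ : Summable fun n => ‖Φ n‖) : Integrable (fun x => Φ (r x)) μ := by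
  have hm : AEStronglyMeasurable Φ (μ.map r) := (measurable_of_countable Φ).aestronglyMeasurable
  refine (integrable_map_measure hm hr.aemeasurable).1 ?_
  rw [map_eq_smul_count hr hc]
  exact (integrable_count_iff.2 hΦ).smul_measure ENNReal.ofReal_ne_top

lemma integral_comp_of_fibers (hc0 : 0 ≤ c) (hr : Measurable r)
    (hc : ∀ n, μ (r ⁻¹' {n}) = ENNReal.ofReal c)
    {Φ : N → ℂ} (hΦ : Summable fun n => ‖Φ n‖) : ∫ x, Φ (r x) ∂μ = c * ∑' n, Φ n := by
  have hm : AEStronglyMeasurable Φ (μ.map r) := (measurable_of_countable Φ).aestronglyMeasurable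
  rw [← integral_map hr.aemeasurable hm, map_eq_smul_count hr hc, integral_smul_measure,
    ENNReal.toReal_ofReal hc0, Complex.real_smul]
  congr 1
  rw [integral_countable (integrable_count_iff.2 hΦ)]
  simp [Measure.real]

end Fibers

/-! ### Rounding momenta to the dual lattice. -/

section Rounding

variable {d : ℕ} {L : ℝ}

/-- Rounding of a momentum to the dual lattice. -/
noncomputable def roundPt (L : ℝ) (x : E d) : E d := dualPt L (cellIndex L⁻¹ x)

lemma measurable_roundPt (L : ℝ) : Measurable (roundPt L : E d → E d) :=
  (measurable_of_countable (dualPt L)).comp (measurable_cellIndex L⁻¹)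

lemma norm_roundPt_sub_le (hL : 0 < L) (x : E d) : ‖roundPt L x - x‖ ≤ d / L := by
  have h : ∀ i, |(roundPt L x - x) i| ≤ 1 / L := fun i => by
    have h1 := Int.floor_le (x i / L⁻¹ + 1 / 2)
    have h2 := Int.lt_floor_add_one (x i / L⁻¹ + 1 / 2)
    have h3 : (roundPt L x - x) i = ((⌊x i / L⁻¹ + 1 / 2⌋ : ℝ) - x i / L⁻¹) / L := by
      rw [PiLp.sub_apply, roundPt, dualPt_apply, cellIndex]
      field_simp
    rw [h3, abs_div, abs_of_pos hL]
    gcongr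
    rw [abs_le]
    constructor <;> linarith
  rw [EuclideanSpace.norm_eq]
  refine Real.sqrt_le_iff.2 ⟨by positivity, ?_⟩
  have h2 : ∀ i ∈ Finset.univ, ‖(roundPt L x - x) i‖ ^ 2 ≤ (1 / L) ^ 2 := fun i _ => by
    rw [Real.norm_eq_abs]
    exact pow_le_pow_left₀ (abs_nonneg _) (h i) 2
  refine (Finset.sum_le_sum h2).trans ?_
  -- The estimate is deliberately crude, with `d` in place of `√d`.
  have h3 : (d : ℝ) ≤ (d : ℝ) ^ 2 := by exact_mod_cast Nat.le_self_pow two_ne_zero d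
  rw [Finset.sum_const, Finset.card_univ, Fintype.card_fin, nsmul_eq_mul, div_pow, div_pow,
    one_pow, mul_one_div]
  gcongr

lemma tendsto_roundPt (x : E d) : Tendsto (fun L : ℝ => roundPt L x) atTop (𝓝 x) := by
  rw [tendsto_iff_norm_sub_tendsto_zero]
  refine squeeze_zero' (Eventually.of_forall fun _ => norm_nonneg _)
    ((eventually_gt_atTop 0).mono fun L hL => norm_roundPt_sub_le hL x) ?_
  exact tendsto_const_nhds.div_atTop tendsto_id

lemma norm_roundPt_sub_le_of_one_le (hL : 1 ≤ L) (x : E d) : ‖roundPt L x - x‖ ≤ d :=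
  (norm_roundPt_sub_le (by linarith) x).trans (div_le_self (Nat.cast_nonneg d) hL)

lemma volume_cellIndex_fiber (hL : 0 < L) (n : Fin d → ℤ) :
    volume (cellIndex L⁻¹ ⁻¹' {n} : Set (E d)) = ENNReal.ofReal ((L ^ d)⁻¹) := by
  have := volume_cell (d := d) (inv_pos.2 hL) n
  rwa [inv_pow] at this

lemma measurable_cellIndex_comp (k : ℕ) (ℓ : ℝ) :
    Measurable fun w : Fin k → E d => fun j => cellIndex ℓ (w j) :=
  measurable_pi_lambda _ fun j => (measurable_cellIndex ℓ).comp (measurable_pi_apply j)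

lemma volume_cellIndex_comp_fiber (hL : 0 < L) {k : ℕ} (m : Fin k → Fin d → ℤ) :
    volume ((fun w : Fin k → E d => fun j => cellIndex L⁻¹ (w j)) ⁻¹' {m}) =
      ENNReal.ofReal (((L ^ d)⁻¹) ^ k) := by
  have h : ((fun w : Fin k → E d => fun j => cellIndex L⁻¹ (w j)) ⁻¹' {m}) =
      Set.univ.pi fun j => (cellIndex L⁻¹ ⁻¹' {m j} : Set (E d)) := by
    ext w
    simp [funext_iff]
  have : (0 : ℝ) ≤ (L ^ d)⁻¹ := by positivity
  rw [h, volume_pi_pi]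
  simp_rw [volume_cellIndex_fiber hL]
  rw [Finset.prod_const, Finset.card_univ, Fintype.card_fin, ENNReal.ofReal_pow this]

end Rounding

end RandomSchrodinger

namespace RandomSchrodinger

/-! ### Cutoffs, decay and Bessel's inequality -/

section Decay

variable {d : ℕ}

/-- The integrable weight `(1 + |x|)^{-(d+1)}`. -/
noncomputable def decay (x : E d) : ℝ := ((1 + ‖x‖) ^ (d + 1))⁻¹

lemma decay_pos (x : E d) : 0 < decay x := by unfold decay; positivity

lemma decay_le_one (x : E d) : decay x ≤ 1 :=
  inv_le_one_of_one_le₀ (one_le_pow₀ (by linarith [norm_nonneg x]))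

lemma continuous_decay : Continuous (decay : E d → ℝ) :=
  Continuous.inv₀ (by fun_prop) fun x => by positivity

lemma integrable_decay : Integrable (decay : E d → ℝ) := by
  have h := integrable_one_add_norm (E := E d) (μ := volume) (r := (d + 1 : ℕ)) (by simp)
  refine h.congr (Eventually.of_forall fun x => ?_)
  simp only [decay]
  rw [Real.rpow_neg (by positivity), Real.rpow_natCast]

lemma decay_le_mul {c : ℝ} {x y : E d} (h : 1 + ‖y‖ ≤ c * (1 + ‖x‖)) :
    decay x ≤ c ^ (d + 1) * decay y := by
  unfold decay
  rw [inv_le_iff_one_le_mul₀ (by positivity), mul_right_comm, ← mul_pow, ← div_eq_mul_inv,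
    le_div_iff₀ (by positivity), one_mul]
  exact pow_le_pow_left₀ (by positivity) h _

lemma exists_decay_bound (f : SchwartzMap (E d) ℂ) :
    ∃ C, 0 ≤ C ∧ ∀ x, ‖f x‖ ≤ C * decay x := by
  obtain ⟨K, h⟩ : ∃ K, ∀ x, (1 + ‖x‖) ^ (d + 1) * ‖iteratedFDeriv ℝ 0 f x‖ ≤ K :=
    ⟨_, fun x => SchwartzMap.one_add_le_sup_seminorm_apply (𝕜 := ℝ) (m := (d + 1, 0))
      le_rfl le_rfl f x⟩
  refine ⟨K, le_trans (by positivity) (h 0), fun x => ?_⟩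
  have h1 := h x
  rw [norm_iteratedFDeriv_zero] at h1
  unfold decay
  rw [← div_eq_mul_inv, le_div_iff₀ (by positivity), mul_comm]
  exact h1

lemma exists_decay_bound_prod (f : SchwartzMap (E d × E d) ℂ) :
    ∃ C, 0 ≤ C ∧ ∀ x v, ‖f (x, v)‖ ≤ C * (decay x * decay v) := by
  obtain ⟨K, h⟩ : ∃ K, ∀ z, (1 + ‖z‖) ^ (d + 1 + (d + 1)) * ‖iteratedFDeriv ℝ 0 f z‖ ≤ K :=
    ⟨_, fun z => SchwartzMap.one_add_le_sup_seminorm_apply (𝕜 := ℝ) (m := (d + 1 + (d + 1), 0))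
      le_rfl le_rfl f z⟩
  refine ⟨K, le_trans (by positivity) (h 0), fun x v => ?_⟩
  have h1 := h (x, v)
  rw [norm_iteratedFDeriv_zero, pow_add] at h1
  unfold decay
  rw [← mul_inv, ← div_eq_mul_inv, le_div_iff₀ (by positivity), mul_comm]
  refine le_trans ?_ h1
  gcongr
  · exact norm_fst_le (x, v)
  · exact norm_snd_le (x, v)

lemma summable_of_integrable_comp {X N : Type*} [MeasurableSpace X] [MeasurableSpace N] [Countable N]
    [MeasurableSingletonClass N] {μ : Measure X} {r : X → N} {c : ℝ} (hc0 : 0 < c)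
    (hr : Measurable r) (hc : ∀ n, μ (r ⁻¹' {n}) = ENNReal.ofReal c) {Φ : N → ℝ}
    (hΦ : Integrable (fun x => Φ (r x)) μ) : Summable fun n => ‖Φ n‖ := by
  have hm : AEStronglyMeasurable Φ (μ.map r) := (measurable_of_countable Φ).aestronglyMeasurable
  have h := (integrable_map_measure hm hr.aemeasurable).2 hΦ
  rw [map_eq_smul_count hr hc, integrable_smul_measure (by simpa using hc0) ENNReal.ofReal_ne_top] at h
  exact integrable_count_iff.1 h

/-- `decay` at the rounded point is at most a constant times `decay` at the point, so integrability
over the space yields summability over the lattice. -/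
lemma summable_decay_dualPt {L : ℝ} (hL : 0 < L) :
    Summable fun n : Fin d → ℤ => decay (dualPt L n) := by
  have h := summable_of_integrable_comp (μ := (volume : Measure (E d))) (r := cellIndex L⁻¹)
    (c := (L ^ d)⁻¹) (by positivity) (measurable_cellIndex _) (volume_cellIndex_fiber hL)
    (Φ := fun n => decay (dualPt L n)) ?_
  · simpa [abs_of_pos (decay_pos _)] using h
  · refine ((integrable_decay (d := d)).const_mul ((1 + d / L) ^ (d + 1))).mono'
      ((continuous_decay.measurable.comp (measurable_roundPt L)).aestronglyMeasurable)
      (Eventually.of_forall fun x => ?_)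
    rw [Real.norm_of_nonneg (decay_pos _).le]
    refine decay_le_mul ?_
    have h1 := norm_roundPt_sub_le hL x
    have h2 := norm_sub_norm_le x (roundPt L x)
    rw [norm_sub_rev] at h2
    change 1 + ‖x‖ ≤ (1 + d / L) * (1 + ‖roundPt L x‖)
    have : 0 ≤ (d / L : ℝ) * ‖roundPt L x‖ := by positivity
    linarith

end Decay

/-! ### Box cutoffs and their Fourier transforms. -/

section Cutoff

variable {d : ℕ} {χ : ℝ → E d → ℝ}

lemma mem_box_iff_norm_le {x : E d} {ℓ : ℝ} (h : ‖x‖ ≤ ℓ / 2) : x ∈ box d ℓ := fun i =>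
  (PiLp.norm_apply_le x i).trans h

lemma norm_le_of_mem_box {x : E d} {ℓ : ℝ} (hℓ : 0 ≤ ℓ) (h : x ∈ box d ℓ) : ‖x‖ ≤ d * ℓ := by
  rw [EuclideanSpace.norm_eq]
  refine Real.sqrt_le_iff.2 ⟨by positivity, ?_⟩
  have h2 : ∀ i ∈ Finset.univ, ‖x i‖ ^ 2 ≤ ℓ ^ 2 := fun i _ => by
    rw [Real.norm_eq_abs]
    exact pow_le_pow_left₀ (abs_nonneg _) ((h i).trans (by linarith)) 2
  refine (Finset.sum_le_sum h2).trans ?_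
  have h3 : (d : ℝ) ≤ (d : ℝ) ^ 2 := by exact_mod_cast Nat.le_self_pow two_ne_zero d
  rw [Finset.sum_const, Finset.card_univ, Fintype.card_fin, nsmul_eq_mul, mul_pow]
  gcongr

/-- `χ_L(0) = 1`, and a gradient of size `C/L` over a distance at most `dL` changes the value by at
most `Cd`, whatever `L`. -/
lemma IsBoxCutoff.exists_bound (hχ : IsBoxCutoff χ) :
    ∃ C, 0 ≤ C ∧ ∀ L, 1 ≤ L → ∀ x, |χ L x| ≤ C := by
  obtain ⟨C, hC⟩ := hχ.gradient_le
  have hC0 : 0 ≤ C := by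
    have := (norm_nonneg _).trans (hC 1 le_rfl 0)
    simpa using this
  refine ⟨1 + C * d, by positivity, fun L hL x => ?_⟩
  have hL0 : 0 < L := by linarith
  by_cases hx : x ∈ box d L
  · have h0 : χ L 0 = 1 := hχ.eq_one L hL 0 fun i => by
      simp only [PiLp.zero_apply, abs_zero]; positivity
    have h1 := Convex.norm_image_sub_le_of_norm_fderiv_le (𝕜 := ℝ) (f := χ L) (s := Set.univ)
      (fun y _ => ((hχ.smooth L hL).differentiable (by simp)).differentiableAt)
      (fun y _ => hC L hL y) convex_univ (Set.mem_univ 0) (Set.mem_univ x)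
    rw [h0, sub_zero, Real.norm_eq_abs] at h1
    have h2 : C / L * ‖x‖ ≤ C / L * (d * L) := by
      gcongr
      exact norm_le_of_mem_box hL0.le hx
    have h3 : C / L * (d * L) = C * d := by field_simp
    have h4 := abs_sub_abs_le_abs_sub (χ L x) 1
    rw [abs_one] at h4
    linarith
  · have : χ L x = 0 := by
      by_contra h
      exact hx (hχ.support_subset L hL h)
    rw [this, abs_zero]
    positivity

lemma IsBoxCutoff.tendsto_one (hχ : IsBoxCutoff χ) (x : E d) :
    Tendsto (fun L => χ L x) atTop (𝓝 1) := by
  refine tendsto_const_nhds.congr' ?_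
  filter_upwards [eventually_ge_atTop (max 1 (4 * ‖x‖))] with L hL
  refine (hχ.eq_one L ((le_max_left _ _).trans hL) x (mem_box_iff_norm_le ?_)).symm
  linarith [(le_max_right _ _).trans hL]

/-- Function and frequency both vary with `L`, because momenta are rounded to a lattice depending on
`L` while the cutoff is being removed. -/
lemma IsBoxCutoff.tendsto_fourier (hχ : IsBoxCutoff χ) {f : ℝ → E d → ℂ} {f₀ : E d → ℂ}
    {g : E d → ℝ} (hf : ∀ L, Continuous (f L)) (hg : Integrable g) (hfg : ∀ L x, ‖f L x‖ ≤ g x)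
    (hlim : ∀ x, Tendsto (fun L => f L x) atTop (𝓝 (f₀ x)))
    {p : ℝ → E d} {p₀ : E d} (hp : Tendsto p atTop (𝓝 p₀)) :
    Tendsto (fun L => 𝓕 (fun x => (χ L x : ℂ) * f L x) (p L)) atTop (𝓝 (𝓕 f₀ p₀)) := by
  obtain ⟨C, hC0, hC⟩ := hχ.exists_bound
  simp only [Real.fourier_eq', smul_eq_mul]
  refine tendsto_integral_filter_of_dominated_convergence (fun x => C * g x) ?_ ?_
    (hg.const_mul C) (Eventually.of_forall fun x => ?_)
  · filter_upwards [eventually_ge_atTop 1] with L hL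
    have := (hχ.smooth L hL).continuous
    have := hf L
    exact Continuous.aestronglyMeasurable (by fun_prop)
  · filter_upwards [eventually_ge_atTop 1] with L hL
    refine Eventually.of_forall fun x => ?_
    rw [norm_mul, Complex.norm_exp_ofReal_mul_I, one_mul, norm_mul, Complex.norm_real]
    exact mul_le_mul (hC L hL x) (hfg L x) (norm_nonneg _) hC0
  · have h1 : Tendsto (fun L => (χ L x : ℂ) * f L x) atTop (𝓝 (f₀ x)) := by
      have h2 : Tendsto (fun L => (χ L x : ℂ)) atTop (𝓝 ((1 : ℝ) : ℂ)) :=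
        (Complex.continuous_ofReal.tendsto _).comp (hχ.tendsto_one x)
      simpa using h2.mul (hlim x)
    refine Tendsto.mul ?_ h1
    have h3 : Continuous fun q : E d => Complex.exp (((-2 * Real.pi * inner ℝ x q : ℝ) : ℂ) *
        Complex.I) := by fun_prop
    exact (h3.tendsto p₀).comp hp

lemma norm_fourier_cutoff_le {C : ℝ}
    (hC : ∀ L, 1 ≤ L → ∀ x, |χ L x| ≤ C) {f : E d → ℂ} {g : E d → ℝ}
    (hg : Integrable g) (hfg : ∀ x, ‖f x‖ ≤ g x) {L : ℝ} (hL : 1 ≤ L) (p : E d) :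
    ‖𝓕 (fun x => (χ L x : ℂ) * f x) p‖ ≤ C * ∫ x, g x := by
  rw [← integral_const_mul, Real.fourier_eq']
  refine norm_integral_le_of_norm_le (hg.const_mul C) (Eventually.of_forall fun x => ?_)
  rw [norm_smul, Complex.norm_exp_ofReal_mul_I, one_mul, norm_mul, Complex.norm_real]
  exact mul_le_mul (hC L hL x) (hfg x) (norm_nonneg _) ((abs_nonneg _).trans (hC L hL x))

/-- The support lies in the box, so cutting the integral off there changes nothing. -/
lemma IsBoxCutoff.boxFourier_eq_fourier (hχ : IsBoxCutoff χ) (f : E d → ℂ) {L : ℝ} (hL : 1 ≤ L)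
    (p : E d) : boxFourier L (fun x => (χ L x : ℂ) * f x) p = 𝓕 (fun x => (χ L x : ℂ) * f x) p := by
  rw [boxFourier_eq, Real.fourier_eq', setIntegral_eq_integral_of_forall_compl_eq_zero]
  · congr 1; ext x
    rw [planeWave_eq, smul_eq_mul, inner_neg_left, real_inner_comm]
    congr 4
    ring
  · intro x hx
    have : χ L x = 0 := by
      by_contra h
      exact hx (hχ.support_subset L hL h)
    simp [this]

/-- At fixed `L` the product is smooth with compact support, hence Schwartz. No uniformity in `L` is
obtained; the limit relies on `L²` bounds instead. -/
lemma IsBoxCutoff.summable_fourier (hχ : IsBoxCutoff χ) (f : SchwartzMap (E d) ℂ) {L : ℝ}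
    (hL : 1 ≤ L) : Summable fun n => ‖𝓕 (fun x => (χ L x : ℂ) * f x) (dualPt L n)‖ := by
  have hc : HasCompactSupport fun x => (χ L x : ℂ) * f x := by
    refine HasCompactSupport.of_support_subset_isCompact (isCompact_box (d := d) L) fun x hx => ?_
    refine hχ.support_subset L hL ?_
    intro h
    simp [h] at hx
  have hs : ContDiff ℝ ((⊤ : ℕ∞) : WithTop ℕ∞) fun x => (χ L x : ℂ) * f x :=
    (Complex.ofRealCLM.contDiff.comp (hχ.smooth L hL)).mul (f.smooth ⊤)
  obtain ⟨C, hC0, hC⟩ := exists_decay_bound (𝓕 (hc.toSchwartzMap hs))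
  refine Summable.of_nonneg_of_le (fun _ => norm_nonneg _) (fun n => ?_)
    ((summable_decay_dualPt (d := d) (L := L) (by linarith)).mul_left C)
  have := hC (dualPt L n)
  rw [SchwartzMap.fourier_coe] at this
  exact this

/-- Bessel: `f` and its Fourier series have equal coefficients, so `0 ≤ ‖f - synth‖² = ‖f‖² -
‖synth‖²`. -/
lemma boxNormSq_synth_le {L : ℝ} {c : (Fin d → ℤ) → ℂ} (hc : Summable fun n => ‖c n‖)
    (hL : 0 < L) {f : E d → ℂ} (hf : Continuous f)
    (hfc : ∀ n, boxFourier L f (dualPt L n) = c n) :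
    boxNormSq L (synth L c) ≤ boxNormSq L f := by
  have hg := continuous_synth hc L
  have hint : ∀ {V : Type} [NormedAddCommGroup V] {u : E d → V}, Continuous u →
      Integrable u (volume.restrict (box d L)) :=
    fun hu => hu.continuousOn.integrableOn_compact (isCompact_box L)
  have h1 : ∫ x in box d L, conj (f x) * synth L c x = (boxNormSq L (synth L c) : ℂ) := by
    have hi : Integrable (fun x => conj (f x)) (volume.restrict (box d L)) :=
      hint (Complex.continuous_conj.comp hf)
    rw [integral_mul_synth hi hc, boxNormSq_synth hL hc]
    congr 2; ext n
    rw [mul_comm]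
    congr 1
    rw [← hfc n, boxFourier_eq, ← integral_conj]
    congr 1; ext x
    rw [planeWave_neg]; simp
  have h2 : ∀ x, ‖f x - synth L c x‖ ^ 2 = ‖f x‖ ^ 2 + ‖synth L c x‖ ^ 2 -
      2 * (conj (f x) * synth L c x).re := fun x => by
    simp only [← Complex.normSq_eq_norm_sq, Complex.normSq_apply, Complex.sub_re, Complex.sub_im,
      Complex.mul_re, Complex.conj_re, Complex.conj_im]
    ring
  have h3 : 0 ≤ ∫ x in box d L, ‖f x - synth L c x‖ ^ 2 := integral_nonneg fun x => by positivity
  have hi1 : Integrable (fun x => ‖f x‖ ^ 2) (volume.restrict (box d L)) := hint (hf.norm.pow 2)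
  have hi2 : Integrable (fun x => ‖synth L c x‖ ^ 2) (volume.restrict (box d L)) :=
    hint (hg.norm.pow 2)
  have hi3 : Integrable (fun x => conj (f x) * synth L c x) (volume.restrict (box d L)) :=
    hint ((Complex.continuous_conj.comp hf).mul hg)
  have h4 : ∫ x in box d L, (conj (f x) * synth L c x).re = boxNormSq L (synth L c) := by
    have := congrArg Complex.re h1
    rw [Complex.ofReal_re] at this
    rw [← this]
    exact integral_re hi3
  have h5 : ∫ x in box d L, ‖f x - synth L c x‖ ^ 2 =
      boxNormSq L f + boxNormSq L (synth L c) - 2 * boxNormSq L (synth L c) := by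
    simp_rw [h2]
    have h6 : ∫ x in box d L, (‖f x‖ ^ 2 + ‖synth L c x‖ ^ 2 -
        2 * (conj (f x) * synth L c x).re) = (∫ x in box d L, (‖f x‖ ^ 2 + ‖synth L c x‖ ^ 2)) -
        ∫ x in box d L, 2 * (conj (f x) * synth L c x).re :=
      integral_sub (hi1.add hi2) (hi3.re.const_mul 2)
    rw [h6, integral_add hi1 hi2, integral_const_mul, h4]
    rfl
  linarith

end Cutoff

end RandomSchrodinger

namespace RandomSchrodinger

/-! ### Expectations of quadratic forms of the wave function -/

section Quadratic

variable {d k : ℕ} {B : SchwartzMap (E d) ℝ} {lam L : ℝ} {S : Finset (Fin d → ℤ)}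
  {a : (Fin d → ℤ) → ℂ} {Pv : Measure ℝ} [IsProbabilityMeasure Pv]

lemma waveCoeff_eq (t : ℝ) (ω : Config d) (n : Fin d → ℤ) :
    waveCoeff B lam L S a t k ω n = ∑ γ : Fin k ↪ Fin ω.1,
      ∑ m ∈ Fintype.piFinset (fun _ : Fin k => S),
        collisionCoeff B lam L a t m n * labelFactor L γ m ω.2 := rfl

/-- The index maps `u`, `u'` cover both applications: `u = u' = id` for the norm, the two
projections of a pair of momenta for the Wigner pairing. -/
lemma tsum_waveCoeff_eq_labelForm {J : Type*} (h : J → ℂ) (u u' : J → Fin d → ℤ) {t : ℝ}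
    (hs : ∀ m m' : Fin k → Fin d → ℤ, Summable fun j => h j *
      (conj (collisionCoeff B lam L a t m (u j)) * collisionCoeff B lam L a t m' (u' j)))
    (ω : Config d) :
    ∑' j, h j * (conj (waveCoeff B lam L S a t k ω (u j)) * waveCoeff B lam L S a t k ω (u' j)) =
      labelForm L S (fun m m' : Fin k → Fin d → ℤ => ∑' j, h j *
        (conj (collisionCoeff B lam L a t m (u j)) * collisionCoeff B lam L a t m' (u' j))) ω := by
  have h1 : ∀ j, h j * (conj (waveCoeff B lam L S a t k ω (u j)) *
      waveCoeff B lam L S a t k ω (u' j)) =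
      ∑ γ : Fin k ↪ Fin ω.1, ∑ γ' : Fin k ↪ Fin ω.1,
        ∑ m ∈ Fintype.piFinset (fun _ => S), ∑ m' ∈ Fintype.piFinset (fun _ => S),
        (h j * (conj (collisionCoeff B lam L a t m (u j)) *
          collisionCoeff B lam L a t m' (u' j))) *
          (conj (labelFactor L γ m ω.2) * labelFactor L γ' m' ω.2) := fun j => by
    rw [waveCoeff_eq, waveCoeff_eq, map_sum, Finset.sum_mul_sum, Finset.mul_sum]
    refine Finset.sum_congr rfl fun γ _ => ?_
    rw [Finset.mul_sum]
    refine Finset.sum_congr rfl fun γ' _ => ?_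
    rw [map_sum, Finset.sum_mul_sum, Finset.mul_sum]
    refine Finset.sum_congr rfl fun m _ => ?_
    rw [Finset.mul_sum]
    refine Finset.sum_congr rfl fun m' _ => ?_
    rw [map_mul]
    ring
  have hs' := fun (γ γ' : Fin k ↪ Fin ω.1) m m' =>
    (hs m m').mul_right (conj (labelFactor L γ m ω.2) * labelFactor L γ' m' ω.2)
  simp_rw [h1]
  unfold labelForm
  rw [Summable.tsum_finsetSum fun γ _ => summable_sum fun γ' _ => summable_sum fun m _ =>
    summable_sum fun m' _ => hs' γ γ' m m']
  refine Finset.sum_congr rfl fun γ _ => ?_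
  rw [Summable.tsum_finsetSum fun γ' _ => summable_sum fun m _ =>
    summable_sum fun m' _ => hs' γ γ' m m']
  refine Finset.sum_congr rfl fun γ' _ => ?_
  rw [Summable.tsum_finsetSum fun m _ => summable_sum fun m' _ => hs' γ γ' m m']
  refine Finset.sum_congr rfl fun m _ => ?_
  rw [Summable.tsum_finsetSum fun m' _ => hs' γ γ' m m']
  refine Finset.sum_congr rfl fun m' _ => ?_
  rw [tsum_mul_right]

/-- The part of a collision history that does not involve the initial state. -/
noncomputable def historyWeight (B : SchwartzMap (E d) ℝ) (lam t : ℝ) (σ : Equiv.Perm (Fin k))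
    (w : Fin k → E d) (z z' : E d) : ℂ :=
  (lam : ℂ) ^ (2 * k) * (∏ j, (conj (Bhat B (w j)) * Bhat B (w j))) *
    (conj (pathKernel B lam t (incrPath z (w ∘ σ))) * pathKernel B lam t (incrPath z' w))

lemma dualPt_incrPath (n : Fin d → ℤ) (m : Fin k → Fin d → ℤ) :
    (fun j => dualPt L (incrPath n m j)) = incrPath (dualPt L n) (fun i => dualPt L (m i)) :=
  funext fun j => map_incrPath (dualHom d L) n m j

/-- Shifting by `∑ m_i` makes `n`, `n'` the initial momenta. The `L^{dk}` of the label count and the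
`L^{-2dk}` of the two amplitudes leave `L^{-dk}`, the volume of `k` lattice cells; the phases
`(-i)^k` cancel. -/
lemma conj_collisionCoeff_mul (hL : 0 < L) (t : ℝ) (σ : Equiv.Perm (Fin k))
    (m : Fin k → Fin d → ℤ) (n n' : Fin d → ℤ) :
    ((L : ℂ) ^ d) ^ k * (conj (collisionCoeff B lam L a t (m ∘ σ) (n + ∑ i, m i)) *
      collisionCoeff B lam L a t m (n' + ∑ i, m i)) = (((L : ℂ) ^ d)⁻¹) ^ k *
      (historyWeight B lam t σ (fun j => dualPt L (m j)) (dualPt L n) (dualPt L n') *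
        (conj (a n) * a n')) := by
  have h1 : ∑ i, (m ∘ σ) i = ∑ i, m i := Equiv.sum_comp σ m
  have h2 : ∏ j, Bhat B (dualPt L ((m ∘ σ) j)) = ∏ j, Bhat B (dualPt L (m j)) :=
    Equiv.prod_comp σ fun j => Bhat B (dualPt L (m j))
  have hI : conj ((-Complex.I) ^ k) * (-Complex.I) ^ k = 1 := by
    rw [map_pow, ← mul_pow]; simp
  have hL' : ((L : ℂ) ^ d) ≠ 0 := pow_ne_zero _ (by exact_mod_cast hL.ne')
  have hL2 : ((L : ℂ) ^ d) ^ k * (((L : ℂ) ^ d)⁻¹) ^ k = 1 := by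
    rw [← mul_pow, mul_inv_cancel₀ hL', one_pow]
  unfold collisionCoeff historyWeight
  rw [h1, h2, add_sub_cancel_right, add_sub_cancel_right, dualPt_incrPath, dualPt_incrPath]
  have hr1 : conj ((((L : ℂ) ^ d)⁻¹) ^ k) = (((L : ℂ) ^ d)⁻¹) ^ k := by simp
  have hr2 : conj ((lam : ℂ) ^ k) = (lam : ℂ) ^ k := by simp
  simp only [map_mul, Finset.prod_mul_distrib, map_prod, Function.comp_def, mul_pow, two_mul,
    pow_add, hr1, hr2]
  generalize ((L : ℂ) ^ d) ^ k = X at *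
  generalize (((L : ℂ) ^ d)⁻¹) ^ k = Y at *
  generalize conj ((-Complex.I) ^ k) = c at *
  generalize (-Complex.I) ^ k = c' at *
  generalize ∏ x, conj (Bhat B (dualPt L (m x))) = P
  generalize ∏ x, Bhat B (dualPt L (m x)) = P'
  generalize conj (pathKernel B lam t _) = K
  generalize pathKernel B lam t _ = K'
  linear_combination (Y * (lam : ℂ) ^ k * (lam : ℂ) ^ k * P * P' * K * K' * conj (a n) * a n') *
    (X * Y * hI + hL2)

lemma expectation_quadratic (hL : 0 < L) (hm1 : ∫ v, v ∂Pv = 0) (hm2 : ∫ v, v ^ 2 ∂Pv = 1)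
    {J : Type*} (h : J → ℂ) (u u' : J → Fin d → ℤ) {t : ℝ}
    (hs : ∀ m m' : Fin k → Fin d → ℤ, Summable fun j => h j *
      (conj (collisionCoeff B lam L a t m (u j)) * collisionCoeff B lam L a t m' (u' j))) :
    Integrable (fun ω => ∑' j, h j * (conj (waveCoeff B lam L S a t k ω (u j)) *
      waveCoeff B lam L S a t k ω (u' j))) (configLaw d L Pv) ∧
    ∫ ω, ∑' j, h j * (conj (waveCoeff B lam L S a t k ω (u j)) *
      waveCoeff B lam L S a t k ω (u' j)) ∂(configLaw d L Pv) =
      ∑ σ : Equiv.Perm (Fin k), ∑ m ∈ Fintype.piFinset (fun _ => S), ∑' j, h j *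
        (((L : ℂ) ^ d) ^ k * (conj (collisionCoeff B lam L a t (m ∘ σ) (u j)) *
          collisionCoeff B lam L a t m (u' j))) := by
  simp_rw [tsum_waveCoeff_eq_labelForm h u u' hs]
  obtain ⟨h1, h2⟩ := expectation_labelForm (Pv := Pv) hL hm1 hm2 S (fun m m' => ∑' j, h j *
    (conj (collisionCoeff B lam L a t m (u j)) * collisionCoeff B lam L a t m' (u' j)))
  refine ⟨h1, h2.trans ?_⟩
  rw [Finset.mul_sum]
  refine Finset.sum_congr rfl fun σ _ => ?_
  rw [Finset.mul_sum]
  refine Finset.sum_congr rfl fun m _ => ?_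
  rw [← tsum_mul_left]
  exact tsum_congr fun j => by ring

end Quadratic

/-! ### Sums over transfers and initial momenta as one integral. -/

section LatticeSums

variable {d k : ℕ} {L : ℝ}

lemma integral_lattice_prod (hL : 0 < L) (S : Finset (Fin d → ℤ)) {Y J : Type*} [MeasureSpace Y]
    [SFinite (volume : Measure Y)] [MeasurableSpace J] [Countable J] [MeasurableSingletonClass J]
    {r : Y → J} {c : ℝ} (hc0 : 0 ≤ c) (hr : Measurable r)
    (hc : ∀ j, volume (r ⁻¹' {j}) = ENNReal.ofReal c)
    {Φ : (Fin k → Fin d → ℤ) × J → ℂ} (hΦS : ∀ m ∉ Fintype.piFinset (fun _ => S), ∀ j, Φ (m, j) = 0)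
    (hΦ : ∀ m, Summable fun j => ‖Φ (m, j)‖) :
    ∫ x : (Fin k → E d) × Y, Φ (fun i => cellIndex L⁻¹ (x.1 i), r x.2) =
      ((((L : ℂ) ^ d)⁻¹) ^ k * c) * ∑ m ∈ Fintype.piFinset (fun _ => S), ∑' j, Φ (m, j) := by
  have hsum : Summable fun x => ‖Φ x‖ := by
    refine (summable_prod_of_nonneg fun _ => norm_nonneg _).2 ⟨hΦ, ?_⟩
    refine summable_of_ne_finset_zero (s := Fintype.piFinset (fun _ => S)) fun m hm => ?_
    simp [hΦS m hm]
  have hmeas : Measurable fun x : (Fin k → E d) × Y =>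
      ((fun i => cellIndex L⁻¹ (x.1 i), r x.2) : (Fin k → Fin d → ℤ) × J) :=
    ((measurable_cellIndex_comp k L⁻¹).comp measurable_fst).prodMk (hr.comp measurable_snd)
  have hinv : (0 : ℝ) ≤ (L ^ d)⁻¹ := by positivity
  have hfib : ∀ p : (Fin k → Fin d → ℤ) × J, volume ((fun x : (Fin k → E d) × Y =>
      ((fun i => cellIndex L⁻¹ (x.1 i), r x.2) : (Fin k → Fin d → ℤ) × J)) ⁻¹' {p}) =
      ENNReal.ofReal (((L ^ d)⁻¹) ^ k * c) := fun p => by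
    have : ((fun x : (Fin k → E d) × Y =>
      ((fun i => cellIndex L⁻¹ (x.1 i), r x.2) : (Fin k → Fin d → ℤ) × J)) ⁻¹' {p}) =
      ((fun w : Fin k → E d => fun j => cellIndex L⁻¹ (w j)) ⁻¹' {p.1}) ×ˢ (r ⁻¹' {p.2}) := by
      ext x
      simp [Prod.ext_iff]
    rw [this, Measure.volume_eq_prod, Measure.prod_prod, volume_cellIndex_comp_fiber hL, hc,
      ENNReal.ofReal_mul (by positivity)]
  rw [integral_comp_of_fibers (by positivity) hmeas hfib hsum]
  congr 1
  · push_cast; rfl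
  · rw [hsum.of_norm.tsum_prod' fun m => (hΦ m).of_norm, tsum_eq_sum fun m hm => ?_]
    simp [hΦS m hm]

end LatticeSums

end RandomSchrodinger

namespace RandomSchrodinger

/-! ### Majorants -/

section Majorants

variable {d : ℕ}

/-- The shear `(y₁, y₂) ↦ (y₁ + y₂, y₂)` preserves volume and separates the variables. -/
lemma integral_decay_add_mul_snd {u : E d → ℝ} (hu : Integrable u) :
    Integrable (fun y : E d × E d => decay (y.1 + y.2) * u y.2) ∧
      ∫ y : E d × E d, decay (y.1 + y.2) * u y.2 = (∫ x : E d, decay x) * ∫ x, u x := by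
  have hT : MeasurePreserving (fun y : E d × E d => (y.1 + y.2, y.2)) :=
    volume_preserving_skew_fst (g := fun b a => a + b) (by fun_prop)
      fun b => measurePreserving_add_right volume b
  have hi : Integrable (fun y : E d × E d => decay y.1 * u y.2) := integrable_decay.mul_prod hu
  refine ⟨(hT.integrable_comp hi.aestronglyMeasurable).2 hi, ?_⟩
  have h := integral_map (φ := fun y : E d × E d => (y.1 + y.2, y.2))
    (f := fun y : E d × E d => decay y.1 * u y.2) (μ := volume) hT.measurable.aemeasurable
    (by rw [hT.map_eq]; exact hi.aestronglyMeasurable)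
  rw [hT.map_eq] at h
  exact h.symm.trans (integral_prod_mul (fun x : E d => decay x) u)

lemma integral_decay_add_mul_fst {u : E d → ℝ} (hu : Integrable u) :
    Integrable (fun y : E d × E d => decay (y.1 + y.2) * u y.1) ∧
      ∫ y : E d × E d, decay (y.1 + y.2) * u y.1 = (∫ x : E d, decay x) * ∫ x, u x := by
  obtain ⟨h1, h2⟩ := integral_decay_add_mul_snd hu
  have hs : ∀ y : E d × E d, decay (y.1 + y.2) * u y.1 =
      (fun y : E d × E d => decay (y.1 + y.2) * u y.2) y.swap := fun y => by
    simp [add_comm]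
  simp_rw [hs]
  refine ⟨h1.swap, ?_⟩
  rw [← h2]
  exact integral_prod_swap (μ := (volume : Measure (E d))) (ν := (volume : Measure (E d)))
    (fun y : E d × E d => decay (y.1 + y.2) * u y.2)

variable {k : ℕ}

/-- The indicator function of a ball of momentum transfers. -/
noncomputable def ballIndicator (k : ℕ) (R : ℝ) (w : Fin k → E d) : ℝ :=
  (Metric.closedBall (0 : Fin k → E d) R).indicator (fun _ => 1) w

lemma ballIndicator_nonneg (R : ℝ) (w : Fin k → E d) : 0 ≤ ballIndicator k R w :=
  Set.indicator_nonneg (fun _ _ => zero_le_one) w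

lemma integrable_ballIndicator (R : ℝ) : Integrable (ballIndicator (d := d) k R) :=
  (integrable_indicator_iff measurableSet_closedBall).2
    (integrableOn_const (isCompact_closedBall _ _).measure_lt_top.ne)

/-- For `L ≥ 1` rounding moves a point by at most `d`, so a ball enlarged by `d` serves for every
`L`. -/
lemma ballIndicator_roundPt_le {R : ℝ} {L : ℝ} (hL : 1 ≤ L) (w : Fin k → E d) :
    ballIndicator k R (fun j => roundPt L (w j)) ≤ ballIndicator k (R + d) w := by
  unfold ballIndicator
  by_cases h : (fun j => roundPt L (w j)) ∈ Metric.closedBall (0 : Fin k → E d) R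
  · have h2 : w ∈ Metric.closedBall (0 : Fin k → E d) (R + d) := by
      rw [mem_closedBall_zero_iff] at h ⊢
      have hR : 0 ≤ R := (norm_nonneg _).trans h
      rw [pi_norm_le_iff_of_nonneg (by positivity)]
      rw [pi_norm_le_iff_of_nonneg hR] at h
      intro j
      have h3 := norm_roundPt_sub_le_of_one_le hL (w j)
      have h4 := norm_sub_norm_le (w j) (roundPt L (w j))
      rw [norm_sub_rev] at h4
      linarith [h j]
    rw [Set.indicator_of_mem h, Set.indicator_of_mem h2]
  · rw [Set.indicator_of_notMem h]
    exact Set.indicator_nonneg (fun _ _ => zero_le_one) w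

lemma continuous_historyWeight (hd : 3 ≤ d) (B : SchwartzMap (E d) ℝ) (lam t : ℝ)
    (σ : Equiv.Perm (Fin k)) :
    Continuous fun x : (Fin k → E d) × (E d × E d) => historyWeight B lam t σ x.1 x.2.1 x.2.2 := by
  have h1 := continuous_Bhat B
  have h2 := continuous_pathKernel (k := k) hd B lam t
  have h3 := continuous_comp_perm (d := d) σ
  have h4 := continuous_incrPath (d := d) (k := k)
  unfold historyWeight
  refine (continuous_const.mul (continuous_finsetProd _ fun j _ => ?_)).mul (Continuous.mul ?_ ?_)
  · have : Continuous fun x : (Fin k → E d) × (E d × E d) => Bhat B (x.1 j) :=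
      h1.comp (by fun_prop)
    exact (Complex.continuous_conj.comp this).mul this
  · exact Complex.continuous_conj.comp (h2.comp (h4.comp
      (Continuous.prodMk (by fun_prop) (h3.comp continuous_fst))))
  · exact h2.comp (h4.comp (Continuous.prodMk (by fun_prop) continuous_fst))

/-- Each time kernel is at most `t^k`, the simplex volume bound, and the factors `B̂` confine the
transfers to a ball. The momenta `z`, `z'` stay unrestricted, so their decay must come from the
amplitudes. -/
lemma norm_historyWeight_le (hd : 3 ≤ d) {B : SchwartzMap (E d) ℝ}
    (hB : HasCompactSupport (Bhat B)) (lam : ℝ) {t : ℝ} (ht : 0 ≤ t) (k : ℕ) :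
    ∃ C R, 0 ≤ C ∧ 0 ≤ R ∧ ∀ (σ : Equiv.Perm (Fin k)) (w : Fin k → E d) (z z' : E d),
      ‖historyWeight B lam t σ w z z'‖ ≤ C * ballIndicator k R w := by
  obtain ⟨R, hR, hRB⟩ := exists_radius_of_hasCompactSupport hB
  obtain ⟨b, hb⟩ := (continuous_Bhat B).bounded_above_of_compact_support hB
  have hb0 : 0 ≤ b := (norm_nonneg _).trans (hb 0)
  refine ⟨|lam| ^ (2 * k) * (b * b) ^ k * (t ^ k * t ^ k), R, by positivity, hR.le,
    fun σ w z z' => ?_⟩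
  unfold ballIndicator
  by_cases h : w ∈ Metric.closedBall (0 : Fin k → E d) R
  · rw [Set.indicator_of_mem h, mul_one]
    unfold historyWeight
    rw [norm_mul, norm_mul, norm_mul, norm_prod, RCLike.norm_conj, norm_pow, Complex.norm_real,
      Real.norm_eq_abs]
    gcongr
    · calc ∏ j, ‖conj (Bhat B (w j)) * Bhat B (w j)‖ ≤ ∏ _j : Fin k, b * b := by
            refine Finset.prod_le_prod (fun _ _ => norm_nonneg _) fun j _ => ?_
            rw [norm_mul, RCLike.norm_conj]
            exact mul_le_mul (hb _) (hb _) (norm_nonneg _) hb0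
        _ = (b * b) ^ k := by simp
    · exact norm_pathKernel_le hd B lam ht _
    · exact norm_pathKernel_le hd B lam ht _
  · rw [Set.indicator_of_notMem h, mul_zero]
    rw [mem_closedBall_zero_iff, pi_norm_le_iff_of_nonneg hR.le] at h
    push Not at h
    obtain ⟨j, hj⟩ := h
    have h0 : Bhat B (w j) = 0 := by
      by_contra h1
      exact absurd (hRB _ h1) (not_le.2 hj)
    have : ∏ i, (conj (Bhat B (w i)) * Bhat B (w i)) = 0 :=
      Finset.prod_eq_zero (Finset.mem_univ j) (by rw [h0, mul_zero])
    simp [historyWeight, this]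

end Majorants

/-! ### Initial amplitudes after the cutoff. -/

section Amplitude

variable {d : ℕ} {χ : ℝ → E d → ℝ}

/-- The Fourier transform of the initial state after the cutoff. -/
noncomputable def cutAmplitude (χ : ℝ → E d → ℝ) (ψ : SchwartzMap (E d) ℂ) (L : ℝ) (p : E d) : ℂ :=
  𝓕 (fun x => (χ L x : ℂ) * ψ x) p

lemma IsBoxCutoff.tendsto_cutAmplitude (hχ : IsBoxCutoff χ) (ψ : SchwartzMap (E d) ℂ) {p : ℝ → E d}
    {p₀ : E d} (hp : Tendsto p atTop (𝓝 p₀)) :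
    Tendsto (fun L => cutAmplitude χ ψ L (p L)) atTop (𝓝 (𝓕 (fun x => ψ x) p₀)) :=
  hχ.tendsto_fourier (f := fun _ x => ψ x) (fun _ => ψ.continuous) (ψ.integrable.norm)
    (fun _ _ => le_rfl) (fun _ => tendsto_const_nhds) hp

lemma IsBoxCutoff.boxFourier_eq_cutAmplitude (hχ : IsBoxCutoff χ) (ψ : SchwartzMap (E d) ℂ) {L : ℝ}
    (hL : 1 ≤ L) (p : E d) :
    boxFourier L (fun x => (χ L x : ℂ) * ψ x) p = cutAmplitude χ ψ L p :=
  hχ.boxFourier_eq_fourier _ hL p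

lemma IsBoxCutoff.summable_cutAmplitude (hχ : IsBoxCutoff χ) (ψ : SchwartzMap (E d) ℂ) {L : ℝ}
    (hL : 1 ≤ L) : Summable fun n => ‖cutAmplitude χ ψ L (dualPt L n)‖ :=
  hχ.summable_fourier ψ hL

lemma integrable_sq_schwartz (ψ : SchwartzMap (E d) ℂ) : Integrable fun x => ‖ψ x‖ ^ 2 := by
  obtain ⟨C, hC0, hC⟩ := exists_decay_bound ψ
  refine (integrable_decay.const_mul (C ^ 2)).mono' (ψ.continuous.norm.pow 2).aestronglyMeasurable
    (Eventually.of_forall fun x => ?_)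
  rw [Real.norm_of_nonneg (by positivity)]
  calc ‖ψ x‖ ^ 2 ≤ (C * decay x) ^ 2 := by gcongr; exact hC x
    _ = C ^ 2 * (decay x * decay x) := by ring
    _ ≤ C ^ 2 * (decay x * 1) := by
        gcongr
        · exact (decay_pos x).le
        · exact decay_le_one x
    _ = _ := by ring

lemma IsBoxCutoff.integrable_sq_cutoff (hχ : IsBoxCutoff χ) (ψ : SchwartzMap (E d) ℂ) {L : ℝ}
    (hL : 1 ≤ L) : Integrable fun x => ‖(χ L x : ℂ) * ψ x‖ ^ 2 := by
  obtain ⟨C, hC0, hC⟩ := hχ.exists_bound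
  have hc : Continuous fun x => (χ L x : ℂ) * ψ x :=
    (Complex.continuous_ofReal.comp (hχ.smooth L hL).continuous).mul ψ.continuous
  refine ((integrable_sq_schwartz ψ).const_mul (C ^ 2)).mono'
    (hc.norm.pow 2).aestronglyMeasurable (Eventually.of_forall fun x => ?_)
  rw [Real.norm_of_nonneg (by positivity), norm_mul, mul_pow, Complex.norm_real]
  gcongr
  exact hC L hL x

lemma IsBoxCutoff.tendsto_integral_sq_cutoff (hχ : IsBoxCutoff χ) (ψ : SchwartzMap (E d) ℂ) :
    Tendsto (fun L => ∫ x, ‖(χ L x : ℂ) * ψ x‖ ^ 2) atTop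
      (𝓝 (∫ p, ‖𝓕 (fun x => ψ x) p‖ ^ 2)) := by
  obtain ⟨C, hC0, hC⟩ := hχ.exists_bound
  have h : ∫ p, ‖𝓕 (fun x => ψ x) p‖ ^ 2 = ∫ x, ‖ψ x‖ ^ 2 := by
    have := SchwartzMap.integral_norm_sq_fourier ψ
    rwa [SchwartzMap.fourier_coe] at this
  rw [h]
  refine tendsto_integral_filter_of_dominated_convergence (fun x => C ^ 2 * ‖ψ x‖ ^ 2) ?_ ?_
    ((integrable_sq_schwartz ψ).const_mul (C ^ 2)) (Eventually.of_forall fun x => ?_)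
  · filter_upwards [eventually_ge_atTop 1] with L hL
    exact (hχ.integrable_sq_cutoff ψ hL).aestronglyMeasurable
  · filter_upwards [eventually_ge_atTop 1] with L hL
    refine Eventually.of_forall fun x => ?_
    rw [Real.norm_of_nonneg (by positivity), norm_mul, mul_pow, Complex.norm_real]
    gcongr
    exact hC L hL x
  · have h2 : Tendsto (fun L => (χ L x : ℂ)) atTop (𝓝 ((1 : ℝ) : ℂ)) :=
      (Complex.continuous_ofReal.tendsto _).comp (hχ.tendsto_one x)
    simpa using ((h2.mul_const (ψ x)).norm.pow 2)

/-- The integral is the lattice sum of squared coefficients, hence the box norm of the Fourier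
series, and Bessel applies. -/
lemma IsBoxCutoff.integral_sq_cutAmplitude_le (hχ : IsBoxCutoff χ) (ψ : SchwartzMap (E d) ℂ) {L : ℝ}
    (hL : 1 ≤ L) : Integrable (fun z => ‖cutAmplitude χ ψ L (roundPt L z)‖ ^ 2) ∧
      ∫ z, ‖cutAmplitude χ ψ L (roundPt L z)‖ ^ 2 ≤ ∫ x, ‖(χ L x : ℂ) * ψ x‖ ^ 2 := by
  have hL0 : 0 < L := by linarith
  have hs := hχ.summable_cutAmplitude ψ hL
  set a := fun n => cutAmplitude χ ψ L (dualPt L n) with ha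
  have hs2 : Summable fun n => ‖conj (a n) * a n‖ := by
    simp_rw [norm_mul, RCLike.norm_conj]
    exact hs.mul_norm hs |>.comp_injective (i := fun n => (n, n)) (fun m n h => by simpa using h)
      |>.congr fun n => by simp [ha]
  have hval : ∀ z : E d, ‖cutAmplitude χ ψ L (roundPt L z)‖ ^ 2 =
      (conj (a (cellIndex L⁻¹ z)) * a (cellIndex L⁻¹ z)).re := fun z => by
    rw [Complex.conj_mul', ← Complex.ofReal_pow, Complex.ofReal_re]
    rfl
  have hi := integrable_comp_of_fibers (μ := (volume : Measure (E d)))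
    (measurable_cellIndex L⁻¹) (volume_cellIndex_fiber hL0) hs2
  have hint := integral_comp_of_fibers (μ := (volume : Measure (E d))) (by positivity)
    (measurable_cellIndex L⁻¹) (volume_cellIndex_fiber hL0) hs2
  simp_rw [hval]
  refine ⟨hi.re, ?_⟩
  have hre : ∫ z : E d, (conj (a (cellIndex L⁻¹ z)) * a (cellIndex L⁻¹ z)).re =
      (∫ z : E d, conj (a (cellIndex L⁻¹ z)) * a (cellIndex L⁻¹ z)).re := integral_re hi
  rw [hre, hint]
  have hb := boxNormSq_synth hL0 hs
  push_cast
  rw [← hb, Complex.ofReal_re]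
  have hc : Continuous fun x => (χ L x : ℂ) * ψ x :=
    (Complex.continuous_ofReal.comp (hχ.smooth L hL).continuous).mul ψ.continuous
  refine (boxNormSq_synth_le hs hL0 hc fun n => hχ.boxFourier_eq_cutAmplitude ψ hL _).trans ?_
  exact setIntegral_le_integral (hχ.integrable_sq_cutoff ψ hL)
    (Eventually.of_forall fun x => by positivity)

lemma integrable_sq_fourier (ψ : SchwartzMap (E d) ℂ) :
    Integrable fun p => ‖𝓕 (fun x => ψ x) p‖ ^ 2 := by
  have := integrable_sq_schwartz (𝓕 ψ)
  rwa [SchwartzMap.fourier_coe] at this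

end Amplitude

end RandomSchrodinger

namespace RandomSchrodinger

/-! ### The limits of the lattice sums -/

/-! ### Fourier transform of the observable in the space variable. -/

section PhaseSpace

variable {d : ℕ} {χ : ℝ → E d → ℝ}

lemma continuous_phaseHat (O : SchwartzMap (E d × E d) ℂ) :
    Continuous fun y : E d × E d => phaseHat (fun z => O z) y.1 y.2 := by
  obtain ⟨C, hC0, hC⟩ := exists_decay_bound_prod O
  have hO := O.continuous
  unfold phaseHat
  simp only [Real.fourier_eq', smul_eq_mul]
  refine continuous_of_dominated (bound := fun x => C * decay x) (fun y => ?_) (fun y => ?_)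
    (integrable_decay.const_mul C) (Eventually.of_forall fun x => ?_)
  · exact Continuous.aestronglyMeasurable (by fun_prop)
  · refine Eventually.of_forall fun x => ?_
    rw [norm_mul, Complex.norm_exp_ofReal_mul_I, one_mul]
    refine (hC x y.2).trans ?_
    rw [← mul_assoc]
    exact mul_le_of_le_one_right (mul_nonneg hC0 (decay_pos x).le) (decay_le_one _)
  · fun_prop

lemma IsBoxCutoff.tendsto_phaseHat (hχ : IsBoxCutoff χ) (O : SchwartzMap (E d × E d) ℂ)
    {ξ v : ℝ → E d} {ξ₀ v₀ : E d} (hξ : Tendsto ξ atTop (𝓝 ξ₀)) (hv : Tendsto v atTop (𝓝 v₀)) :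
    Tendsto (fun L => phaseHat (fun z => (χ L z.1 : ℂ) * O z) (ξ L) (v L)) atTop
      (𝓝 (phaseHat (fun z => O z) ξ₀ v₀)) := by
  obtain ⟨C, hC0, hC⟩ := exists_decay_bound_prod O
  have hO := O.continuous
  refine hχ.tendsto_fourier (f := fun L x => O (x, v L)) (g := fun x => C * decay x)
    (fun L => by fun_prop) (integrable_decay.const_mul C) (fun L x => ?_) (fun x => ?_) hξ
  · refine (hC x (v L)).trans ?_
    rw [← mul_assoc]
    exact mul_le_of_le_one_right (mul_nonneg hC0 (decay_pos x).le) (decay_le_one _)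
  · exact (hO.tendsto _).comp (tendsto_const_nhds.prodMk_nhds hv)

/-- Only decay in `v` is retained, uniformly in `ξ` and `L`; decay in `ξ` would require control of
derivatives of the cutoff. -/
lemma IsBoxCutoff.norm_phaseHat_le (hχ : IsBoxCutoff χ) (O : SchwartzMap (E d × E d) ℂ) :
    ∃ C, 0 ≤ C ∧ ∀ L, 1 ≤ L → ∀ ξ v,
      ‖phaseHat (fun z => (χ L z.1 : ℂ) * O z) ξ v‖ ≤ C * decay v := by
  obtain ⟨C, hC0, hC⟩ := exists_decay_bound_prod O
  obtain ⟨D, hD0, hD⟩ := hχ.exists_bound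
  refine ⟨D * (C * ∫ x : E d, decay x), ?_, fun L hL ξ v => ?_⟩
  · have : 0 ≤ ∫ x : E d, decay x := integral_nonneg fun x => (decay_pos x).le
    positivity
  · refine (norm_fourier_cutoff_le hD (f := fun x => O (x, v)) (g := fun x => C * decay v * decay x)
      (integrable_decay.const_mul _) (fun x => (hC x v).trans_eq (by ring)) hL ξ).trans_eq ?_
    rw [integral_const_mul]
    ring

end PhaseSpace

section Limits

variable {d k : ℕ} {χ : ℝ → E d → ℝ} {B : SchwartzMap (E d) ℝ} {lam t : ℝ}

/-- The integrand of the squared norm. -/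
noncomputable def normDensity (B : SchwartzMap (E d) ℝ) (lam t : ℝ) (σ : Equiv.Perm (Fin k))
    (A : E d → ℂ) (x : (Fin k → E d) × E d) : ℂ :=
  historyWeight B lam t σ x.1 x.2 x.2 * (conj (A x.2) * A x.2)

/-- The integrand of the Wigner transform tested against an observable. -/
noncomputable def wignerDensity (B : SchwartzMap (E d) ℝ) (lam t ε : ℝ) (σ : Equiv.Perm (Fin k))
    (H : E d → E d → ℂ) (A : E d → ℂ) (x : (Fin k → E d) × (E d × E d)) : ℂ :=
  historyWeight B lam t σ x.1 x.2.1 x.2.2 *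
    (H (ε⁻¹ • ((x.2.1 + ∑ j, x.1 j) - (x.2.2 + ∑ j, x.1 j)))
      ((1 / 2 : ℝ) • ((x.2.1 + ∑ j, x.1 j) + (x.2.2 + ∑ j, x.1 j))) *
      (conj (A x.2.1) * A x.2.2))

/-- Rounding of all momentum transfers. -/
noncomputable def roundPts (L : ℝ) (w : Fin k → E d) : Fin k → E d := fun j => roundPt L (w j)

lemma tendsto_roundPts (w : Fin k → E d) :
    Tendsto (fun L : ℝ => roundPts L w) atTop (𝓝 w) :=
  tendsto_pi_nhds.2 fun j => tendsto_roundPt (w j)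

lemma tendsto_max_one : Tendsto (fun L : ℝ => max L 1) atTop atTop :=
  tendsto_atTop_mono (fun L => le_max_left L 1) tendsto_id

lemma tendsto_historyWeight (hd : 3 ≤ d) (σ : Equiv.Perm (Fin k)) {w : ℝ → Fin k → E d}
    {z z' : ℝ → E d} {w₀ : Fin k → E d} {z₀ z₀' : E d} (hw : Tendsto w atTop (𝓝 w₀))
    (hz : Tendsto z atTop (𝓝 z₀)) (hz' : Tendsto z' atTop (𝓝 z₀')) :
    Tendsto (fun L => historyWeight B lam t σ (w L) (z L) (z' L)) atTop
      (𝓝 (historyWeight B lam t σ w₀ z₀ z₀')) := by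
  have h1 := hw.prodMk_nhds (hz.prodMk_nhds hz')
  have h2 := (continuous_historyWeight hd B lam t σ).tendsto (w₀, (z₀, z₀'))
  have h3 := Tendsto.comp h2 h1
  exact h3

/-- The integrand converges pointwise. Its majorant is a product of a fixed ball indicator and the
rounded squared amplitude, the latter controlled by Bessel. -/
lemma tendsto_integral_normDensity (hd : 3 ≤ d) (hB : HasCompactSupport (Bhat B)) (ht : 0 ≤ t)
    (hχ : IsBoxCutoff χ) (ψ : SchwartzMap (E d) ℂ) (σ : Equiv.Perm (Fin k)) :
    Tendsto (fun L => ∫ x : (Fin k → E d) × E d,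
        normDensity B lam t σ (cutAmplitude χ ψ L) (roundPts L x.1, roundPt L x.2)) atTop
      (𝓝 (∫ x, normDensity B lam t σ (𝓕 (fun x => ψ x)) x)) := by
  obtain ⟨C, R, hC0, hR0, hC⟩ := norm_historyWeight_le hd hB lam ht k
  have hψc : Continuous (𝓕 (fun x => ψ x)) := by
    rw [← SchwartzMap.fourier_coe]; exact (𝓕 ψ).continuous
  have hH := continuous_historyWeight hd B lam t σ
  have key := tendsto_integral_of_varying_bound (μ := (volume : Measure ((Fin k → E d) × E d)))
    (l := (atTop : Filter ℝ))
    -- `max L 1` makes the bounds valid for every index; the limit only sees `L ≥ 1`.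
    (F := fun L x => normDensity B lam t σ (cutAmplitude χ ψ (max L 1))
      (roundPts (max L 1) x.1, roundPt (max L 1) x.2))
    (f := normDensity B lam t σ (𝓕 (fun x => ψ x)))
    (G := fun L x => (C * ballIndicator k (R + d) x.1) *
      ‖cutAmplitude χ ψ (max L 1) (roundPt (max L 1) x.2)‖ ^ 2)
    (g := fun x => (C * ballIndicator k (R + d) x.1) * ‖𝓕 (fun x => ψ x) x.2‖ ^ 2)
    (A := fun L => (∫ w : Fin k → E d, C * ballIndicator k (R + d) w) *
      ∫ x, ‖(χ (max L 1) x : ℂ) * ψ x‖ ^ 2)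
    ?_ ?_ ?_ ?_ ?_ ?_ ?_ ?_ ?_
  · refine key.2.congr' ?_
    filter_upwards [eventually_ge_atTop 1] with L hL
    rw [max_eq_left hL]
  · intro L
    have hm : Measurable fun x : (Fin k → E d) × E d =>
        (((fun i => cellIndex (max L 1)⁻¹ (x.1 i)), cellIndex (max L 1)⁻¹ x.2) :
          (Fin k → Fin d → ℤ) × (Fin d → ℤ)) :=
      ((measurable_cellIndex_comp k _).comp measurable_fst).prodMk
        ((measurable_cellIndex _).comp measurable_snd)
    exact ((measurable_of_countable fun n : (Fin k → Fin d → ℤ) × (Fin d → ℤ) =>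
      normDensity B lam t σ (cutAmplitude χ ψ (max L 1))
      ((fun j => dualPt (max L 1) (n.1 j)), dualPt (max L 1) n.2)).comp hm).aestronglyMeasurable
  · refine Continuous.aestronglyMeasurable ?_
    unfold normDensity
    refine Continuous.mul (hH.comp (f := fun x : (Fin k → E d) × E d => (x.1, (x.2, x.2)))
      (by fun_prop)) ?_
    exact (Complex.continuous_conj.comp (hψc.comp continuous_snd)).mul (hψc.comp continuous_snd)
  · intro L x
    unfold normDensity
    have h1 : ‖conj (cutAmplitude χ ψ (max L 1) (roundPt (max L 1) x.2)) *
        cutAmplitude χ ψ (max L 1) (roundPt (max L 1) x.2)‖ =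
        ‖cutAmplitude χ ψ (max L 1) (roundPt (max L 1) x.2)‖ ^ 2 := by
      rw [norm_mul, RCLike.norm_conj, sq]
    rw [norm_mul, h1]
    refine mul_le_mul_of_nonneg_right ((hC σ _ _ _).trans ?_) (by positivity)
    exact mul_le_mul_of_nonneg_left (ballIndicator_roundPt_le (le_max_right L 1) x.1) hC0
  · intro L
    exact ((integrable_ballIndicator (R + d)).const_mul C).mul_prod
      (hχ.integral_sq_cutAmplitude_le ψ (le_max_right L 1)).1
  · exact ((integrable_ballIndicator (R + d)).const_mul C).mul_prod (integrable_sq_fourier ψ)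
  · intro x
    have h1 := tendsto_historyWeight (B := B) (lam := lam) (t := t) hd σ (tendsto_roundPts x.1)
      (tendsto_roundPt x.2) (tendsto_roundPt x.2)
    have h2 := hχ.tendsto_cutAmplitude ψ (tendsto_roundPt x.2)
    have h3 : Tendsto (fun L => normDensity B lam t σ (cutAmplitude χ ψ L)
        (roundPts L x.1, roundPt L x.2)) atTop (𝓝 (normDensity B lam t σ (𝓕 (fun x => ψ x)) x)) := by
      unfold normDensity
      exact h1.mul (((Complex.continuous_conj.tendsto _).comp h2).mul h2)
    exact h3.comp tendsto_max_one
  · intro x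
    have h2 := hχ.tendsto_cutAmplitude ψ (tendsto_roundPt x.2)
    exact ((h2.norm.pow 2).const_mul _).comp tendsto_max_one
  · intro L
    beta_reduce
    rw [Measure.volume_eq_prod, integral_prod_mul (fun w => C * ballIndicator k (R + d) w)
      (fun z => ‖cutAmplitude χ ψ (max L 1) (roundPt (max L 1) z)‖ ^ 2)]
    refine mul_le_mul_of_nonneg_left
      (hχ.integral_sq_cutAmplitude_le ψ (le_max_right L 1)).2 ?_
    exact integral_nonneg fun w => mul_nonneg hC0 (ballIndicator_nonneg _ _)
  · rw [Measure.volume_eq_prod, integral_prod_mul (fun w => C * ballIndicator k (R + d) w)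
      (fun z => ‖𝓕 (fun x => ψ x) z‖ ^ 2)]
    exact ((hχ.tendsto_integral_sq_cutoff ψ).const_mul _).comp tendsto_max_one

/-- With `y` the half-sum, `z + z'` equals `2y - 2∑w` minus two rounding errors; `‖∑w‖ ≤ kR` and
each error is at most `d`, which gives the constant. -/
lemma one_add_norm_add_le {L R : ℝ} (hL : 1 ≤ L) (hR : 0 ≤ R) {w : Fin k → E d}
    (hw : w ∈ Metric.closedBall (0 : Fin k → E d) R) (z z' : E d) :
    1 + ‖z + z'‖ ≤ (3 + 2 * (d + k * R)) * (1 + ‖(1 / 2 : ℝ) •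
      ((roundPt L z + ∑ j, w j) + (roundPt L z' + ∑ j, w j))‖) := by
  rw [mem_closedBall_zero_iff, pi_norm_le_iff_of_nonneg hR] at hw
  set s := ∑ j, w j with hs
  have hsn : ‖s‖ ≤ k * R := by
    refine (norm_sum_le _ _).trans ((Finset.sum_le_sum fun j _ => hw j).trans_eq ?_)
    simp
  set y := (1 / 2 : ℝ) • ((roundPt L z + s) + (roundPt L z' + s)) with hy
  have h1 : z + z' = (2 : ℝ) • y - (2 : ℝ) • s - (roundPt L z - z) - (roundPt L z' - z') := by
    rw [hy, smul_smul]
    norm_num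
    rw [two_smul]
    abel
  have h2 : ‖z + z'‖ ≤ 2 * ‖y‖ + 2 * ‖s‖ + ‖roundPt L z - z‖ + ‖roundPt L z' - z'‖ := by
    rw [h1]
    refine (norm_sub_le _ _).trans (add_le_add_left ((norm_sub_le _ _).trans
      (add_le_add_left ((norm_sub_le _ _).trans ?_) _)) _)
    rw [norm_smul (2 : ℝ) y, norm_smul (2 : ℝ) s, Real.norm_eq_abs, abs_of_pos two_pos]
  have h3 := norm_roundPt_sub_le_of_one_le hL z
  have h4 := norm_roundPt_sub_le_of_one_le hL z'
  have h5 : 0 ≤ (d + k * R : ℝ) * ‖y‖ := by positivity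
  have h6 := norm_nonneg y
  nlinarith

/-- The two initial momenta are now independent. `|ab| ≤ |a|² + |b|²` leaves a square in one of
them, and the decay of the observable in `z + z'` makes the other integrable. -/
lemma tendsto_integral_wignerDensity (hd : 3 ≤ d) (hB : HasCompactSupport (Bhat B)) (ht : 0 ≤ t)
    (hχ : IsBoxCutoff χ) (ψ : SchwartzMap (E d) ℂ) (ε : ℝ) (O : SchwartzMap (E d × E d) ℂ)
    (σ : Equiv.Perm (Fin k)) :
    Integrable (wignerDensity B lam t ε σ (phaseHat fun z => O z) (𝓕 (fun x => ψ x))) ∧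
    Tendsto (fun L => ∫ x : (Fin k → E d) × (E d × E d),
        wignerDensity B lam t ε σ (phaseHat fun z => (χ L z.1 : ℂ) * O z) (cutAmplitude χ ψ L)
          (roundPts L x.1, (roundPt L x.2.1, roundPt L x.2.2))) atTop
      (𝓝 (∫ x, wignerDensity B lam t ε σ (phaseHat fun z => O z) (𝓕 (fun x => ψ x)) x)) := by
  obtain ⟨C, R, hC0, hR0, hC⟩ := norm_historyWeight_le hd hB lam ht k
  obtain ⟨D, hD0, hD⟩ := hχ.norm_phaseHat_le O
  set c : ℝ := (3 + 2 * (d + k * R)) ^ (d + 1) with hc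
  have hc0 : 0 ≤ c := by positivity
  have hψc : Continuous (𝓕 (fun x => ψ x)) := by
    rw [← SchwartzMap.fourier_coe]; exact (𝓕 ψ).continuous
  have hH := continuous_historyWeight hd B lam t σ
  have hO := continuous_phaseHat O
  have hI : ∀ u : E d → ℝ, Integrable u →
      Integrable (fun y : E d × E d => decay (y.1 + y.2) * u y.1 + decay (y.1 + y.2) * u y.2) ∧
      ∫ y : E d × E d, (decay (y.1 + y.2) * u y.1 + decay (y.1 + y.2) * u y.2) =
        (2 * ∫ x : E d, decay x) * ∫ x, u x := fun u hu => by
    obtain ⟨h1, h2⟩ := integral_decay_add_mul_fst hu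
    obtain ⟨h3, h4⟩ := integral_decay_add_mul_snd hu
    refine ⟨h1.add h3, ?_⟩
    rw [integral_add h1 h3, h2, h4]
    ring
  set J : (Fin k → E d) → ℝ := fun w => C * (D * c) * ballIndicator k (R + d) w with hJ
  have hJi : Integrable J := (integrable_ballIndicator (R + d)).const_mul _
  have hJ0 : ∀ w, 0 ≤ J w := fun w => by
    have := ballIndicator_nonneg (R + d) w
    positivity
  have key := tendsto_integral_of_varying_bound
    (μ := (volume : Measure ((Fin k → E d) × (E d × E d))))
    (l := (atTop : Filter ℝ))
    (F := fun L x => wignerDensity B lam t ε σ (phaseHat fun z => (χ (max L 1) z.1 : ℂ) * O z)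
      (cutAmplitude χ ψ (max L 1))
      (roundPts (max L 1) x.1, (roundPt (max L 1) x.2.1, roundPt (max L 1) x.2.2)))
    (f := wignerDensity B lam t ε σ (phaseHat fun z => O z) (𝓕 (fun x => ψ x)))
    (G := fun L x => J x.1 * (decay (x.2.1 + x.2.2) *
        ‖cutAmplitude χ ψ (max L 1) (roundPt (max L 1) x.2.1)‖ ^ 2 + decay (x.2.1 + x.2.2) *
        ‖cutAmplitude χ ψ (max L 1) (roundPt (max L 1) x.2.2)‖ ^ 2))
    (g := fun x => J x.1 * (decay (x.2.1 + x.2.2) * ‖𝓕 (fun x => ψ x) x.2.1‖ ^ 2 +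
        decay (x.2.1 + x.2.2) * ‖𝓕 (fun x => ψ x) x.2.2‖ ^ 2))
    (A := fun L => (∫ w, J w) * ((2 * ∫ x : E d, decay x) *
      ∫ x, ‖(χ (max L 1) x : ℂ) * ψ x‖ ^ 2))
    ?_ ?_ ?_ ?_ ?_ ?_ ?_ ?_ ?_
  · refine ⟨key.1, key.2.congr' ?_⟩
    filter_upwards [eventually_ge_atTop 1] with L hL
    rw [max_eq_left hL]
  · intro L
    have hm : Measurable fun x : (Fin k → E d) × (E d × E d) =>
        (((fun i => cellIndex (max L 1)⁻¹ (x.1 i)),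
          (cellIndex (max L 1)⁻¹ x.2.1, cellIndex (max L 1)⁻¹ x.2.2)) :
          (Fin k → Fin d → ℤ) × ((Fin d → ℤ) × (Fin d → ℤ))) :=
      ((measurable_cellIndex_comp k _).comp measurable_fst).prodMk
        (((measurable_cellIndex _).comp (measurable_fst.comp measurable_snd)).prodMk
          ((measurable_cellIndex _).comp (measurable_snd.comp measurable_snd)))
    exact ((measurable_of_countable fun n : (Fin k → Fin d → ℤ) × ((Fin d → ℤ) × (Fin d → ℤ)) =>
      wignerDensity B lam t ε σ (phaseHat fun z => (χ (max L 1) z.1 : ℂ) * O z)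
      (cutAmplitude χ ψ (max L 1))
      ((fun j => dualPt (max L 1) (n.1 j)),
        (dualPt (max L 1) n.2.1, dualPt (max L 1) n.2.2))).comp hm).aestronglyMeasurable
  · refine Continuous.aestronglyMeasurable ?_
    unfold wignerDensity
    refine hH.mul (Continuous.mul ?_ ?_)
    · exact hO.comp (f := fun x : (Fin k → E d) × (E d × E d) =>
        (ε⁻¹ • ((x.2.1 + ∑ j, x.1 j) - (x.2.2 + ∑ j, x.1 j)),
          (1 / 2 : ℝ) • ((x.2.1 + ∑ j, x.1 j) + (x.2.2 + ∑ j, x.1 j)))) (by fun_prop)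
    · exact (Complex.continuous_conj.comp (hψc.comp (continuous_fst.comp continuous_snd))).mul
        (hψc.comp (continuous_snd.comp continuous_snd))
  · intro L x
    unfold wignerDensity
    have hL : 1 ≤ max L 1 := le_max_right L 1
    set L' := max L 1
    rw [norm_mul]
    set w := roundPts L' x.1
    set a := cutAmplitude χ ψ L' (roundPt L' x.2.1)
    set b := cutAmplitude χ ψ L' (roundPt L' x.2.2)
    have hab : ‖conj a * b‖ ≤ ‖a‖ ^ 2 + ‖b‖ ^ 2 := by
      rw [norm_mul, RCLike.norm_conj]
      nlinarith [sq_nonneg (‖a‖ - ‖b‖), sq_nonneg ‖a‖, sq_nonneg ‖b‖]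
    -- The comparison of `decay` at the half-sum with `decay` at `z + z'` needs bounded transfers;
    -- outside the ball the history weight vanishes.
    by_cases hw : w ∈ Metric.closedBall (0 : Fin k → E d) R
    · have h1 := hC σ w (roundPt L' x.2.1) (roundPt L' x.2.2)
      have h1' : C * ballIndicator k R w ≤ C * ballIndicator k (R + d) x.1 :=
        mul_le_mul_of_nonneg_left (ballIndicator_roundPt_le hL x.1) hC0
      have h2 : ∀ ξ, ‖phaseHat (fun z => (χ L' z.1 : ℂ) * O z) ξ ((1 / 2 : ℝ) •
          ((roundPt L' x.2.1 + ∑ j, w j) + (roundPt L' x.2.2 + ∑ j, w j)))‖ ≤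
          D * c * decay (x.2.1 + x.2.2) := fun ξ => by
        refine (hD L' hL _ _).trans ?_
        rw [mul_assoc]
        exact mul_le_mul_of_nonneg_left
          (decay_le_mul (one_add_norm_add_le hL hR0 hw x.2.1 x.2.2)) hD0
      rw [norm_mul]
      have hdec := (decay_pos (x.2.1 + x.2.2)).le
      have hball := ballIndicator_nonneg (R + d) x.1
      calc _ ≤ (C * ballIndicator k (R + d) x.1) * ((D * c * decay (x.2.1 + x.2.2)) *
            (‖a‖ ^ 2 + ‖b‖ ^ 2)) := by
            refine mul_le_mul (h1.trans h1') ?_ (by positivity) (by positivity)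
            exact mul_le_mul (h2 _) hab (norm_nonneg _) (by positivity)
        _ = _ := by rw [hJ]; ring
    · have h0 : historyWeight B lam t σ w (roundPt L' x.2.1) (roundPt L' x.2.2) = 0 := by
        have := hC σ w (roundPt L' x.2.1) (roundPt L' x.2.2)
        rw [ballIndicator, Set.indicator_of_notMem hw, mul_zero] at this
        exact norm_le_zero_iff.1 this
      rw [h0, norm_zero, zero_mul]
      have hdec := (decay_pos (x.2.1 + x.2.2)).le
      have := hJ0 x.1
      positivity
  · intro L
    exact hJi.mul_prod (hI _ (hχ.integral_sq_cutAmplitude_le ψ (le_max_right L 1)).1).1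
  · exact hJi.mul_prod (hI _ (integrable_sq_fourier ψ)).1
  · intro x
    have hx1 := tendsto_roundPts (d := d) x.1
    have hx2 := tendsto_roundPt x.2.1
    have hx3 := tendsto_roundPt x.2.2
    have hsum : Tendsto (fun L => ∑ j, roundPts L x.1 j) atTop (𝓝 (∑ j, x.1 j)) :=
      tendsto_finsetSum _ fun j _ => (tendsto_pi_nhds.1 hx1) j
    have h1 := tendsto_historyWeight (B := B) (lam := lam) (t := t) hd σ hx1 hx2 hx3
    have h2 := hχ.tendsto_cutAmplitude ψ hx2
    have h3 := hχ.tendsto_cutAmplitude ψ hx3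
    have h4 := hχ.tendsto_phaseHat O (((hx2.add hsum).sub (hx3.add hsum)).const_smul ε⁻¹)
      (((hx2.add hsum).add (hx3.add hsum)).const_smul (1 / 2 : ℝ))
    have h5 : Tendsto (fun L => wignerDensity B lam t ε σ (phaseHat fun z => (χ L z.1 : ℂ) * O z)
        (cutAmplitude χ ψ L) (roundPts L x.1, (roundPt L x.2.1, roundPt L x.2.2))) atTop
        (𝓝 (wignerDensity B lam t ε σ (phaseHat fun z => O z) (𝓕 (fun x => ψ x)) x)) := by
      unfold wignerDensity
      exact h1.mul (h4.mul (((Complex.continuous_conj.tendsto _).comp h2).mul h3))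
    exact h5.comp tendsto_max_one
  · intro x
    have h2 := hχ.tendsto_cutAmplitude ψ (tendsto_roundPt x.2.1)
    have h3 := hχ.tendsto_cutAmplitude ψ (tendsto_roundPt x.2.2)
    exact ((((h2.norm.pow 2).const_mul _).add ((h3.norm.pow 2).const_mul _)).const_mul _).comp
      tendsto_max_one
  · intro L
    have h := hχ.integral_sq_cutAmplitude_le ψ (le_max_right L 1)
    have h2 := (hI _ h.1).2
    beta_reduce
    rw [Measure.volume_eq_prod (Fin k → E d) (E d × E d), integral_prod_mul J
      (fun y : E d × E d => decay (y.1 + y.2) *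
        ‖cutAmplitude χ ψ (max L 1) (roundPt (max L 1) y.1)‖ ^ 2 + decay (y.1 + y.2) *
        ‖cutAmplitude χ ψ (max L 1) (roundPt (max L 1) y.2)‖ ^ 2), h2]
    refine mul_le_mul_of_nonneg_left (mul_le_mul_of_nonneg_left h.2 ?_)
      (integral_nonneg hJ0)
    exact mul_nonneg zero_le_two (integral_nonneg fun x => (decay_pos x).le)
  · rw [Measure.volume_eq_prod (Fin k → E d) (E d × E d), integral_prod_mul J
      (fun y : E d × E d => decay (y.1 + y.2) * ‖𝓕 (fun x => ψ x) y.1‖ ^ 2 +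
        decay (y.1 + y.2) * ‖𝓕 (fun x => ψ x) y.2‖ ^ 2), (hI _ (integrable_sq_fourier ψ)).2]
    exact (((hχ.tendsto_integral_sq_cutoff ψ).const_mul _).const_mul _).comp tendsto_max_one

end Limits

end RandomSchrodinger

namespace RandomSchrodinger

/-! ### Expectations in the box as integrals of rounded densities -/

section FiniteBox

variable {d k : ℕ} {χ : ℝ → E d → ℝ} {B : SchwartzMap (E d) ℝ} {lam t L : ℝ}
  {Pv : Measure ℝ} [IsProbabilityMeasure Pv]

lemma exists_finset_Bhat_dualPt (hB : HasCompactSupport (Bhat B)) (hL : 0 < L) :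
    ∃ S : Finset (Fin d → ℤ), ∀ m ∉ S, Bhat B (dualPt L m) = 0 := by
  obtain ⟨R, hR, hRB⟩ := exists_radius_of_hasCompactSupport hB
  refine ⟨Finset.Icc (fun _ => -⌈R * L⌉) (fun _ => ⌈R * L⌉), fun m hm => ?_⟩
  by_contra h
  refine hm (Finset.mem_Icc.2 ?_)
  have h1 : ∀ i, |(m i : ℝ)| ≤ R * L := fun i => by
    have h2 := (PiLp.norm_apply_le (dualPt L m) i).trans (hRB _ h)
    rw [dualPt_apply, norm_div, Real.norm_eq_abs, Real.norm_eq_abs, abs_of_pos hL,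
      div_le_iff₀ hL] at h2
    exact h2
  refine ⟨fun i => ?_, fun i => ?_⟩
  · have := (abs_le.1 (h1 i)).1.trans' (neg_le_neg (Int.le_ceil (R * L)))
    exact_mod_cast this
  · have := (abs_le.1 (h1 i)).2.trans (Int.le_ceil (R * L))
    exact_mod_cast this

lemma historyWeight_eq_zero {w : Fin k → E d} {j : Fin k} (h : Bhat B (w j) = 0)
    (σ : Equiv.Perm (Fin k)) (z z' : E d) : historyWeight B lam t σ w z z' = 0 := by
  have : ∏ i, (conj (Bhat B (w i)) * Bhat B (w i)) = 0 :=
    Finset.prod_eq_zero (Finset.mem_univ j) (by rw [h, mul_zero])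
  simp [historyWeight, this]

lemma historyWeight_dualPt_eq_zero {S : Finset (Fin d → ℤ)}
    (hS : ∀ m ∉ S, Bhat B (dualPt L m) = 0) {m : Fin k → Fin d → ℤ}
    (hm : m ∉ Fintype.piFinset fun _ => S) (σ : Equiv.Perm (Fin k)) (z z' : E d) :
    historyWeight B lam t σ (fun j => dualPt L (m j)) z z' = 0 := by
  rw [Fintype.mem_piFinset] at hm
  push Not at hm
  obtain ⟨j, hj⟩ := hm
  exact historyWeight_eq_zero (w := fun j => dualPt L (m j)) (hS _ hj) σ z z'

/-- An exact identity at finite `L`: Parseval, the expectation of the quadratic form, and the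
reading of the lattice sum as an integral over cells. -/
lemma expectation_boxNormSq (hd : 3 ≤ d) (hB : HasCompactSupport (Bhat B)) (ht : 0 ≤ t)
    (hχ : IsBoxCutoff χ) (ψ : SchwartzMap (E d) ℂ) (hm1 : ∫ v, v ∂Pv = 0)
    (hm2 : ∫ v, v ^ 2 ∂Pv = 1) (hL1 : 1 ≤ L) (k : ℕ) :
    Integrable (fun ω => boxNormSq L (psiNR B lam L t k (fun x => (χ L x : ℂ) * ψ x) ω))
      (configLaw d L Pv) ∧
    ((∫ ω, boxNormSq L (psiNR B lam L t k (fun x => (χ L x : ℂ) * ψ x) ω)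
      ∂(configLaw d L Pv) : ℝ) : ℂ) = ∑ σ : Equiv.Perm (Fin k), ∫ x : (Fin k → E d) × E d,
        normDensity B lam t σ (cutAmplitude χ ψ L) (roundPts L x.1, roundPt L x.2) := by
  have hL : 0 < L := by linarith
  obtain ⟨S, hS⟩ := exists_finset_Bhat_dualPt hB hL
  obtain ⟨C, R, hC0, hR0, hC⟩ := norm_historyWeight_le hd hB lam ht k
  have ha := hχ.summable_cutAmplitude ψ hL1
  have hψ : ∀ ω : Config d, psiNR B lam L t k (fun x => (χ L x : ℂ) * ψ x) ω =
      synth L (waveCoeff B lam L S (fun n => cutAmplitude χ ψ L (dualPt L n)) t k ω) :=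
    psiNR_eq_synth hd hL hS ha (fun n => hχ.boxFourier_eq_cutAmplitude ψ hL1 _) ht k
  have hns : ∀ ω : Config d,
      (boxNormSq L (psiNR B lam L t k (fun x => (χ L x : ℂ) * ψ x) ω) : ℂ) =
      ∑' n, ((L : ℂ) ^ d)⁻¹ *
        (conj (waveCoeff B lam L S (fun n => cutAmplitude χ ψ L (dualPt L n)) t k ω n) *
        waveCoeff B lam L S (fun n => cutAmplitude χ ψ L (dualPt L n)) t k ω n) := fun ω => by
    rw [hψ, boxNormSq_synth hL (summable_waveCoeff hd ha ht k ω), tsum_mul_left]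
  have hdiag : ∀ b c : (Fin d → ℤ) → ℂ, (Summable fun n => ‖b n‖) → (Summable fun n => ‖c n‖) →
      Summable fun n => ‖conj (b n) * c n‖ := fun b c hb hc => by
    refine ((hb.mul_norm hc).comp_injective (i := fun n => (n, n)) fun m n h => by
      simpa using h).congr fun n => ?_
    simp
  obtain ⟨h1, h2⟩ := expectation_quadratic (Pv := Pv) (B := B) (lam := lam) (S := S) (t := t)
    (k := k) (a := fun n => cutAmplitude χ ψ L (dualPt L n)) hL hm1 hm2
    (fun _ : Fin d → ℤ => ((L : ℂ) ^ d)⁻¹) id id (fun m m' =>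
      ((hdiag _ _ (summable_collisionCoeff hd ha ht m)
        (summable_collisionCoeff hd ha ht m')).of_norm.mul_left _))
  simp only [id] at h1 h2
  simp_rw [← hns] at h1 h2
  refine ⟨by simpa using h1.re, ?_⟩
  rw [integral_complex_ofReal] at h2
  rw [h2]
  refine Finset.sum_congr rfl fun σ _ => ?_
  have hlat := integral_lattice_prod (k := k) hL S (Y := E d) (c := (L ^ d)⁻¹) (by positivity)
    (measurable_cellIndex L⁻¹) (volume_cellIndex_fiber hL)
    (Φ := fun n => normDensity B lam t σ (cutAmplitude χ ψ L)
      ((fun j => dualPt L (n.1 j)), dualPt L n.2)) ?_ ?_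
  · refine Eq.trans ?_ hlat.symm
    rw [Finset.mul_sum]
    refine Finset.sum_congr rfl fun m _ => ?_
    -- Parseval sums over final momenta; the shift passes to the initial ones.
    rw [← (Equiv.addRight (∑ i, m i)).tsum_eq, ← tsum_mul_left]
    refine tsum_congr fun n => ?_
    rw [Equiv.coe_addRight, conj_collisionCoeff_mul hL]
    unfold normDensity
    push_cast
    ring
  · intro m hm n
    simp only [normDensity]
    rw [historyWeight_dualPt_eq_zero hS hm, zero_mul]
  · intro m
    refine Summable.of_nonneg_of_le (fun _ => norm_nonneg _) (fun n => ?_)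
      ((hdiag _ _ ha ha).mul_left (C * ballIndicator k R fun j => dualPt L (m j)))
    simp only [normDensity]
    rw [norm_mul]
    exact mul_le_mul_of_nonneg_right (hC σ _ _ _) (norm_nonneg _)

/-- In the variables `ξ`, `v` of the pairing, `v ± εξ/2` are again the two lattice momenta. -/
lemma conj_wignerHat {ε : ℝ} (hε : 0 < ε) (f : E d → ℂ) (p q : E d) :
    conj (wignerHat ε f (ε⁻¹ • (p - q)) ((1 / 2 : ℝ) • (p + q))) = conj (f p) * f q := by
  have h : (ε / 2) • ε⁻¹ • (p - q) = (1 / 2 : ℝ) • (p - q) := by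
    rw [smul_smul]; congr 1; field_simp
  have h1 : (1 / 2 : ℝ) • (p + q) - (1 / 2 : ℝ) • (p - q) = q := by module
  have h2 : (1 / 2 : ℝ) • (p + q) + (1 / 2 : ℝ) • (p - q) = p := by module
  rw [wignerHat, h, h1, h2, map_mul, Complex.conj_conj, mul_comm]

lemma expectation_wignerPairing (hd : 3 ≤ d) (hB : HasCompactSupport (Bhat B)) (ht : 0 ≤ t)
    (hχ : IsBoxCutoff χ) (ψ : SchwartzMap (E d) ℂ) (hm1 : ∫ v, v ∂Pv = 0)
    (hm2 : ∫ v, v ^ 2 ∂Pv = 1) (hL1 : 1 ≤ L) (k : ℕ) {ε : ℝ} (hε : 0 < ε)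
    (O : SchwartzMap (E d × E d) ℂ) :
    Integrable (fun ω => wignerPairing L ε (fun z => (χ L z.1 : ℂ) * O z)
      (psiNR B lam L t k (fun x => (χ L x : ℂ) * ψ x) ω)) (configLaw d L Pv) ∧
    ∫ ω, wignerPairing L ε (fun z => (χ L z.1 : ℂ) * O z)
      (psiNR B lam L t k (fun x => (χ L x : ℂ) * ψ x) ω) ∂(configLaw d L Pv) =
      ((ε : ℂ) ^ d)⁻¹ * ∑ σ : Equiv.Perm (Fin k), ∫ x : (Fin k → E d) × (E d × E d),
        wignerDensity B lam t ε σ (phaseHat fun z => (χ L z.1 : ℂ) * O z) (cutAmplitude χ ψ L)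
          (roundPts L x.1, (roundPt L x.2.1, roundPt L x.2.2)) := by
  have hL : 0 < L := by linarith
  obtain ⟨S, hS⟩ := exists_finset_Bhat_dualPt hB hL
  obtain ⟨C, R, hC0, hR0, hC⟩ := norm_historyWeight_le hd hB lam ht k
  obtain ⟨D, hD0, hD⟩ := hχ.norm_phaseHat_le O
  have hDb : ∀ ξ v, ‖phaseHat (fun z => (χ L z.1 : ℂ) * O z) ξ v‖ ≤ D := fun ξ v =>
    (hD L hL1 ξ v).trans (mul_le_of_le_one_right hD0 (decay_le_one v))
  have ha := hχ.summable_cutAmplitude ψ hL1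
  set a : (Fin d → ℤ) → ℂ := fun n => cutAmplitude χ ψ L (dualPt L n) with hadef
  set H : (Fin d → ℤ) × (Fin d → ℤ) → ℂ := fun n =>
    phaseHat (fun z => (χ L z.1 : ℂ) * O z) (ε⁻¹ • (dualPt L n.1 - dualPt L n.2))
        ((1 / 2 : ℝ) • (dualPt L n.1 + dualPt L n.2)) with hHdef
  have hψ : ∀ ω : Config d, psiNR B lam L t k (fun x => (χ L x : ℂ) * ψ x) ω =
      synth L (waveCoeff B lam L S a t k ω) :=
    psiNR_eq_synth hd hL hS ha (fun n => hχ.boxFourier_eq_cutAmplitude ψ hL1 _) ht k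
  have hns : ∀ ω : Config d, wignerPairing L ε (fun z => (χ L z.1 : ℂ) * O z)
      (psiNR B lam L t k (fun x => (χ L x : ℂ) * ψ x) ω) =
      ((ε : ℂ) ^ d)⁻¹ * ∑' n, (((L : ℂ) ^ d)⁻¹ ^ 2 * H n) *
        (conj (waveCoeff B lam L S a t k ω n.1) * waveCoeff B lam L S a t k ω n.2) := fun ω => by
    unfold wignerPairing
    rw [← tsum_mul_left]
    congr 1
    refine tsum_congr fun n => ?_
    rw [hψ, conj_wignerHat hε, boxFourier_synth hL (summable_waveCoeff hd ha ht k ω),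
      boxFourier_synth hL (summable_waveCoeff hd ha ht k ω), mul_assoc]
  have hoff : ∀ b c : (Fin d → ℤ) → ℂ, (Summable fun n => ‖b n‖) → (Summable fun n => ‖c n‖) →
      Summable fun n : (Fin d → ℤ) × (Fin d → ℤ) => ‖conj (b n.1) * c n.2‖ := fun b c hb hc => by
    refine (hb.mul_norm hc).congr fun n => ?_
    simp
  obtain ⟨h1, h2⟩ := expectation_quadratic (Pv := Pv) (B := B) (lam := lam) (S := S) (t := t)
    (k := k) (a := a) hL hm1 hm2 (fun n => ((L : ℂ) ^ d)⁻¹ ^ 2 * H n) Prod.fst Prod.snd (by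
      intro m m'
      refine Summable.of_norm_bounded
        ((hoff (collisionCoeff B lam L a t m) (collisionCoeff B lam L a t m')
          (summable_collisionCoeff hd ha ht m) (summable_collisionCoeff hd ha ht m')).mul_left (‖((L : ℂ) ^ d)⁻¹ ^ 2‖ * D)) fun n => ?_
      rw [norm_mul, norm_mul (((L : ℂ) ^ d)⁻¹ ^ 2)]
      gcongr
      exact hDb _ _)
  simp_rw [hns]
  refine ⟨h1.const_mul _, ?_⟩
  rw [integral_const_mul, h2]
  congr 1
  refine Finset.sum_congr rfl fun σ _ => ?_
  have hlat := integral_lattice_prod (k := k) hL S (Y := E d × E d) (c := ((L ^ d)⁻¹) ^ 2)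
    (r := fun y => (cellIndex L⁻¹ y.1, cellIndex L⁻¹ y.2))
    (by positivity)
    (((measurable_cellIndex _).comp measurable_fst).prodMk
      ((measurable_cellIndex _).comp measurable_snd)) ?_
    (Φ := fun n => wignerDensity B lam t ε σ (phaseHat fun z => (χ L z.1 : ℂ) * O z)
      (cutAmplitude χ ψ L) ((fun j => dualPt L (n.1 j)), (dualPt L n.2.1, dualPt L n.2.2))) ?_ ?_
  · refine Eq.trans ?_ hlat.symm
    rw [Finset.mul_sum]
    refine Finset.sum_congr rfl fun m _ => ?_
    -- Both momenta are shifted by the same total transfer, since permuting the transfers does not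
    -- change their sum.
    rw [← (Equiv.addRight ((∑ i, m i, ∑ i, m i) : (Fin d → ℤ) × (Fin d → ℤ))).tsum_eq,
      ← tsum_mul_left]
    refine tsum_congr fun n => ?_
    have hsum : dualPt L (∑ i, m i) = ∑ i, dualPt L (m i) := map_sum (dualHom d L) m _
    rw [Equiv.coe_addRight, Prod.fst_add, Prod.snd_add, conj_collisionCoeff_mul hL]
    simp only [wignerDensity, hHdef, Prod.fst_add, Prod.snd_add, dualPt_add, hsum]
    push_cast
    ring
  · intro n
    have : (fun y : E d × E d => (cellIndex L⁻¹ y.1, cellIndex L⁻¹ y.2)) ⁻¹' {n} =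
        (cellIndex L⁻¹ ⁻¹' {n.1}) ×ˢ (cellIndex L⁻¹ ⁻¹' {n.2}) := by
      ext y
      simp [Prod.ext_iff]
    rw [this, Measure.volume_eq_prod, Measure.prod_prod, volume_cellIndex_fiber hL,
      volume_cellIndex_fiber hL, sq, ENNReal.ofReal_mul (by positivity)]
  · intro m hm n
    simp only [wignerDensity]
    rw [historyWeight_dualPt_eq_zero hS hm, zero_mul]
  · intro m
    refine Summable.of_nonneg_of_le (fun _ => norm_nonneg _) (fun n => ?_)
      ((hoff _ _ ha ha).mul_left ((C * ballIndicator k R fun j => dualPt L (m j)) * D))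
    simp only [wignerDensity]
    rw [norm_mul, norm_mul (phaseHat _ _ _), mul_assoc]
    have := ballIndicator_nonneg R fun j => dualPt L (m j)
    exact mul_le_mul (hC σ _ _ _) (mul_le_mul_of_nonneg_right (hDb _ _) (norm_nonneg _))
      (by positivity) (by positivity)

end FiniteBox

end RandomSchrodinger

namespace RandomSchrodinger

/-! ### Feynman values as integrals of the limit densities -/

section FeynmanValue

variable {d k : ℕ} {B : SchwartzMap (E d) ℝ} {lam t : ℝ}

/-- Permuting the factors of a product removes `σ` from the `B̂` factors, and the sign of the
transfer on the conjugated side is absorbed by `Bhat_neg`. -/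
lemma pathFactor_eq (hBrad : ∀ x y : E d, ‖x‖ = ‖y‖ → B x = B y) (ψ : SchwartzMap (E d) ℂ)
    (Q : E d → ℂ) (ξ : E d) (σ : Equiv.Perm (Fin k)) (z : E d × (Fin k → E d)) :
    (lam : ℂ) ^ (2 * k) * (conj (pathKernel B lam t (incrPath (z.1 + ξ) (z.2 ∘ σ))) *
        pathKernel B lam t (incrPath z.1 z.2) * pathFactor B ψ Q ξ σ z) =
      historyWeight B lam t σ z.2 (z.1 + ξ) z.1 *
        (Q ((1 / 2 : ℝ) • ((z.1 + ξ + ∑ j, z.2 j) + (z.1 + ∑ j, z.2 j))) *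
          (conj (𝓕 (fun x => ψ x) (z.1 + ξ)) * 𝓕 (fun x => ψ x) z.1)) := by
  have h1 : ∏ j : Fin k, conj (Bhat B (incrPath (z.1 + ξ) (z.2 ∘ σ) j.castSucc -
      incrPath (z.1 + ξ) (z.2 ∘ σ) j.succ)) = ∏ j, conj (Bhat B (z.2 j)) := by
    rw [← Equiv.prod_comp σ fun j => conj (Bhat B (z.2 j))]
    refine Finset.prod_congr rfl fun j _ => ?_
    rw [incrPath_succ, sub_add_cancel_left, Bhat_neg B hBrad, Function.comp_apply]
  have h2 : ∏ j : Fin k, Bhat B (incrPath z.1 z.2 j.succ - incrPath z.1 z.2 j.castSucc) =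
      ∏ j, Bhat B (z.2 j) := by
    refine Finset.prod_congr rfl fun j _ => ?_
    rw [incrPath_succ, add_sub_cancel_left]
  have h3 : ∑ j, (z.2 ∘ σ) j = ∑ j, z.2 j := Equiv.sum_comp σ z.2
  unfold pathFactor vertexFactor historyWeight
  rw [h1, h2, incrPath_last, incrPath_last, h3, incrPath_zero, incrPath_zero,
    Finset.prod_mul_distrib]
  ring

lemma feynmanValue_eq_integral_normDensity (hd : 3 ≤ d) (hB : HasCompactSupport (Bhat B))
    (hBrad : ∀ x y : E d, ‖x‖ = ‖y‖ → B x = B y) {ψ : SchwartzMap (E d) ℂ}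
    (hψ : HasCompactSupport (𝓕 (fun x => ψ x))) {η : ℝ} (hη : 0 < η) (ht : 0 ≤ t)
    (σ : Equiv.Perm (Fin k)) :
    feynmanValue B lam η t (fun x => ψ x) 0 ⊥ σ (fun _ => 1) =
      ∫ x, normDensity B lam t σ (𝓕 (fun x => ψ x)) x := by
  rw [feynmanValue_bot hd hB hψ lam hη ht k 0 σ continuous_const, ← integral_const_mul]
  simp_rw [pathFactor_eq hBrad, add_zero, one_mul]
  exact integral_prod_swap (μ := (volume : Measure (Fin k → E d))) (ν := (volume : Measure (E d)))
    (normDensity B lam t σ (𝓕 (fun x => ψ x)))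

/-- The difference `ζ` of the two initial momenta replaces the first one as a variable; this shear
is volume preserving. -/
lemma integral_shear {W : (Fin k → E d) × (E d × E d) → ℂ} (hW : Integrable W) :
    ∫ ζ : E d, ∫ z : E d × (Fin k → E d), W (z.2, (z.1 + ζ, z.1)) = ∫ x, W x := by
  have hT : MeasurePreserving fun y : E d × (E d × (Fin k → E d)) =>
      (y.2.2, (y.2.1 + y.1, y.2.1)) := by
    have h1 : MeasurePreserving fun y : E d × (E d × (Fin k → E d)) => (y.2.1 + y.1, y.2) :=
      volume_preserving_skew_fst (g := fun (b : E d × (Fin k → E d)) a => b.1 + a) (by fun_prop)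
        fun b => measurePreserving_add_left volume b.1
    have h2 : MeasurePreserving (fun y : E d × (E d × (Fin k → E d)) => ((y.1, y.2.1), y.2.2)) :=
      (volume_preserving_prodAssoc (α₁ := E d) (β₁ := E d) (γ₁ := Fin k → E d)).symm
    exact volume_preserving_swap.comp (h2.comp h1)
  have hTi : Integrable fun y : E d × (E d × (Fin k → E d)) => W (y.2.2, (y.2.1 + y.1, y.2.1)) :=
    (hT.integrable_comp hW.aestronglyMeasurable).2 hW
  have hTint : ∫ y : E d × (E d × (Fin k → E d)), W (y.2.2, (y.2.1 + y.1, y.2.1)) = ∫ x, W x := by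
    have h := integral_map (φ := fun y : E d × (E d × (Fin k → E d)) =>
      (y.2.2, (y.2.1 + y.1, y.2.1))) (f := W) (μ := volume) hT.measurable.aemeasurable
      (by rw [hT.map_eq]; exact hW.aestronglyMeasurable)
    rw [hT.map_eq] at h
    exact h.symm
  rw [← hTint, Measure.volume_eq_prod (E d) (E d × (Fin k → E d)), integral_prod _ hTi]

lemma wignerDensity_shear {ε : ℝ} (hε : ε ≠ 0) (σ : Equiv.Perm (Fin k)) (H : E d → E d → ℂ)
    (A : E d → ℂ) (ξ z : E d) (w : Fin k → E d) :
    wignerDensity B lam t ε σ H A (w, (z + ε • ξ, z)) =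
      historyWeight B lam t σ w (z + ε • ξ) z *
        (H ξ ((1 / 2 : ℝ) • ((z + ε • ξ + ∑ j, w j) + (z + ∑ j, w j))) *
          (conj (A (z + ε • ξ)) * A z)) := by
  have h1 : ε⁻¹ • ((z + ε • ξ + ∑ j, w j) - (z + ∑ j, w j)) = ξ := by
    rw [add_sub_add_right_eq_sub, add_sub_cancel_left, smul_smul, inv_mul_cancel₀ hε, one_smul]
  unfold wignerDensity
  rw [h1]

lemma feynmanValue_eq_integral_wignerDensity (hd : 3 ≤ d) (hB : HasCompactSupport (Bhat B))
    (hBrad : ∀ x y : E d, ‖x‖ = ‖y‖ → B x = B y) {ψ : SchwartzMap (E d) ℂ}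
    (hψ : HasCompactSupport (𝓕 (fun x => ψ x))) {η : ℝ} (hη : 0 < η) (ht : 0 ≤ t)
    {ε : ℝ} (hε : 0 < ε) (O : SchwartzMap (E d × E d) ℂ) (σ : Equiv.Perm (Fin k)) (ξ : E d) :
    feynmanValue B lam η t (fun x => ψ x) (ε • ξ) ⊥ σ (fun v => phaseHat (fun z => O z) ξ v) =
      ∫ z : E d × (Fin k → E d), wignerDensity B lam t ε σ (phaseHat fun z => O z)
        (𝓕 (fun x => ψ x)) (z.2, (z.1 + ε • ξ, z.1)) := by
  have hQ : Continuous fun v => phaseHat (fun z => O z) ξ v :=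
    (continuous_phaseHat O).comp (f := fun v : E d => (ξ, v)) (by fun_prop)
  rw [feynmanValue_bot hd hB hψ lam hη ht k _ σ hQ, ← integral_const_mul]
  simp_rw [pathFactor_eq hBrad, wignerDensity_shear hε.ne']

/-- The substitution `ζ = εξ` produces `ε^{-d}`, the prefactor of the Wigner pairing. -/
lemma integral_feynmanValue_eq (hd : 3 ≤ d) (hB : HasCompactSupport (Bhat B))
    (hBrad : ∀ x y : E d, ‖x‖ = ‖y‖ → B x = B y) {ψ : SchwartzMap (E d) ℂ}
    (hψ : HasCompactSupport (𝓕 (fun x => ψ x))) {η : ℝ} (hη : 0 < η) (ht : 0 ≤ t)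
    {ε : ℝ} (hε : 0 < ε) (O : SchwartzMap (E d × E d) ℂ) (σ : Equiv.Perm (Fin k))
    (hint : Integrable (wignerDensity B lam t ε σ (phaseHat fun z => O z) (𝓕 (fun x => ψ x)))) :
    ∫ ξ : E d, feynmanValue B lam η t (fun x => ψ x) (ε • ξ) ⊥ σ
      (fun v => phaseHat (fun z => O z) ξ v) = ((ε : ℂ) ^ d)⁻¹ *
      ∫ x, wignerDensity B lam t ε σ (phaseHat fun z => O z) (𝓕 (fun x => ψ x)) x := by
  simp_rw [feynmanValue_eq_integral_wignerDensity hd hB hBrad hψ hη ht hε O σ]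
  rw [← integral_shear hint]
  generalize wignerDensity B lam t ε σ (phaseHat fun z => O z) (𝓕 (fun x => ψ x)) = W
  rw [Measure.integral_comp_smul volume
    (fun ζ : E d => ∫ z : E d × (Fin k → E d), W (z.2, (z.1 + ζ, z.1))) ε,
    finrank_euclideanSpace_fin, abs_of_pos (by positivity), Complex.real_smul]
  push_cast
  rfl

end FeynmanValue

end RandomSchrodinger

/-! ### Conclusion: both sides are the same momentum integrals. -/

theorem proposition6p3 (d : ℕ) (hd : 3 ≤ d)
    -- single-site potential: real, spherically symmetric Schwartz function, `B̂` compactly supported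
    (B : SchwartzMap (E d) ℝ) (hBrad : ∀ x y : E d, ‖x‖ = ‖y‖ → B x = B y)
    (hBsupp : HasCompactSupport (Bhat B)) (hB0 : (0 : E d) ∈ tsupport (Bhat B))
    -- distribution of the random weights
    (Pv : Measure ℝ) [IsProbabilityMeasure Pv]
    (hmom : Integrable (fun v : ℝ => v ^ (2 * d)) Pv)
    (hm1 : ∫ v, v ∂Pv = 0) (hm2 : ∫ v, v ^ 2 ∂Pv = 1)
    (hm3 : ∫ v, v ^ 3 ∂Pv = 0) (hm5 : ∫ v, v ^ 5 ∂Pv = 0)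
    -- initial wave function, with smooth and compactly supported Fourier transform
    (ψ₀ : SchwartzMap (E d) ℂ) (hψ : HasCompactSupport (𝓕 (fun x => ψ₀ x)))
    -- cutoff functions of the boxes
    (χ : ℝ → E d → ℝ) (hχ : IsBoxCutoff χ)
    -- coupling constant, regularization, time, number of collisions
    (lam η t : ℝ) (hlam : 0 < lam) (hη : 0 < η) (ht : 0 ≤ t) (k : ℕ) :
    -- the squared norm
    ((∀ L : ℝ, 1 ≤ L → Integrable
        (fun ω => boxNormSq L (psiNR B lam L t k (fun x => (χ L x : ℂ) * ψ₀ x) ω))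
        (configLaw d L Pv)) ∧
      Tendsto
        (fun L : ℝ => ((∫ ω, boxNormSq L (psiNR B lam L t k (fun x => (χ L x : ℂ) * ψ₀ x) ω)
          ∂(configLaw d L Pv) : ℝ) : ℂ))
        atTop
        (𝓝 (∑ σ : Equiv.Perm (Fin k), ∑ A : Finpartition (Finset.univ : Finset (Fin k)),
          partitionCoeff A * feynmanValue B lam η t (fun x => ψ₀ x) 0 A σ (fun _ => 1)))) ∧
    -- the rescaled Wigner transform tested against an observable
    (∀ (ε : ℝ), 0 < ε → ∀ O : SchwartzMap (E d × E d) ℂ,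
      (∀ L : ℝ, 1 ≤ L → Integrable
        (fun ω => wignerPairing L ε (fun z => (χ L z.1 : ℂ) * O z)
          (psiNR B lam L t k (fun x => (χ L x : ℂ) * ψ₀ x) ω))
        (configLaw d L Pv)) ∧
      Tendsto
        (fun L : ℝ => ∫ ω, wignerPairing L ε (fun z => (χ L z.1 : ℂ) * O z)
          (psiNR B lam L t k (fun x => (χ L x : ℂ) * ψ₀ x) ω) ∂(configLaw d L Pv))
        atTop
        (𝓝 (∑ σ : Equiv.Perm (Fin k), ∑ A : Finpartition (Finset.univ : Finset (Fin k)),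
          partitionCoeff A * ∫ ξ : E d,
            feynmanValue B lam η t (fun x => ψ₀ x) (ε • ξ) A σ
              (fun v => phaseHat (fun z => O z) ξ v)))) := by
  refine ⟨⟨fun L hL => (expectation_boxNormSq hd hBsupp ht hχ ψ₀ hm1 hm2 hL k).1, ?_⟩,
    fun ε hε O => ⟨fun L hL =>
      (expectation_wignerPairing hd hBsupp ht hχ ψ₀ hm1 hm2 hL k hε O).1, ?_⟩⟩
  · simp_rw [sum_partitionCoeff_mul, feynmanValue_eq_integral_normDensity hd hBsupp hBrad hψ hη ht]
    refine Tendsto.congr' ?_ (tendsto_finsetSum _ fun σ _ =>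
      tendsto_integral_normDensity (lam := lam) hd hBsupp ht hχ ψ₀ σ)
    filter_upwards [eventually_ge_atTop 1] with L hL
    exact (expectation_boxNormSq hd hBsupp ht hχ ψ₀ hm1 hm2 hL k).2.symm
  · have hlim := fun σ : Equiv.Perm (Fin k) =>
      tendsto_integral_wignerDensity (lam := lam) hd hBsupp ht hχ ψ₀ ε O σ
    have hval := fun σ : Equiv.Perm (Fin k) =>
      integral_feynmanValue_eq (η := η) hd hBsupp hBrad hψ hη ht hε O σ (hlim σ).1
    simp_rw [sum_partitionCoeff_mul, hval, ← Finset.mul_sum]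
    refine Tendsto.congr' ?_ ((tendsto_finsetSum _ fun σ _ => (hlim σ).2).const_mul _)
    filter_upwards [eventually_ge_atTop 1] with L hL
    exact (expectation_wignerPairing hd hBsupp ht hχ ψ₀ hm1 hm2 hL k hε O).2.symm
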